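/- All graphs are finite, simple and undirected. A path $(v_1,\dots,v_q)$ in a graph $G$ is a cable path if $N_G(v_i)=\{v_{i-1},v_{i+1}\}$ for all $2\le i\le q-1$. A connected core of $G$ is a set $Z\subseteq V(G)$ such that every two vertices of $Z$ are joined by a path in $G[Z]$ (so $Z=\emptyset$ counts as connected), and every connected component of $G-Z$ is either a single vertex or a cable path of $G$ both of whose endpoints have a neighbour in $Z$. There are a constant $c$ and a deterministic algorithm (a program for a random access machine with logarithmic cost, graphs being given by their adjacency matrices) which, given a connected graph $G$ on $n\ge 1$ vertices, a subset $X\subseteq V(G)$ and an integer $k\ge 0$, in time $O(6^k\cdot n^{c})$ either outputs a connected core $Z\supseteq X$ of $G$ with $|Z|\le k$ whose size is minimum among all connected cores of $G$ that contain $X$, or correctly reports that $G$ has no connected core of size at most $k$ that contains $X$. -/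

import Mathlib

/-! ### Cores of graphs -/

namespace SimpleGraph

variable {V : Type*}

/-- A path of `G` is a cable path if every internal vertex has no neighbours in `G` other than its
predecessor and its successor on the path. -/
def Walk.IsCablePath {G : SimpleGraph V} {u v : V} (p : G.Walk u v) : Prop :=
  p.IsPath ∧ ∀ i : ℕ, 0 < i → i < p.length →
    G.neighborSet (p.getVert i) = {p.getVert (i - 1), p.getVert (i + 1)}

/-- `Z` is a core of `G`: every connected component of `G - Z` is an isolated vertex, or it is (as
a subgraph of `G`, so without further edges) a cable path of `G` both of whose endpoints have a
neighbour in `Z`. -/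
def IsCore (G : SimpleGraph V) (Z : Set V) : Prop :=
  ∀ C : (G.induce Zᶜ).ConnectedComponent,
    (∃ v, C.supp = {v}) ∨
    ∃ (u v : V) (p : G.Walk u v), p.IsCablePath ∧
      p.toSubgraph = (⊤ : G.Subgraph).induce (Subtype.val '' C.supp) ∧
      (∃ z ∈ Z, G.Adj u z) ∧ (∃ z ∈ Z, G.Adj v z)

/-- A connected core: a core `Z` such that any two vertices of `Z` are joined by a path of `G[Z]`
(so the empty set counts as a connected set). -/
def IsConnectedCore (G : SimpleGraph V) (Z : Set V) : Prop :=
  G.IsCore Z ∧ (G.induce Z).Preconnected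

/-- `Z` has the minimum size among all connected cores of `G` that contain `X`. -/
def IsMinConnectedCore (G : SimpleGraph V) (X Z : Finset V) : Prop :=
  G.IsConnectedCore (Z : Set V) ∧ X ⊆ Z ∧
    ∀ Z' : Finset V, G.IsConnectedCore (Z' : Set V) → X ⊆ Z' → Z.card ≤ Z'.card

end SimpleGraph

/-! ### Random access machines with logarithmic cost -/

namespace RAM

/-- Registers (addressed by constants of the program) and a memory (addressed through registers),
all of whose cells hold natural numbers. -/
structure State where
  reg : ℕ → ℕ
  mem : ℕ → ℕ

/-- Write the value `x` into register `d`. -/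
def State.setReg (σ : State) (d x : ℕ) : State :=
  { σ with reg := Function.update σ.reg d x }

/-- Write the value `x` into the memory cell with address `a`. -/
def State.setMem (σ : State) (a x : ℕ) : State :=
  { σ with mem := Function.update σ.mem a x }

/-- Basic instructions. The arguments `d`, `a`, `b` are register numbers, `c` is a constant. -/
inductive Instr where
  | const (d c : ℕ)
  | copy (d a : ℕ)
  | add (d a b : ℕ)
  | sub (d a b : ℕ)
  | mul (d a b : ℕ)
  | div (d a b : ℕ)
  | mod (d a b : ℕ)
  | load (d a : ℕ)
  | store (a b : ℕ)

/-- The effect of an instruction (`sub` is truncated subtraction, `x div 0 = 0`, `x mod 0 = x`). -/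
def Instr.apply (σ : State) : Instr → State
  | const d c => σ.setReg d c
  | copy d a => σ.setReg d (σ.reg a)
  | add d a b => σ.setReg d (σ.reg a + σ.reg b)
  | sub d a b => σ.setReg d (σ.reg a - σ.reg b)
  | mul d a b => σ.setReg d (σ.reg a * σ.reg b)
  | div d a b => σ.setReg d (σ.reg a / σ.reg b)
  | mod d a b => σ.setReg d (σ.reg a % σ.reg b)
  | load d a => σ.setReg d (σ.mem (σ.reg a))
  | store a b => σ.setMem (σ.reg a) (σ.reg b)

/-- The logarithmic cost of an instruction: one plus the binary lengths of the numbers and of the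
memory address it handles. Multiplication and division are charged the product of the lengths of
their operands in addition. -/
def Instr.cost (σ : State) : Instr → ℕ
  | const _ c => 1 + Nat.size c
  | copy _ a => 1 + Nat.size (σ.reg a)
  | add _ a b | sub _ a b => 1 + Nat.size (σ.reg a) + Nat.size (σ.reg b)
  | mul _ a b | div _ a b | mod _ a b =>
      1 + Nat.size (σ.reg a) + Nat.size (σ.reg b) + Nat.size (σ.reg a) * Nat.size (σ.reg b)
  | load _ a => 1 + Nat.size (σ.reg a) + Nat.size (σ.mem (σ.reg a))
  | store a b => 1 + Nat.size (σ.reg a) + Nat.size (σ.reg b)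

/-- Programs. The tests ask whether register `a` is nonzero. -/
inductive Program where
  | skip
  | instr (i : Instr)
  | seq (P Q : Program)
  | ite (a : ℕ) (P Q : Program)
  | loop (a : ℕ) (P : Program)

/-- `Exec P σ τ t`: started in state `σ`, the program `P` halts in state `τ` after time `t`. -/
inductive Exec : Program → State → State → ℕ → Prop where
  | skip (σ : State) : Exec .skip σ σ 1
  | instr (i : Instr) (σ : State) : Exec (.instr i) σ (i.apply σ) (i.cost σ)
  | seq {P Q : Program} {σ τ ρ : State} {s t : ℕ} :
      Exec P σ τ s → Exec Q τ ρ t → Exec (.seq P Q) σ ρ (s + t)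
  | iteTrue {a : ℕ} {P Q : Program} {σ τ : State} {t : ℕ} :
      σ.reg a ≠ 0 → Exec P σ τ t → Exec (.ite a P Q) σ τ (1 + Nat.size (σ.reg a) + t)
  | iteFalse {a : ℕ} {P Q : Program} {σ τ : State} {t : ℕ} :
      σ.reg a = 0 → Exec Q σ τ t → Exec (.ite a P Q) σ τ (1 + Nat.size (σ.reg a) + t)
  | loopStep {a : ℕ} {P : Program} {σ τ ρ : State} {s t : ℕ} :
      σ.reg a ≠ 0 → Exec P σ τ s → Exec (.loop a P) τ ρ t →
      Exec (.loop a P) σ ρ (1 + Nat.size (σ.reg a) + s + t)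
  | loopEnd {a : ℕ} {P : Program} {σ : State} :
      σ.reg a = 0 → Exec (.loop a P) σ σ (1 + Nat.size (σ.reg a))

end RAM

/-! ### The computational problem -/

namespace MinConnectedCore

open Classical in
/-- The initial state for the input `(G, X, k)`: register `0` holds `n`, register `1` holds `k`,
memory cells `0, …, n - 1` hold the indicator function of `X`, the next `n * n` cells hold the
adjacency matrix of `G` row by row, and everything else is `0`. -/
noncomputable def input {n : ℕ} (G : SimpleGraph (Fin n)) (X : Finset (Fin n)) (k : ℕ) :
    RAM.State where
  reg i := if i = 0 then n else if i = 1 then k else 0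
  mem a :=
    if (∃ v ∈ X, a = (v : ℕ)) ∨ (∃ u v : Fin n, G.Adj u v ∧ a = n + n * (u : ℕ) + (v : ℕ))
    then 1 else 0

/-- Reading the output off a final state: register `0` holds `0` for the answer "there is none", and
otherwise `1`, in which case memory cells `0, …, n - 1` hold the indicator function of the set. -/
def Outputs {n : ℕ} (σ : RAM.State) : Option (Finset (Fin n)) → Prop
  | none => σ.reg 0 = 0
  | some Z => σ.reg 0 = 1 ∧ ∀ v : Fin n, σ.mem (v : ℕ) = if v ∈ Z then 1 else 0

/-- The correct answers for the input `(G, X, k)`. -/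
def IsAnswer {n : ℕ} (G : SimpleGraph (Fin n)) (X : Finset (Fin n)) (k : ℕ) :
    Option (Finset (Fin n)) → Prop
  | none => ¬ ∃ Z : Finset (Fin n), G.IsConnectedCore (Z : Set (Fin n)) ∧ X ⊆ Z ∧ Z.card ≤ k
  | some Z => G.IsMinConnectedCore X Z ∧ Z.card ≤ k

end MinConnectedCore

/-! Call `a`, `b`, `c` an obstruction if `b` and `c` are neighbours of `a` and either `b ≠ c` and
`a` has degree at least three, or `a` has degree one (so `b = c`). Every core meets every
obstruction (`IsCore.hits`), and in a connected graph a nonempty set that meets every obstruction is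
a core (`isCore_of_hits`). Hence being a core is, apart from emptiness, a hitting set condition with
sets of size at most three, and it passes to supersets.

Put `K = min n k`. If `Z ⊇ X` is a connected core with at most `K` vertices, then branching three
ways on an unhit obstruction, at most `K` times, leads for one of the `3 ^ K` guiding numbers to a
set `S` with `X ⊆ S ⊆ Z` that hits all obstructions (`exists_branch`). Conversely, every nonempty
connected superset of such an `S` is a connected core. What remains is an unweighted Steiner tree
problem with terminal set `S`, `|S| ≤ K`: is there a connected set of at most `i + 1` vertices that
contains `S`?

It is solved by counting branching walks. Their vertex sets are connected with at most `i + 1`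
elements, and each connected set of exactly `i + 1` vertices occurs (`of_branchingWalks_pos`,
`branchingWalks_pos`). The number of branching walks that visit all of `S` is a signed sum over the
subsets of `S` declared forbidden (`sum_signedTerm`, `sum_signedCount`); each summand obeys a
recurrence over vertices and lengths and takes polynomial time (`branchingWeight_succ`,
`walkCount_eq`). The true total is below the modulus `2 ^ B`, so counting modulo `2 ^ B` loses
nothing (`sumProg_spec`). Together this makes `3 ^ K * 2 ^ K ≤ 6 ^ k` rounds.

The least successful `i` gives the minimum size (`sizeProg_spec`), and a minimum core is then built
by self-reduction, keeping a vertex exactly if a core of that size still exists (`extendProg_spec`).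
Graphs with one vertex are separate, since there the empty set is a core.

The machine model is handled by a language of bounded loops. It has a total semantics `St.den` and a
cost function `St.cost` that the compiled code respects (`St.exec_code`). A syntactic check, decided
by computation, bounds the cost by a constant times a product of loop bounds times a square of the
word length (`St.cost_le`). -/

namespace RAM

/-! ### States -/

@[simp] theorem State.setReg_reg (σ : State) (d x r : ℕ) :
    (σ.setReg d x).reg r = if r = d then x else σ.reg r := by
  simp [State.setReg, Function.update_apply]

@[simp] theorem State.setReg_mem (σ : State) (d x : ℕ) : (σ.setReg d x).mem = σ.mem := rfl

@[simp] theorem State.setMem_reg (σ : State) (a x : ℕ) : (σ.setMem a x).reg = σ.reg := rfl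

theorem State.setMem_mem (σ : State) (a x b : ℕ) :
    (σ.setMem a x).mem b = if b = a then x else σ.mem b := by
  simp [State.setMem, Function.update_apply]

/-! ### A small structured language

Variables are the registers below `varBound`; the registers above it serve for the evaluation of
expressions. -/

/-- The number of registers that serve as variables. -/
abbrev varBound : ℕ := 40

/-- The variable that holds the modulus by which growing quantities are reduced. -/
abbrev modVar : ℕ := 4

/-- Arithmetic operations. -/
inductive Op where
  | add | sub | mul | div | mod

/-- The function computed by an operation. -/
def Op.fn : Op → ℕ → ℕ → ℕ
  | add, a, b => a + b
  | sub, a, b => a - b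
  | mul, a, b => a * b
  | div, a, b => a / b
  | mod, a, b => a % b

/-- The instruction of an operation. -/
def Op.instr : Op → ℕ → ℕ → ℕ → Instr
  | add => .add
  | sub => .sub
  | mul => .mul
  | div => .div
  | mod => .mod

/-- Arithmetic expressions with memory access. -/
inductive Ex where
  | c (k : ℕ)
  | v (r : ℕ)
  | bin (o : Op) (a b : Ex)
  | ld (a : Ex)

namespace Ex

instance : Add Ex := ⟨bin .add⟩
instance : Sub Ex := ⟨bin .sub⟩
instance : Mul Ex := ⟨bin .mul⟩
instance : Div Ex := ⟨bin .div⟩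
instance : Mod Ex := ⟨bin .mod⟩

/-- The value of an expression. -/
def eval (σ : State) : Ex → ℕ
  | c k => k
  | v r => σ.reg r
  | bin o a b => o.fn (a.eval σ) (b.eval σ)
  | ld a => σ.mem (a.eval σ)

@[simp] theorem eval_c (σ : State) (k : ℕ) : (c k).eval σ = k := rfl
@[simp] theorem eval_v (σ : State) (r : ℕ) : (v r).eval σ = σ.reg r := rfl
@[simp] theorem eval_add (σ : State) (a b : Ex) : (a + b).eval σ = a.eval σ + b.eval σ := rfl
@[simp] theorem eval_sub (σ : State) (a b : Ex) : (a - b).eval σ = a.eval σ - b.eval σ := rfl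
@[simp] theorem eval_mul (σ : State) (a b : Ex) : (a * b).eval σ = a.eval σ * b.eval σ := rfl
@[simp] theorem eval_div (σ : State) (a b : Ex) : (a / b).eval σ = a.eval σ / b.eval σ := rfl
@[simp] theorem eval_mod (σ : State) (a b : Ex) : (a % b).eval σ = a.eval σ % b.eval σ := rfl
@[simp] theorem eval_ld (σ : State) (a : Ex) : (ld a).eval σ = σ.mem (a.eval σ) := rfl

/-- The code that evaluates an expression into register `d`, using registers from `d` on. -/
def code : Ex → ℕ → Program
  | c k, d => .instr (.const d k)
  | v r, d => .instr (.copy d r)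
  | bin o a b, d => .seq (a.code d) (.seq (b.code (d + 1)) (.instr (o.instr d d (d + 1))))
  | ld a, d => .seq (a.code d) (.instr (.load d d))

/-- A bound for the running time of the code of an expression. -/
def cost (σ : State) : Ex → ℕ
  | c k => 1 + Nat.size k
  | v r => 1 + Nat.size (σ.reg r)
  | bin _ a b => a.cost σ + (b.cost σ + (1 + Nat.size (a.eval σ) + Nat.size (b.eval σ) +
      Nat.size (a.eval σ) * Nat.size (b.eval σ)))
  | ld a => a.cost σ + (1 + Nat.size (a.eval σ) + Nat.size (σ.mem (a.eval σ)))

/-- All variables of the expression are below `varBound`. -/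
def wf : Ex → Bool
  | c _ => true
  | v r => decide (r < varBound)
  | bin _ a b => a.wf && b.wf
  | ld a => a.wf

end Ex

/-- The states have the same memory and the same variables. -/
def Agree (σ τ : State) : Prop := τ.mem = σ.mem ∧ ∀ r < varBound, τ.reg r = σ.reg r

theorem Agree.setReg {σ τ : State} (h : Agree σ τ) (d x : ℕ) :
    Agree (σ.setReg d x) (τ.setReg d x) :=
  ⟨h.1, fun r hr => by simp [h.2 r hr]⟩

theorem Agree.of_temp {σ τ τ' : State} (h : Agree σ τ) (hm : τ'.mem = τ.mem)
    (hr : ∀ r < varBound, τ'.reg r = τ.reg r) : Agree σ τ' :=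
  ⟨hm.trans h.1, fun r hr' => (hr r hr').trans (h.2 r hr')⟩

theorem Op.apply_instr (o : Op) (σ : State) (d a b : ℕ) :
    (o.instr d a b).apply σ = σ.setReg d (o.fn (σ.reg a) (σ.reg b)) := by
  cases o <;> rfl

theorem Op.cost_instr_le (o : Op) (σ : State) (d a b : ℕ) :
    (o.instr d a b).cost σ ≤ 1 + Nat.size (σ.reg a) + Nat.size (σ.reg b) +
      Nat.size (σ.reg a) * Nat.size (σ.reg b) := by
  cases o <;> simp [Op.instr, Instr.cost]

/-- Evaluation into `d` leaves all registers below `d` alone, so the first operand survives in `d`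
while the second is evaluated into `d + 1`. Value and cost refer to the ideal state `σ`; the machine
state `τ` may differ from it in the scratch registers. -/
theorem Ex.exec_code (e : Ex) : ∀ (d : ℕ) (σ τ : State), e.wf = true → varBound ≤ d →
    Agree σ τ → ∃ τ' t, Exec (e.code d) τ τ' t ∧ t ≤ e.cost σ ∧ τ'.mem = τ.mem ∧
      τ'.reg d = e.eval σ ∧ ∀ r < d, τ'.reg r = τ.reg r := by
  induction e with
  | c k =>
    intro d σ τ _ _ _
    exact ⟨_, _, .instr _ _, le_rfl, rfl, by simp [Instr.apply],
      fun r hr => by simp [Instr.apply, hr.ne]⟩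
  | v r =>
    intro d σ τ hwf _ h
    have hr : τ.reg r = σ.reg r := h.2 r (by simpa [wf] using hwf)
    refine ⟨_, _, .instr _ _, ?_, rfl, by simp [Instr.apply, hr],
      fun r hr => by simp [Instr.apply, hr.ne]⟩
    simp [Instr.cost, cost, hr]
  | bin o a b iha ihb =>
    intro d σ τ hwf hd h
    simp only [wf, Bool.and_eq_true] at hwf
    obtain ⟨τ₁, t₁, e₁, c₁, m₁, v₁, f₁⟩ := iha d σ τ hwf.1 hd h
    have h₁ : Agree σ τ₁ := h.of_temp m₁ fun r hr => f₁ r (hr.trans_le hd)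
    obtain ⟨τ₂, t₂, e₂, c₂, m₂, v₂, f₂⟩ := ihb (d + 1) σ τ₁ hwf.2 (by omega) h₁
    have hd₂ : τ₂.reg d = a.eval σ := by rw [f₂ d (by omega), v₁]
    refine ⟨_, _, .seq e₁ (.seq e₂ (.instr _ _)), ?_, ?_, ?_, ?_⟩
    · have := o.cost_instr_le τ₂ d d (d + 1)
      rw [hd₂, v₂] at this
      simp only [cost]
      omega
    · rw [Op.apply_instr]; simp [m₂, m₁]
    · rw [Op.apply_instr]; simp [hd₂, v₂, eval]
    · intro r hr
      rw [Op.apply_instr]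
      simp [hr.ne, f₂ r (by omega), f₁ r hr]
  | ld a iha =>
    intro d σ τ hwf hd h
    obtain ⟨τ₁, t₁, e₁, c₁, m₁, v₁, f₁⟩ := iha d σ τ hwf hd h
    refine ⟨_, _, .seq e₁ (.instr _ _), ?_, ?_, ?_, ?_⟩
    · simp only [Instr.cost, cost, v₁, m₁, h.1]
      omega
    · simp [Instr.apply, m₁]
    · simp [Instr.apply, v₁, m₁, h.1, eval]
    · intro r hr
      simp [Instr.apply, hr.ne, f₁ r hr]

/-- Statements. The loop `for_ x e s` runs `s` for `x = e - 1, …, 1, 0`. -/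
inductive St where
  | skip
  | set (x : ℕ) (e : Ex)
  | store (a e : Ex)
  | seq (s t : St)
  | ite (e : Ex) (s t : St)
  | for_ (x : ℕ) (e : Ex) (s : St)

/-- The effect of a loop with body `f` for the remaining values of the loop variable `x`. -/
def loopDen (f : State → State) (x : ℕ) : ℕ → State → State
  | 0, σ => σ
  | N + 1, σ => loopDen f x N (f (σ.setReg x N))

/-- A bound for the running time of a loop. -/
def loopCost (f : State → State) (g : State → ℕ) (x : ℕ) : ℕ → State → ℕ
  | 0, _ => 1
  | N + 1, σ => 5 + 2 * Nat.size (N + 1) + g (σ.setReg x N) +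
      loopCost f g x N (f (σ.setReg x N))

namespace St

/-- The effect of a statement. -/
def den : St → State → State
  | skip, σ => σ
  | set x e, σ => σ.setReg x (e.eval σ)
  | store a e, σ => σ.setMem (a.eval σ) (e.eval σ)
  | seq s t, σ => t.den (s.den σ)
  | ite e s t, σ => if e.eval σ ≠ 0 then s.den σ else t.den σ
  | for_ x e s, σ => loopDen s.den x (e.eval σ) (σ.setReg x (e.eval σ))

/-- A bound for the running time of the code of a statement. -/
def cost : St → State → ℕ
  | skip, _ => 1
  | set _ e, σ => e.cost σ + (1 + Nat.size (e.eval σ))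
  | store a e, σ => a.cost σ + (e.cost σ + (1 + Nat.size (a.eval σ) + Nat.size (e.eval σ)))
  | seq s t, σ => s.cost σ + t.cost (s.den σ)
  | ite e s t, σ => e.cost σ + (1 + Nat.size (e.eval σ) +
      if e.eval σ ≠ 0 then s.cost σ else t.cost σ)
  | for_ x e s, σ => e.cost σ + (1 + Nat.size (e.eval σ) +
      loopCost s.den s.cost x (e.eval σ) (σ.setReg x (e.eval σ)))

/-- The code of a statement. -/
def code : St → Program
  | skip => .skip
  | set x e => .seq (e.code varBound) (.instr (.copy x varBound))
  | store a e => .seq (a.code varBound) (.seq (e.code (varBound + 1))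
      (.instr (.store varBound (varBound + 1))))
  | seq s t => .seq s.code t.code
  | ite e s t => .seq (e.code varBound) (.ite varBound s.code t.code)
  | for_ x e s => .seq (e.code varBound) (.seq (.instr (.copy x varBound))
      (.loop x (.seq (.seq (.instr (.const varBound 1)) (.instr (.sub x x varBound))) s.code)))

/-- The statement may write the variable. -/
def wr : St → ℕ → Bool
  | skip, _ => false
  | set x _, r => r == x
  | store _ _, _ => false
  | seq s t, r => s.wr r || t.wr r
  | ite _ s t, r => s.wr r || t.wr r
  | for_ x _ s, r => r == x || s.wr r

/-- The statement contains no `store`. -/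
def noStore : St → Bool
  | skip => true
  | set _ _ => true
  | store _ _ => false
  | seq s t => s.noStore && t.noStore
  | ite _ s t => s.noStore && t.noStore
  | for_ _ _ s => s.noStore

/-- Only proper variables are used, and no loop writes its loop variable. -/
def wf : St → Bool
  | skip => true
  | set x e => decide (x < varBound) && e.wf
  | store a e => a.wf && e.wf
  | seq s t => s.wf && t.wf
  | ite e s t => e.wf && (s.wf && t.wf)
  | for_ x e s => decide (x < varBound) && (e.wf && (s.wf && !s.wr x))

theorem den_reg (s : St) : ∀ {r : ℕ}, s.wr r = false → ∀ σ, (s.den σ).reg r = σ.reg r := by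
  induction s with
  | skip => intros; rfl
  | set x e => intro r h σ; simp_all [wr, den]
  | store a e => intros; rfl
  | seq s t ihs iht =>
    intro r h σ
    simp only [wr, Bool.or_eq_false_iff] at h
    simp [den, ihs h.1, iht h.2]
  | ite e s t ihs iht =>
    intro r h σ
    simp only [wr, Bool.or_eq_false_iff] at h
    simp only [den]
    split_ifs
    · exact ihs h.1 σ
    · exact iht h.2 σ
  | for_ x e s ih =>
    intro r h σ
    simp only [wr, Bool.or_eq_false_iff, beq_eq_false_iff_ne] at h
    have : ∀ N σ, (loopDen s.den x N σ).reg r = σ.reg r := by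
      intro N
      induction N with
      | zero => intro σ; rfl
      | succ N ihN => intro σ; simp [loopDen, ihN, ih h.2, h.1]
    simp [den, this, h.1]

theorem den_mem (s : St) : s.noStore = true → ∀ σ, (s.den σ).mem = σ.mem := by
  induction s with
  | skip => intros; rfl
  | set x e => intros; rfl
  | store a e => intro h; simp [noStore] at h
  | seq s t ihs iht =>
    intro h σ
    simp only [noStore, Bool.and_eq_true] at h
    simp [den, ihs h.1, iht h.2]
  | ite e s t ihs iht =>
    intro h σ
    simp only [noStore, Bool.and_eq_true] at h
    simp only [den]
    split_ifs
    · exact ihs h.1 σ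
    · exact iht h.2 σ
  | for_ x e s ih =>
    intro h σ
    have : ∀ N σ, (loopDen s.den x N σ).mem = σ.mem := by
      intro N
      induction N with
      | zero => intro σ; rfl
      | succ N ihN => intro σ; simp [loopDen, ihN, ih h]
    simp [den, this]

/-- The rule for loops: `I i` holds when the values `i - 1, …, 0` of the loop variable remain. -/
theorem den_for (I : ℕ → State → Prop) {x : ℕ} {e : Ex} {s : St} {σ : State} {N : ℕ}
    (hN : e.eval σ = N) (start : I N (σ.setReg x N))
    (step : ∀ i < N, ∀ τ : State, (∀ r, (for_ x e s).wr r = false → τ.reg r = σ.reg r) →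
      (s.noStore = true → τ.mem = σ.mem) → I (i + 1) τ → I i (s.den (τ.setReg x i))) :
    I 0 ((for_ x e s).den σ) := by
  subst hN
  have key : ∀ i ≤ e.eval σ, ∀ τ : State,
      (∀ r, (for_ x e s).wr r = false → τ.reg r = σ.reg r) →
      (s.noStore = true → τ.mem = σ.mem) → I i τ → I 0 (loopDen s.den x i τ) := by
    intro i
    induction i with
    | zero => intro _ τ _ _ h; exact h
    | succ i ih =>
      intro hi τ hr hm h
      refine ih (by omega) _ ?_ ?_ (step i (by omega) τ hr hm h)
      · intro r h
        have h' := h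
        simp only [wr, Bool.or_eq_false_iff, beq_eq_false_iff_ne] at h'
        rw [den_reg s h'.2, State.setReg_reg, if_neg h'.1, hr r h]
      · intro h; rw [den_mem s h]; exact hm h
  refine key _ le_rfl _ ?_ (fun _ => rfl) start
  intro r h
  simp only [wr, Bool.or_eq_false_iff, beq_eq_false_iff_ne] at h
  simp [h.1]

/-- The simulation is up to `Agree` because compiled code spoils scratch registers, which no
statement reads. In a compiled loop the loop variable is itself the counter, decremented before the
body runs; as the body does not write it, it still holds the number of remaining passes at the next
test. -/
theorem exec_code (s : St) : ∀ σ τ : State, s.wf = true → Agree σ τ →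
    ∃ τ' t, Exec s.code τ τ' t ∧ t ≤ s.cost σ ∧ Agree (s.den σ) τ' := by
  induction s with
  | skip => intro σ τ _ h; exact ⟨_, _, .skip _, le_rfl, h⟩
  | set x e =>
    intro σ τ hwf h
    simp only [wf, Bool.and_eq_true, decide_eq_true_eq] at hwf
    obtain ⟨τ₁, t₁, e₁, c₁, m₁, v₁, f₁⟩ := e.exec_code varBound σ τ hwf.2 le_rfl h
    refine ⟨_, _, .seq e₁ (.instr _ _), ?_, ?_⟩
    · simp only [Instr.cost, cost, v₁]; omega
    · simp only [Instr.apply, v₁, den]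
      exact (h.of_temp m₁ f₁).setReg _ _
  | store a e =>
    intro σ τ hwf h
    simp only [wf, Bool.and_eq_true] at hwf
    obtain ⟨τ₁, t₁, e₁, c₁, m₁, v₁, f₁⟩ := a.exec_code varBound σ τ hwf.1 le_rfl h
    have h₁ := h.of_temp m₁ f₁
    obtain ⟨τ₂, t₂, e₂, c₂, m₂, v₂, f₂⟩ := e.exec_code (varBound + 1) σ τ₁ hwf.2 (by simp) h₁
    have hv : τ₂.reg varBound = a.eval σ := by rw [f₂ _ (by simp), v₁]
    have h₂ := h₁.of_temp m₂ fun r hr => f₂ r (by omega)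
    refine ⟨_, _, .seq e₁ (.seq e₂ (.instr _ _)), ?_, ?_⟩
    · simp only [Instr.cost, cost, v₂, hv]; omega
    · simp only [Instr.apply, v₂, hv, den]
      exact ⟨by simp [State.setMem, h₂.1], h₂.2⟩
  | seq s t ihs iht =>
    intro σ τ hwf h
    simp only [wf, Bool.and_eq_true] at hwf
    obtain ⟨τ₁, t₁, e₁, c₁, a₁⟩ := ihs σ τ hwf.1 h
    obtain ⟨τ₂, t₂, e₂, c₂, a₂⟩ := iht _ τ₁ hwf.2 a₁
    exact ⟨_, _, .seq e₁ e₂, add_le_add c₁ c₂, a₂⟩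
  | ite e s t ihs iht =>
    intro σ τ hwf h
    simp only [wf, Bool.and_eq_true] at hwf
    obtain ⟨τ₁, t₁, e₁, c₁, m₁, v₁, f₁⟩ := e.exec_code varBound σ τ hwf.1 le_rfl h
    have h₁ := h.of_temp m₁ f₁
    by_cases he : e.eval σ = 0
    · obtain ⟨τ₂, t₂, e₂, c₂, a₂⟩ := iht σ τ₁ hwf.2.2 h₁
      refine ⟨_, _, .seq e₁ (.iteFalse (v₁.trans he) e₂), ?_, ?_⟩
      · simp only [cost, v₁, he, ne_eq, not_true, if_false]; simp; omega
      · simpa [den, he] using a₂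
    · obtain ⟨τ₂, t₂, e₂, c₂, a₂⟩ := ihs σ τ₁ hwf.2.1 h₁
      refine ⟨_, _, .seq e₁ (.iteTrue (by rwa [v₁]) e₂), ?_, ?_⟩
      · simp only [cost, v₁, he, ne_eq, not_false_iff, if_true]; omega
      · simpa [den, he] using a₂
  | for_ x e s ih =>
    intro σ τ hwf h
    simp only [wf, Bool.and_eq_true, decide_eq_true_eq, Bool.not_eq_true'] at hwf
    obtain ⟨hx, he, hs, hw⟩ := hwf
    obtain ⟨τ₁, t₁, e₁, c₁, m₁, v₁, f₁⟩ := e.exec_code varBound σ τ he le_rfl h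
    have h₁ := h.of_temp m₁ f₁
    have key : ∀ (N : ℕ) (σ τ : State), Agree σ τ → σ.reg x = N →
        ∃ τ' t, Exec (.loop x (.seq (.seq (.instr (.const varBound 1))
          (.instr (.sub x x varBound))) s.code)) τ τ' t ∧ t ≤ loopCost s.den s.cost x N σ ∧
          Agree (loopDen s.den x N σ) τ' := by
      intro N
      induction N with
      | zero =>
        intro σ τ h hN
        have h0 : τ.reg x = 0 := by rw [h.2 x hx, hN]
        exact ⟨_, _, .loopEnd h0, by simp [loopCost, h0], h⟩
      | succ N ihN =>
        intro σ τ h hN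
        have h0 : τ.reg x = N + 1 := by rw [h.2 x hx, hN]
        set τ₂ := (Instr.sub x x varBound).apply ((Instr.const varBound 1).apply τ) with hτ₂
        have h₂ : Agree (σ.setReg x N) τ₂ := by
          refine ⟨h.1, fun r hr => ?_⟩
          by_cases hrx : r = x
          · subst hrx; simp [hτ₂, Instr.apply, hx.ne, h0]
          · simp [hτ₂, Instr.apply, hrx, hr.ne, h.2 r hr]
        obtain ⟨τ₃, t₃, e₃, c₃, a₃⟩ := ih _ _ hs h₂
        obtain ⟨τ₄, t₄, e₄, c₄, a₄⟩ := ihN _ τ₃ a₃ (by simp [den_reg s hw])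
        refine ⟨_, _, .loopStep (by omega) (.seq (.seq (.instr _ _) (.instr _ _)) e₃) e₄, ?_, a₄⟩
        -- The overhead `5 + 2 * size (N + 1)` of a pass: `1 + size (N + 1)` for the test, `2` for
        -- loading the constant one, and `2 + size (N + 1)` for the subtraction.
        have hs1 : Nat.size 1 = 1 := by simp
        simp only [loopCost, Instr.cost, Instr.apply, State.setReg_reg, hx.ne, if_false, h0,
          if_true, hs1]
        omega
    obtain ⟨τ₂, t₂, e₂, c₂, a₂⟩ := key (e.eval σ) (σ.setReg x (e.eval σ))
      (τ₁.setReg x (e.eval σ)) (h₁.setReg _ _) (by simp)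
    refine ⟨_, _, .seq e₁ (.seq (.instr _ _) (by simpa only [Instr.apply, v₁] using e₂)), ?_, a₂⟩
    simp only [Instr.cost, cost, v₁]
    omega

end St

/-! ### Running times -/

/-- All variables and memory cells are below `2 ^ B`. -/
def Sized (B : ℕ) (σ : State) : Prop :=
  (∀ r < varBound, σ.reg r < 2 ^ B) ∧ ∀ a, σ.mem a < 2 ^ B

theorem Sized.setReg {B : ℕ} {σ : State} (h : Sized B σ) (d : ℕ) {x : ℕ} (hx : x < 2 ^ B) :
    Sized B (σ.setReg d x) := by
  refine ⟨fun r hr => ?_, h.2⟩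
  rw [State.setReg_reg]
  split_ifs
  exacts [hx, h.1 r hr]

theorem Sized.setMem {B : ℕ} {σ : State} (h : Sized B σ) (a : ℕ) {x : ℕ} (hx : x < 2 ^ B) :
    Sized B (σ.setMem a x) := by
  refine ⟨h.1, fun b => ?_⟩
  rw [State.setMem_mem]
  split_ifs
  exacts [hx, h.2 b]

namespace Ex

/-- The factor by which an expression can exceed the length of the numbers in it. -/
def len : Ex → ℕ
  | c k => Nat.size k + 1
  | v _ => 1
  | bin _ a b => a.len + b.len
  | ld _ => 1

/-- Sums and products of numbers below `2 ^ x` and `2 ^ y` with `x, y ≥ 1` are below `2 ^ (x + y)`,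
and the other operations do not exceed their first operand. A load starts afresh, since every cell
is below `2 ^ B`. Taking `B + 1` instead of `B`, with `1 ≤ e.len`, keeps the exponents positive. -/
theorem size_eval_le {B : ℕ} {σ : State} (h : Sized B σ) (e : Ex) (hwf : e.wf = true) :
    Nat.size (e.eval σ) ≤ e.len * (B + 1) ∧ 1 ≤ e.len := by
  induction e with
  | c k => simp only [eval, len]; constructor <;> nlinarith
  | v r =>
    have := Nat.size_le.2 (h.1 r (by simpa [wf] using hwf))
    simp only [eval, len]; omega
  | ld a _ =>
    have := Nat.size_le.2 (h.2 (a.eval σ))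
    simp only [eval, len]; omega
  | bin o a b iha ihb =>
    simp only [wf, Bool.and_eq_true] at hwf
    obtain ⟨ha, la⟩ := iha hwf.1
    obtain ⟨hb, lb⟩ := ihb hwf.2
    refine ⟨?_, by simp only [len]; omega⟩
    rw [Nat.size_le] at ha hb ⊢
    have hpa : 1 ≤ a.len * (B + 1) := Nat.mul_pos la (by omega)
    have hpb : 1 ≤ b.len * (B + 1) := Nat.mul_pos lb (by omega)
    have h2 : 2 ≤ 2 ^ (a.len * (B + 1)) := Nat.le_self_pow (by omega) 2
    have h3 : 2 ≤ 2 ^ (b.len * (B + 1)) := Nat.le_self_pow (by omega) 2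
    have hle : ∀ x, x ≤ a.eval σ → x < 2 ^ (a.len * (B + 1)) * 2 ^ (b.len * (B + 1)) := by
      intro x hx; nlinarith
    simp only [eval, len, add_mul, pow_add]
    cases o
    · simp only [Op.fn]; nlinarith
    · exact hle _ (Nat.sub_le _ _)
    · exact Nat.mul_lt_mul'' ha hb
    · exact hle _ (Nat.div_le_self _ _)
    · exact hle _ (Nat.mod_le _ _)

/-- The constant in the running time of an expression. -/
def cst : Ex → ℕ
  | c k => 1 + Nat.size k
  | v _ => 1
  | bin _ a b => a.cst + b.cst + (1 + a.len + b.len + a.len * b.len)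
  | ld a => a.cst + (2 + a.len)

/-- The square comes from multiplication and division, which are charged the product of two lengths,
each linear in `B + 1`. -/
theorem cost_le {B : ℕ} {σ : State} (h : Sized B σ) (e : Ex) (hwf : e.wf = true) :
    e.cost σ ≤ e.cst * (B + 1) ^ 2 := by
  induction e with
  | c k => exact Nat.le_mul_of_pos_right _ (by positivity)
  | v r =>
    have := Nat.size_le.2 (h.1 r (by simpa [wf] using hwf))
    simp only [cost, cst]; nlinarith
  | ld a iha =>
    have h1 := Nat.size_le.2 (h.2 (a.eval σ))
    have h2 := (a.size_eval_le h hwf).1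
    have h3 := iha hwf
    simp only [cost, cst]
    nlinarith [Nat.zero_le (a.len * B), Nat.zero_le (a.len * B ^ 2)]
  | bin o a b iha ihb =>
    simp only [wf, Bool.and_eq_true] at hwf
    have h1 := (a.size_eval_le h hwf.1).1
    have h2 := (b.size_eval_le h hwf.2).1
    have h3 := Nat.mul_le_mul h1 h2
    have h4 := iha hwf.1
    have h5 := ihb hwf.2
    simp only [cost, cst]
    nlinarith [Nat.zero_le (a.len * B), Nat.zero_le (a.len * B ^ 2), Nat.zero_le (b.len * B),
      Nat.zero_le (b.len * B ^ 2)]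

/-- A syntactic criterion for the value to be below `2 ^ B`. -/
def small : Ex → Bool
  | c k => decide (k ≤ 1)
  | v _ => true
  | ld _ => true
  | bin .sub a _ => a.small
  | bin .div a _ => a.small
  | bin .mod a (v r) => a.small || r == modVar
  | bin .mod a _ => a.small
  | bin _ _ _ => false

/-- Differences, quotients and remainders do not exceed the first operand, and a remainder modulo
the positive variable `modVar` is less than that variable. Sums and products are therefore admitted
only below a remainder or in places that do not influence the bound. -/
theorem eval_lt {B : ℕ} (hB : 1 ≤ B) {σ : State} (h : Sized B σ) (hM : 0 < σ.reg modVar) :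
    ∀ e : Ex, e.wf = true → e.small = true → e.eval σ < 2 ^ B := by
  intro e
  induction e with
  | c k =>
    intro _ hs
    have h2 : 2 ≤ 2 ^ B := Nat.le_self_pow (by omega) 2
    simp only [small, decide_eq_true_eq] at hs
    simp only [eval]; omega
  | v r => intro hwf _; exact h.1 r (by simpa [wf] using hwf)
  | ld a _ => intro _ _; exact h.2 _
  | bin o a b iha _ =>
    intro hwf hs
    simp only [wf, Bool.and_eq_true] at hwf
    cases o with
    | add => simp [small] at hs
    | mul => simp [small] at hs
    | sub => exact (Nat.sub_le _ _).trans_lt (iha hwf.1 hs)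
    | div => exact (Nat.div_le_self _ _).trans_lt (iha hwf.1 hs)
    | mod =>
      by_cases ha : a.small = true
      · exact (Nat.mod_le _ _).trans_lt (iha hwf.1 ha)
      · simp only [Bool.not_eq_true] at ha
        cases b with
        | v r =>
          simp only [small, ha, Bool.false_or, beq_iff_eq] at hs
          subst hs
          exact (Nat.mod_lt _ hM).trans (h.1 _ (by decide))
        | c | bin | ld => simp [small, ha] at hs

/-- The variable that bounds the expression from above. -/
def base : Ex → Option ℕ
  | v r => some r
  | bin .sub a _ => a.base
  | _ => none

theorem eval_le_base {σ : State} {r : ℕ} : ∀ e : Ex, e.base = some r → e.eval σ ≤ σ.reg r := by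
  intro e
  induction e with
  | v r' => intro h; cases h; exact le_rfl
  | c | ld => intro h; cases h
  | bin o a b iha _ =>
    intro h
    cases o with
    | sub => exact (Nat.sub_le _ _).trans (iha h)
    | add | mul | div | mod => cases h

end Ex

/-! ### Cost bounds for statements that pass a syntactic check -/

namespace St

/-- A syntactic criterion for all numbers to remain small, and for all loops to be bounded by
variables that satisfy `fz`, which are not written. -/
def chk (fz : ℕ → Bool) : St → Bool
  | skip => true
  | set x e => !fz x && e.wf && e.small
  | store a e => a.wf && e.wf && e.small
  | seq s t => s.chk fz && t.chk fz
  | ite e s t => e.wf && s.chk fz && t.chk fz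
  | for_ x e s => !fz x && e.wf && e.small && s.chk fz &&
      match e.base with
      | some r => fz r && r != modVar && decide (r < 10)
      | none => false

/-- The nesting depth of loops bounded by the variable `r`. -/
def dep (r : ℕ) : St → ℕ
  | skip => 0
  | set _ _ => 0
  | store _ _ => 0
  | seq s t => max (s.dep r) (t.dep r)
  | ite _ s t => max (s.dep r) (t.dep r)
  | for_ _ e s => s.dep r + if e.base = some r then 1 else 0

/-- The constant in the running time of a statement. -/
def cst : St → ℕ
  | skip => 1
  | set _ e => e.cst + (1 + e.len)
  | store a e => a.cst + e.cst + (1 + a.len + e.len)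
  | seq s t => s.cst + t.cst
  | ite e s t => e.cst + (1 + e.len) + (s.cst + t.cst)
  | for_ _ e s => e.cst + (1 + e.len) + 8 + s.cst

/-- The shape of the running time of a statement, for loop bounds `ρ`. -/
def shape (ρ : ℕ → ℕ) (s : St) : ℕ := ∏ r ∈ Finset.range 10, ρ r ^ s.dep r

theorem shape_mono {ρ : ℕ → ℕ} (hρ : ∀ r, 1 ≤ ρ r) {s t : St} (h : ∀ r, s.dep r ≤ t.dep r) :
    s.shape ρ ≤ t.shape ρ :=
  Finset.prod_le_prod' fun r _ => Nat.pow_le_pow_right (hρ r) (h r)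

theorem one_le_shape {ρ : ℕ → ℕ} (hρ : ∀ r, 1 ≤ ρ r) (s : St) : 1 ≤ s.shape ρ :=
  Finset.one_le_prod' fun r _ => Nat.one_le_pow _ _ (hρ r)

theorem chk_wr {fz : ℕ → Bool} {r : ℕ} (hr : fz r = true) :
    ∀ s : St, s.chk fz = true → s.wr r = false := by
  have aux : ∀ x, fz x = false → (r == x) = false := by
    intro x hx
    rw [beq_eq_false_iff_ne]
    rintro rfl
    simp [hr] at hx
  intro s
  induction s with
  | skip => intro _; rfl
  | set x e =>
    intro h
    simp only [chk, Bool.and_eq_true, Bool.not_eq_true'] at h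
    exact aux x h.1.1
  | store a e => intro _; rfl
  | seq s t ihs iht =>
    intro h
    simp only [chk, Bool.and_eq_true] at h
    simp [wr, ihs h.1, iht h.2]
  | ite e s t ihs iht =>
    intro h
    simp only [chk, Bool.and_eq_true] at h
    simp [wr, ihs h.1.2, iht h.2]
  | for_ x e s ih =>
    intro h
    simp only [chk, Bool.and_eq_true, Bool.not_eq_true'] at h
    simp [wr, ih h.1.2, aux x h.1.1.1.1]

theorem test_time_le {l B q : ℕ} (hl : l ≤ B) (hq : 1 ≤ q) :
    5 + 2 * l ≤ 7 * q * (B + 1) ^ 2 :=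
  calc 5 + 2 * l ≤ 7 * 1 * (B + 1) ^ 2 := by nlinarith
    _ ≤ _ := by gcongr

/-- In the constant on the right, `1 + l` pays for copying the bound into the loop variable, and `8`
is one for the final test plus seven for the overhead of each pass (`test_time_le`). -/
theorem loop_time_le (a l c B : ℕ) {p q : ℕ} (h : 1 ≤ p * q) :
    a * (B + 1) ^ 2 + (1 + l * (B + 1) + (1 + p * ((7 + c) * q * (B + 1) ^ 2))) ≤
      (a + (1 + l) + 8 + c) * (p * q) * (B + 1) ^ 2 := by
  have h1 : 1 ≤ (B + 1) ^ 2 := Nat.one_le_pow _ _ (by omega)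
  have h2 : B + 1 ≤ (B + 1) ^ 2 := Nat.le_self_pow (by norm_num) _
  calc _ ≤ a * 1 * (B + 1) ^ 2 + ((B + 1) ^ 2 + l * 1 * (B + 1) ^ 2 +
          ((B + 1) ^ 2 + p * ((7 + c) * q * (B + 1) ^ 2))) := by
          simp only [mul_one]
          gcongr
    _ ≤ a * (p * q) * (B + 1) ^ 2 + (1 * (B + 1) ^ 2 + l * (p * q) * (B + 1) ^ 2 +
          (1 * (B + 1) ^ 2 + p * ((7 + c) * q * (B + 1) ^ 2))) := by
          simp only [one_mul]
          gcongr
    _ ≤ a * (p * q) * (B + 1) ^ 2 + ((p * q) * (B + 1) ^ 2 + l * (p * q) * (B + 1) ^ 2 +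
          ((p * q) * (B + 1) ^ 2 + p * ((7 + c) * q * (B + 1) ^ 2))) := by
          gcongr
    _ = _ := by ring

theorem ite_time_le (a l c d B : ℕ) {p q Q : ℕ} (h : 1 ≤ Q) (hp : p ≤ Q) (hq : q ≤ Q) :
    a * (B + 1) ^ 2 + (1 + l * (B + 1) + (c * p * (B + 1) ^ 2 + d * q * (B + 1) ^ 2)) ≤
      (a + (1 + l) + (c + d)) * Q * (B + 1) ^ 2 := by
  have h1 : 1 ≤ (B + 1) ^ 2 := Nat.one_le_pow _ _ (by omega)
  have h2 : B + 1 ≤ (B + 1) ^ 2 := Nat.le_self_pow (by norm_num) _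
  calc _ ≤ a * 1 * (B + 1) ^ 2 + (1 * (B + 1) ^ 2 + l * 1 * (B + 1) ^ 2 +
          (c * Q * (B + 1) ^ 2 + d * Q * (B + 1) ^ 2)) := by
          simp only [mul_one, one_mul]
          gcongr
    _ ≤ a * Q * (B + 1) ^ 2 + (Q * (B + 1) ^ 2 + l * Q * (B + 1) ^ 2 +
          (c * Q * (B + 1) ^ 2 + d * Q * (B + 1) ^ 2)) := by
          gcongr
    _ = _ := by ring

/-- Composition adds the constants `cst` and takes the maximum of the depths; a loop bounded by the
variable `r` contributes one factor `ρ r`. The variables selected by `fz` are never written, so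
their bounds persist, and the state stays `Sized`, so each elementary step keeps costing `O((B + 1)
^ 2)`. -/
theorem cost_le {fz : ℕ → Bool} {ρ : ℕ → ℕ} {B : ℕ} (hB : 1 ≤ B) (hfz : fz modVar = true)
    (hρ : ∀ r, 1 ≤ ρ r) (s : St) : ∀ σ : State, s.chk fz = true → 0 < σ.reg modVar → Sized B σ →
    (∀ r, fz r = true → r ≠ modVar → σ.reg r ≤ ρ r) →
    s.cost σ ≤ s.cst * s.shape ρ * (B + 1) ^ 2 ∧ Sized B (s.den σ) := by
  induction s with
  | skip =>
    intro σ _ _ h _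
    refine ⟨?_, h⟩
    simp only [cost, cst, one_mul]
    exact Nat.mul_pos (one_le_shape hρ _) (by positivity)
  | set x e =>
    intro σ hc hM h _
    simp only [chk, Bool.and_eq_true] at hc
    refine ⟨?_, h.setReg x (e.eval_lt hB h hM hc.1.2 hc.2)⟩
    have h1 := e.cost_le h hc.1.2
    have h2 := (e.size_eval_le h hc.1.2).1
    have h3 : (set x e).shape ρ = 1 := by simp [shape, dep]
    simp only [cost, cst, h3]
    nlinarith [Nat.zero_le (e.len * B), Nat.zero_le (e.len * B ^ 2)]
  | store a e =>
    intro σ hc hM h _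
    simp only [chk, Bool.and_eq_true] at hc
    refine ⟨?_, h.setMem _ (e.eval_lt hB h hM hc.1.2 hc.2)⟩
    have h1 := e.cost_le h hc.1.2
    have h2 := (e.size_eval_le h hc.1.2).1
    have h4 := a.cost_le h hc.1.1
    have h5 := (a.size_eval_le h hc.1.1).1
    have h3 : (store a e).shape ρ = 1 := by simp [shape, dep]
    simp only [cost, cst, h3]
    nlinarith [Nat.zero_le (e.len * B), Nat.zero_le (e.len * B ^ 2),
      Nat.zero_le (a.len * B), Nat.zero_le (a.len * B ^ 2)]
  | seq s t ihs iht =>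
    intro σ hc hM h hσ
    simp only [chk, Bool.and_eq_true] at hc
    obtain ⟨h1, h2⟩ := ihs σ hc.1 hM h hσ
    obtain ⟨h3, h4⟩ := iht (s.den σ) hc.2 (by rwa [den_reg s (chk_wr hfz s hc.1)]) h2
      (fun r hr hr' => by rw [den_reg s (chk_wr hr s hc.1)]; exact hσ r hr hr')
    refine ⟨?_, h4⟩
    have hs : s.shape ρ ≤ (seq s t).shape ρ := shape_mono hρ fun r => le_max_left _ _
    have ht : t.shape ρ ≤ (seq s t).shape ρ := shape_mono hρ fun r => le_max_right _ _
    calc (seq s t).cost σ ≤ s.cst * s.shape ρ * (B + 1) ^ 2 + t.cst * t.shape ρ * (B + 1) ^ 2 :=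
          add_le_add h1 h3
      _ ≤ s.cst * (seq s t).shape ρ * (B + 1) ^ 2 + t.cst * (seq s t).shape ρ * (B + 1) ^ 2 := by
          gcongr
      _ = _ := by simp only [cst]; ring
  | ite e s t ihs iht =>
    intro σ hc hM h hσ
    simp only [chk, Bool.and_eq_true] at hc
    obtain ⟨h1, h2⟩ := ihs σ hc.1.2 hM h hσ
    obtain ⟨h3, h4⟩ := iht σ hc.2 hM h hσ
    have h5 := e.cost_le h hc.1.1
    have h6 := (e.size_eval_le h hc.1.1).1
    refine ⟨?_, by simp only [den]; split_ifs <;> assumption⟩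
    have h0 := one_le_shape hρ (ite e s t)
    have hs : s.shape ρ ≤ (ite e s t).shape ρ := shape_mono hρ fun r => le_max_left _ _
    have ht : t.shape ρ ≤ (ite e s t).shape ρ := shape_mono hρ fun r => le_max_right _ _
    refine le_trans ?_ (ite_time_le e.cst e.len s.cst t.cst B h0 hs ht)
    simp only [cost]
    split_ifs <;> omega
  | for_ x e s ih =>
    intro σ hc hM h hσ
    simp only [chk, Bool.and_eq_true, Bool.not_eq_true'] at hc
    obtain ⟨⟨⟨⟨hx, hwf⟩, hsm⟩, hs⟩, hb⟩ := hc
    have hne : ∀ r, fz r = true → r ≠ x := by rintro r hr rfl; simp [hr] at hx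
    obtain ⟨r, hr⟩ : ∃ r, e.base = some r := by
      cases hb' : e.base with
      | none => simp [hb'] at hb
      | some r => exact ⟨r, rfl⟩
    simp only [hr, Bool.and_eq_true, bne_iff_ne, decide_eq_true_eq] at hb
    have hN : e.eval σ ≤ ρ r := (e.eval_le_base hr).trans (hσ r hb.1.1 hb.1.2)
    have hlt := e.eval_lt hB h hM hwf hsm
    have h5 := e.cost_le h hwf
    have h6 := (e.size_eval_le h hwf).1
    have hshape : (for_ x e s).shape ρ = ρ r * s.shape ρ := by
      simp only [shape, dep, pow_add, Finset.prod_mul_distrib, hr, Option.some.injEq]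
      rw [Finset.prod_eq_single r (f := fun i => ρ i ^ (if r = i then 1 else 0))]
      · simp [mul_comm]
      · intro i _ hi; simp [hi.symm]
      · intro hi; simp [hb.2] at hi
    have h0 := one_le_shape hρ s
    have key : ∀ N < 2 ^ B, ∀ τ : State, 0 < τ.reg modVar → Sized B τ →
        (∀ r, fz r = true → r ≠ modVar → τ.reg r ≤ ρ r) →
        loopCost s.den s.cost x N τ ≤ 1 + N * ((7 + s.cst) * s.shape ρ * (B + 1) ^ 2) ∧
          Sized B (loopDen s.den x N τ) := by
      intro N
      induction N with
      | zero => intro _ τ _ hτ _; simpa [loopCost, loopDen] using hτ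
      | succ N ihN =>
        intro hN τ hMτ hSτ hτ
        obtain ⟨h1, h2⟩ := ih (τ.setReg x N) hs (by simpa [hne _ hfz] using hMτ)
          (hSτ.setReg x (Nat.lt_of_succ_lt hN))
          (fun r hr hr' => by simpa [hne r hr] using hτ r hr hr')
        obtain ⟨h3, h4⟩ := ihN (Nat.lt_of_succ_lt hN) _
          (by rw [den_reg s (chk_wr hfz s hs)]; simpa [hne _ hfz] using hMτ) h2
          (fun r hr hr' => by
            rw [den_reg s (chk_wr hr s hs)]; simpa [hne r hr] using hτ r hr hr')
        refine ⟨?_, h4⟩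
        have h8 := test_time_le (Nat.size_le.2 hN) h0
        simp only [loopCost]
        have e1 : (7 + s.cst) * s.shape ρ * (B + 1) ^ 2 =
          7 * s.shape ρ * (B + 1) ^ 2 + s.cst * s.shape ρ * (B + 1) ^ 2 := by ring
        rw [add_mul N 1, one_mul]
        linarith
    obtain ⟨h1, h2⟩ := key _ hlt (σ.setReg x (e.eval σ)) (by simpa [hne _ hfz] using hM)
      (h.setReg x hlt) (fun r hr hr' => by simpa [hne r hr] using hσ r hr hr')
    refine ⟨?_, h2⟩
    rw [hshape]
    have hQ : 1 ≤ ρ r * s.shape ρ := Nat.mul_pos (hρ r) h0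
    have h9 := Nat.mul_le_mul_right ((7 + s.cst) * s.shape ρ * (B + 1) ^ 2) hN
    refine le_trans ?_ (loop_time_le e.cst e.len s.cst B hQ)
    simp only [cost]
    linarith

end St
end RAM

/-! ### Cores as hitting sets of obstructions -/

namespace SimpleGraph

variable {V : Type*}

/-- No core avoids all three vertices: two neighbours `b ≠ c` of a vertex `a` of degree at least
three, or the neighbour `b = c` of a vertex `a` of degree one. -/
def IsObstruction (G : SimpleGraph V) (a b c : V) : Prop :=
  G.Adj a b ∧ G.Adj a c ∧
    (b ≠ c ∧ 3 ≤ (G.neighborSet a).ncard ∨ (G.neighborSet a).ncard = 1)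

/-- The component of `G - Z` as a set of vertices of `G` is closed under adjacency in `G - Z`. -/
theorem mem_image_supp_of_adj {G : SimpleGraph V} {Z : Set V}
    {C : (G.induce Zᶜ).ConnectedComponent} {a b : V} (ha : a ∈ Subtype.val '' C.supp)
    (hab : G.Adj a b) (hb : b ∉ Z) : b ∈ Subtype.val '' C.supp := by
  obtain ⟨a', ha', rfl⟩ := ha
  exact ⟨⟨b, hb⟩, C.mem_supp_of_adj_mem_supp ha' (by simpa using hab), rfl⟩

/-- A walk inside the component from a vertex in `S` to one outside `S` would have an edge leaving
`S`. -/
theorem image_supp_subset_of_closed {G : SimpleGraph V} {Z S : Set V}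
    {C : (G.induce Zᶜ).ConnectedComponent} {e : V} (he : e ∈ Subtype.val '' C.supp) (heS : e ∈ S)
    (hS : ∀ a ∈ S, ∀ b ∈ Subtype.val '' C.supp, G.Adj a b → b ∈ S) :
    Subtype.val '' C.supp ⊆ S := by
  classical
  rintro _ ⟨x, hx, rfl⟩
  obtain ⟨e', he', rfl⟩ := he
  obtain ⟨w⟩ := C.reachable_of_mem_supp he' hx
  by_contra hxS
  obtain ⟨d, hd, h1, h2⟩ := w.exists_boundary_dart (Subtype.val ⁻¹' S) heS hxS
  refine h2 (hS _ h1 _ ⟨d.snd, ?_, rfl⟩ (by simpa using d.adj))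
  have h3 : (G.induce Zᶜ).Reachable e' d.snd :=
    ⟨w.takeUntil _ (w.dart_snd_mem_support_of_mem_darts hd)⟩
  have : (G.induce Zᶜ).connectedComponentMk d.snd = C := by
    rw [← ConnectedComponent.sound h3]; exact he'
  exact this

/-- If all three vertices avoid `Z`, they lie in one component of `G - Z`, which is then a cable
path and not a single vertex. Were `a` internal on it, `a` would have degree two. Were `a` an end,
it would have only one neighbour on the path, so `b = c` and `a` has degree one; but it also has a
neighbour in `Z`. -/
theorem IsCore.hits {G : SimpleGraph V} {Z : Set V} (h : G.IsCore Z) {a b c : V}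
    (hv : G.IsObstruction a b c) : a ∈ Z ∨ b ∈ Z ∨ c ∈ Z := by
  obtain ⟨hab, hac, hd⟩ := hv
  by_contra! hcon
  obtain ⟨ha, hb, hc⟩ := hcon
  set C := (G.induce Zᶜ).connectedComponentMk ⟨a, ha⟩ with hC
  have haC : a ∈ Subtype.val '' C.supp := ⟨⟨a, ha⟩, rfl, rfl⟩
  have hbC := mem_image_supp_of_adj haC hab hb
  have hcC := mem_image_supp_of_adj haC hac hc
  rcases h C with ⟨v, hv⟩ | ⟨u, v, p, hp, hsub, ⟨z, hz, huz⟩, z', hz', hvz'⟩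
  · simp only [hv, Set.image_singleton, Set.mem_singleton_iff] at haC hbC
    exact hab.ne (haC.trans hbC.symm)
  · have hsb : p.toSubgraph.Adj a b := by rw [hsub]; exact ⟨haC, hbC, hab⟩
    have hsc : p.toSubgraph.Adj a c := by rw [hsub]; exact ⟨haC, hcC, hac⟩
    have hnil : ¬ p.Nil := by
      intro hn
      have hlen : p.length = 0 := Walk.length_eq_zero_iff.2 hn
      obtain ⟨i, _, hi⟩ := p.toSubgraph_adj_iff.1 hsb
      omega
    have hend : ∀ q : V, p.toSubgraph.neighborSet a = {q} → ∀ z ∈ Z, ¬ G.Adj a z := by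
      intro q hq z hz haz
      have hb' : b ∈ p.toSubgraph.neighborSet a := hsb
      have hc' : c ∈ p.toSubgraph.neighborSet a := hsc
      rw [hq, Set.mem_singleton_iff] at hb' hc'
      rcases hd with ⟨hne, _⟩ | h1
      · exact hne (hb'.trans hc'.symm)
      · obtain ⟨y, hy⟩ := Set.ncard_eq_one.1 h1
        have e1 : b ∈ G.neighborSet a := hab
        have e2 : z ∈ G.neighborSet a := haz
        rw [hy, Set.mem_singleton_iff] at e1 e2
        exact hb (e1.trans e2.symm ▸ hz)
    obtain ⟨i, hi, hil⟩ := Walk.mem_support_iff_exists_getVert.1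
      (p.mem_support_of_adj_toSubgraph hsb)
    by_cases hi0 : i = 0
    · subst hi0
      rw [Walk.getVert_zero] at hi
      subst hi
      exact hend _ (hp.1.neighborSet_toSubgraph_startpoint hnil) z hz huz
    by_cases hil' : i = p.length
    · subst hil'
      rw [Walk.getVert_length] at hi
      subst hi
      exact hend _ (hp.1.neighborSet_toSubgraph_endpoint hnil) z' hz' hvz'
    have h2 := hp.1.ncard_neighborSet_toSubgraph_internal_eq_two hi0 (by omega)
    rw [hp.1.neighborSet_toSubgraph_internal hi0 (by omega),
      ← hp.2 i (by omega) (by omega), hi] at h2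
    omega

theorem exists_longest_isPath_from [Fintype V] (G : SimpleGraph V) (S : Set V) {e : V}
    (he : e ∈ S) : ∃ (f : V) (p : G.Walk e f), p.IsPath ∧ (∀ x ∈ p.support, x ∈ S) ∧
      ∀ g ∈ S, G.Adj f g → g ∈ p.support := by
  classical
  let P : ℕ → Prop := fun l => ∃ (f : V) (p : G.Walk e f), p.IsPath ∧ (∀ x ∈ p.support, x ∈ S) ∧
    p.length = l
  have h0 : P 0 := ⟨e, .nil, .nil, by simpa using he, rfl⟩
  obtain ⟨f, p, hp, hS, hl⟩ := Nat.findGreatest_spec (P := P) (Nat.zero_le (Fintype.card V)) h0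
  refine ⟨f, p, hp, hS, fun g hg hfg => ?_⟩
  by_contra hgp
  have hp' := hp.concat hgp hfg
  have h1 : P (p.length + 1) := by
    refine ⟨g, p.concat hfg, hp', fun x hx => ?_, by simp⟩
    simp only [Walk.support_concat, List.mem_append, List.mem_singleton] at hx
    rcases hx with hx | rfl
    exacts [hS x hx, hg]
  have h2 := Nat.le_findGreatest (P := P) (n := Fintype.card V) (by
    have := hp'.length_lt; simp at this; omega) h1
  omega

/-- By `two`, a vertex outside `Z` with two neighbours outside `Z` has no further neighbours. Start
a longest path of the component at a vertex `e` with a neighbour in `Z`, which exists by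
connectedness. Its internal vertices have no neighbours off the path, `e` has no second neighbour in
the component because of its neighbour in `Z`, and the last vertex has none off the path by
maximality. So the path is the whole component, without chords. -/
theorem isCore_of_hits [Fintype V] {G : SimpleGraph V} (hG : G.Connected) {Z : Set V}
    (hZ : Z.Nonempty)
    (h : ∀ a b c, G.IsObstruction a b c → a ∈ Z ∨ b ∈ Z ∨ c ∈ Z) : G.IsCore Z := by
  intro C
  set D : Set V := Subtype.val '' C.supp with hD
  have hDZ : ∀ x ∈ D, x ∉ Z := by rintro _ ⟨x, _, rfl⟩; exact x.2
  have two : ∀ {a b c : V}, a ∉ Z → b ∉ Z → c ∉ Z → G.Adj a b → G.Adj a c → b ≠ c →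
      G.neighborSet a = {b, c} := by
    intro a b c ha hb hc hab hac hbc
    have hlt : (G.neighborSet a).ncard ≤ 2 := by
      by_contra! hlt
      rcases h a b c ⟨hab, hac, .inl ⟨hbc, hlt⟩⟩ with h | h | h <;> contradiction
    refine (Set.eq_of_subset_of_ncard_le ?_ ?_ (Set.toFinite _)).symm
    · rintro x (rfl | rfl)
      exacts [hab, hac]
    · rwa [Set.ncard_pair hbc]
  obtain ⟨x₀, hx₀⟩ := C.nonempty_supp
  obtain ⟨z₀, hz₀⟩ := hZ
  obtain ⟨e, heD, z, hz, hez⟩ : ∃ e ∈ D, ∃ z ∈ Z, G.Adj e z := by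
    obtain ⟨w⟩ := hG.preconnected x₀.1 z₀
    obtain ⟨d, _, h1, h2⟩ := w.exists_boundary_dart D ⟨x₀, hx₀, rfl⟩ fun h => hDZ _ h hz₀
    refine ⟨d.fst, h1, d.snd, ?_, d.adj⟩
    by_contra h3
    exact h2 (mem_image_supp_of_adj h1 d.adj h3)
  obtain ⟨f, p, hp, hpD, hmax⟩ := G.exists_longest_isPath_from D heD
  by_cases hnil : p.Nil
  · left
    have hef : e = f := hnil.eq
    have hsub : D ⊆ {e} := by
      refine image_supp_subset_of_closed heD rfl ?_
      rintro a rfl b hb hab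
      have := hmax b hb (hef ▸ hab)
      rw [Walk.nil_iff_support_eq.1 hnil] at this
      simpa using this
    obtain ⟨e', he', rfl⟩ := heD
    refine ⟨e', Set.eq_singleton_iff_unique_mem.2 ⟨he', fun y hy => ?_⟩⟩
    exact Subtype.ext (hsub ⟨y, hy, rfl⟩)
  right
  have hvD : ∀ i, p.getVert i ∈ D := fun i => hpD _ (p.getVert_mem_support i)
  have internal : ∀ i, i ≠ 0 → i < p.length →
      G.neighborSet (p.getVert i) = {p.getVert (i - 1), p.getVert (i + 1)} := by
    intro i h0 hi
    have h2 := hp.ncard_neighborSet_toSubgraph_internal_eq_two h0 hi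
    rw [hp.neighborSet_toSubgraph_internal h0 hi] at h2
    refine two (hDZ _ (hvD _)) (hDZ _ (hvD _)) (hDZ _ (hvD _)) ?_ (p.adj_getVert_succ hi) ?_
    · have := p.adj_getVert_succ (i := i - 1) (by omega)
      rw [Nat.sub_add_cancel (by omega)] at this
      exact this.symm
    · intro heq
      rw [heq, Set.pair_eq_singleton, Set.ncard_singleton] at h2
      omega
  have inner : ∀ i < p.length, ∀ y ∈ D, G.Adj (p.getVert i) y →
      p.toSubgraph.Adj (p.getVert i) y := by
    intro i hi y hy hadj
    by_cases h0 : i = 0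
    · subst h0
      have hs := hp.neighborSet_toSubgraph_startpoint hnil
      rw [Walk.getVert_zero] at hadj ⊢
      change y ∈ p.toSubgraph.neighborSet e
      rw [hs, Set.mem_singleton_iff]
      by_contra hne
      -- A second neighbour `y` of `e` in the component would leave no room for the neighbour `z` in
      -- `Z`.
      have h2 := two (hDZ _ heD) (hDZ _ hy) (hDZ _ (hvD 1)) hadj (p.adj_snd hnil) hne
      have h3 : z ∈ G.neighborSet e := hez
      rw [h2] at h3
      rcases h3 with rfl | h3
      · exact hDZ _ hy hz
      · rw [Set.mem_singleton_iff] at h3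
        subst h3
        exact hDZ _ (hvD 1) hz
    · change y ∈ p.toSubgraph.neighborSet _
      rw [hp.neighborSet_toSubgraph_internal h0 hi, ← internal i h0 hi]
      exact hadj
  have all : ∀ x ∈ p.support, ∀ y ∈ D, G.Adj x y → p.toSubgraph.Adj x y := by
    intro x hx y hy hadj
    obtain ⟨i, rfl, hi⟩ := Walk.mem_support_iff_exists_getVert.1 hx
    rcases hi.lt_or_eq with hi | rfl
    · exact inner i hi y hy hadj
    · rw [Walk.getVert_length] at hadj ⊢
      obtain ⟨j, rfl, hj⟩ := Walk.mem_support_iff_exists_getVert.1 (hmax y hy hadj)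
      rcases hj.lt_or_eq with hj | rfl
      · exact (inner j hj f (hpD _ p.end_mem_support) hadj.symm).symm
      · rw [Walk.getVert_length] at hadj
        exact (G.irrefl hadj).elim
  have hsupp : D = {x | x ∈ p.support} := by
    refine Set.Subset.antisymm (image_supp_subset_of_closed heD p.start_mem_support ?_) hpD
    intro a ha b hb hab
    exact p.mem_support_of_adj_toSubgraph (all a ha b hb hab).symm
  refine ⟨e, f, p, ⟨hp, fun i h0 hi => internal i h0.ne' hi⟩, ?_, ⟨z, hz, hez⟩, ?_⟩
  · refine Subgraph.ext (by rw [Walk.verts_toSubgraph, ← hsupp]; rfl) ?_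
    ext x y
    constructor
    · intro hxy
      have hx := p.mem_support_of_adj_toSubgraph hxy
      have hy := p.mem_support_of_adj_toSubgraph hxy.symm
      exact ⟨hpD _ hx, hpD _ hy, hxy.adj_sub⟩
    · rintro ⟨hx, hy, hxy⟩
      exact all x (by have := hx; rw [hsupp] at this; exact this) y hy hxy
  · have hfD := hpD _ p.end_mem_support
    have hpen := (p.adj_penultimate hnil).symm
    have hpenD := hpD _ (p.getVert_mem_support (p.length - 1))
    -- If the last vertex had degree one, it would form an obstruction outside `Z` with its
    -- predecessor taken twice. So it has another neighbour, and that one must be in `Z`.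
    have h1 : (G.neighborSet f).ncard ≠ 1 := by
      intro h1
      rcases h f _ _ ⟨hpen, hpen, .inr h1⟩ with h | h | h
      exacts [hDZ _ hfD h, hDZ _ hpenD h, hDZ _ hpenD h]
    obtain ⟨w, hw, hne⟩ : ∃ w ∈ G.neighborSet f, w ≠ p.penultimate := by
      by_contra! hall
      exact h1 (Set.ncard_eq_one.2 ⟨_, Set.eq_singleton_iff_unique_mem.2 ⟨hpen, hall⟩⟩)
    refine ⟨w, ?_, hw⟩
    by_contra hwZ
    have hwD := mem_image_supp_of_adj hfD hw hwZ
    have hs : w ∈ p.toSubgraph.neighborSet f := all f p.end_mem_support w hwD hw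
    rw [hp.neighborSet_toSubgraph_endpoint hnil] at hs
    exact hne hs

/-- For empty `Z`, a component is not a single vertex, as every vertex has a neighbour, and the ends
of a cable path lack the required neighbour in `Z`. With one vertex this fails, which forces the
separate treatment of `n = 1`. -/
theorem IsCore.nonempty [Nontrivial V] {G : SimpleGraph V} (hG : G.Connected) {Z : Set V}
    (h : G.IsCore Z) : Z.Nonempty := by
  by_contra hZ
  rw [Set.not_nonempty_iff_eq_empty] at hZ
  subst hZ
  obtain ⟨a⟩ := hG.nonempty
  obtain ⟨b, hab⟩ := hG.preconnected.exists_adj_of_nontrivial a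
  rcases h ((G.induce _).connectedComponentMk ⟨a, by simp⟩) with ⟨v, hv⟩ | ⟨_, _, _, _, _, ⟨z, hz, _⟩, _⟩
  · have ha : a ∈ Subtype.val '' ((G.induce (∅ : Set V)ᶜ).connectedComponentMk ⟨a, by simp⟩).supp :=
      ⟨⟨a, by simp⟩, rfl, rfl⟩
    have hb := mem_image_supp_of_adj ha hab (by simp)
    rw [hv, Set.image_singleton, Set.mem_singleton_iff] at ha hb
    exact hab.ne (ha.trans hb.symm)
  · exact hz

theorem isConnectedCore_of_subsingleton [Subsingleton V] (G : SimpleGraph V) (Z : Set V) :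
    G.IsConnectedCore Z := by
  constructor
  · intro C
    obtain ⟨x, hx⟩ := C.nonempty_supp
    exact .inl ⟨x, Set.eq_singleton_iff_unique_mem.2 ⟨hx, fun y _ => Subsingleton.elim _ _⟩⟩
  · intro x y
    rw [Subsingleton.elim x y]

end SimpleGraph

/-! ### Branching walks and connected vertex sets -/

namespace SimpleGraph

open Finset

variable {V : Type*} [Fintype V] (G : SimpleGraph V)

open Classical in
/-- The number of branching walks (homomorphic images of plane trees) with `i` edges that start at
`v` and have the vertex set `A`. -/
noncomputable def branchingWalks : ℕ → V → Finset V → ℕ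
  | 0, v, A => if A = {v} then 1 else 0
  | i + 1, v, A => ∑ p : Fin (i + 1), ∑ u, if G.Adj v u then
      ∑ B, ∑ C, if B ∪ C = A then branchingWalks p v B * branchingWalks (i - p) u C else 0 else 0

variable {G}

-- The recursion splits a plane tree at a distinguished edge from the root `v` to a child `u`: `p`
-- edges stay with `v`, and `i - p` edges lie in the subtree at `u`.
open Classical in
theorem branchingWalks_succ_pos {i : ℕ} {v : V} {A : Finset V} :
    0 < G.branchingWalks (i + 1) v A ↔ ∃ p ≤ i, ∃ u, G.Adj v u ∧ ∃ B C, B ∪ C = A ∧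
      0 < G.branchingWalks p v B ∧ 0 < G.branchingWalks (i - p) u C := by
  rw [branchingWalks]
  simp only [sum_pos_iff, mem_univ, true_and]
  constructor
  · rintro ⟨p, u, h⟩
    split_ifs at h with hu
    · simp only [sum_pos_iff, mem_univ, true_and] at h
      obtain ⟨B, C, h⟩ := h
      split_ifs at h with hA
      · exact ⟨p, Nat.lt_succ_iff.1 p.2, u, hu, B, C, hA, Nat.pos_of_mul_pos_right h,
          Nat.pos_of_mul_pos_left h⟩
      · exact absurd h (lt_irrefl 0)
    · exact absurd h (lt_irrefl 0)
  · rintro ⟨p, hp, u, hu, B, C, hA, hB, hC⟩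
    refine ⟨⟨p, Nat.lt_succ_iff.2 hp⟩, u, ?_⟩
    rw [if_pos hu]
    simp only [sum_pos_iff, mem_univ, true_and]
    refine ⟨B, C, ?_⟩
    rw [if_pos hA]
    exact Nat.mul_pos hB hC

theorem branchingWalks_zero_pos {v : V} {A : Finset V} :
    0 < G.branchingWalks 0 v A ↔ A = {v} := by
  rw [branchingWalks]
  split_ifs with h <;> simp [h]

theorem of_branchingWalks_pos : ∀ {i : ℕ} {v : V} {A : Finset V}, 0 < G.branchingWalks i v A →
    v ∈ A ∧ (G.induce (A : Set V)).Preconnected ∧ A.card ≤ i + 1 := by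
  classical
  intro i
  induction i using Nat.strong_induction_on with
  | _ i ih =>
    intro v A h
    cases i with
    | zero =>
      rw [branchingWalks_zero_pos] at h
      subst h
      refine ⟨by simp, ?_, by simp⟩
      have : Subsingleton ((({v} : Finset V) : Set V)) := by
        rw [coe_singleton]; infer_instance
      exact Preconnected.of_subsingleton
    | succ i =>
      obtain ⟨p, hp, u, hu, B, C, rfl, hB, hC⟩ := branchingWalks_succ_pos.1 h
      obtain ⟨hvB, hBc, hBk⟩ := ih p (by omega) hB
      obtain ⟨huC, hCc, hCk⟩ := ih (i - p) (by omega) hC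
      refine ⟨mem_union_left _ hvB, ?_, (card_union_le _ _).trans (by omega)⟩
      have h1 := induce_union_connected hBc (induce_pair_connected_of_adj hu).preconnected
        ⟨v, hvB, by simp⟩
      have h2 := induce_union_connected h1.preconnected hCc ⟨u, by simp, huC⟩
      have h3 : (B : Set V) ∪ {v, u} ∪ C = ((B ∪ C : Finset V) : Set V) := by
        ext x
        simp only [Set.mem_union, mem_coe, Set.mem_insert_iff, Set.mem_singleton_iff, mem_union]
        constructor
        · rintro ((h | rfl | rfl) | h) <;> tauto
        · tauto
      rw [h3] at h2
      exact h2.preconnected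

-- A new leaf mapped to `w` is attached to a tree node mapped to `x`, in whichever of the two parts
-- such a node occurs.
open Classical in
theorem branchingWalks_insert_pos {x w : V} (hxw : G.Adj x w) : ∀ {i : ℕ} {v : V} {A : Finset V},
    0 < G.branchingWalks i v A → x ∈ A → 0 < G.branchingWalks (i + 1) v (insert w A) := by
  intro i
  induction i using Nat.strong_induction_on with
  | _ i ih =>
    intro v A h hx
    rw [branchingWalks_succ_pos]
    cases i with
    | zero =>
      rw [branchingWalks_zero_pos] at h
      subst h
      rw [mem_singleton] at hx
      subst hx
      exact ⟨0, le_rfl, w, hxw, {x}, {w}, by ext; simp; tauto, branchingWalks_zero_pos.2 rfl,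
        branchingWalks_zero_pos.2 rfl⟩
    | succ i =>
      obtain ⟨p, hp, u, hu, B, C, rfl, hB, hC⟩ := branchingWalks_succ_pos.1 h
      rcases mem_union.1 hx with hx | hx
      · refine ⟨p + 1, by omega, u, hu, insert w B, C, by simp [insert_union],
          ih p (by omega) hB hx, ?_⟩
        rwa [Nat.add_sub_add_right]
      · refine ⟨p, by omega, u, hu, B, insert w C, by simp [union_insert], hB, ?_⟩
        rw [Nat.sub_add_comm hp]
        exact ih (i - p) (by omega) hC hx

/-- Grow a spanning tree of `A` from `v`: as long as a vertex of `A` is missing, connectedness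
provides an edge inside `A` that leaves the current vertex set, and its far end becomes a leaf. -/
theorem branchingWalks_pos {A : Finset V} (hA : (G.induce (A : Set V)).Preconnected) {v : V}
    (hv : v ∈ A) {i : ℕ} (hi : A.card = i + 1) : 0 < G.branchingWalks i v A := by
  classical
  have key : ∀ j ≤ i, ∃ B ⊆ A, B.card = j + 1 ∧ 0 < G.branchingWalks j v B := by
    intro j
    induction j with
    | zero =>
      intro _
      exact ⟨{v}, by simpa using hv, by simp, branchingWalks_zero_pos.2 rfl⟩
    | succ j ih =>
      intro hj
      obtain ⟨B, hBA, hBc, hB⟩ := ih (by omega)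
      obtain ⟨y, hyA, hyB⟩ : ∃ y ∈ A, y ∉ B := by
        by_contra! hsub
        have := card_le_card hsub
        omega
      have hvB := (of_branchingWalks_pos hB).1
      obtain ⟨w⟩ := hA ⟨v, hv⟩ ⟨y, hyA⟩
      obtain ⟨d, _, h1, h2⟩ := w.exists_boundary_dart (Subtype.val ⁻¹' (B : Set V)) hvB hyB
      refine ⟨insert d.snd.1 B, insert_subset d.snd.2 hBA, ?_, ?_⟩
      · rw [card_insert_of_notMem h2, hBc]
      · exact branchingWalks_insert_pos (by simpa using d.adj) hB h1
  obtain ⟨B, hBA, hBc, hB⟩ := key i le_rfl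
  rwa [← eq_of_subset_of_card_le hBA (by omega)]

variable (G) in
/-- The total weight of the branching walks with `i` edges that start at `v`, where the weight `χ`
depends on the vertex set only. -/
noncomputable def branchingWeight {R : Type*} [CommSemiring R] (χ : Finset V → R) (i : ℕ) (v : V) :
    R :=
  ∑ A, (G.branchingWalks i v A : R) * χ A

variable {R : Type*} [CommSemiring R] {χ : Finset V → R}

theorem branchingWeight_zero (v : V) : G.branchingWeight χ 0 v = χ {v} := by
  classical
  simp [branchingWeight, branchingWalks]

-- Multiplicativity of `χ` over unions removes the vertex sets from the recursion. This leaves a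
-- recurrence in length and start vertex only, although the number of sets is exponential.
open Classical in
theorem branchingWeight_succ (hχ : ∀ B C, χ (B ∪ C) = χ B * χ C) (i : ℕ) (v : V) :
    G.branchingWeight χ (i + 1) v = ∑ p ∈ range (i + 1), ∑ u, if G.Adj v u then
      G.branchingWeight χ p v * G.branchingWeight χ (i - p) u else 0 := by
  rw [sum_range]
  simp only [branchingWeight]
  have h1 : ∀ A, (G.branchingWalks (i + 1) v A : R) * χ A = ∑ p : Fin (i + 1), ∑ u,
      if G.Adj v u then ∑ B, ∑ C, if B ∪ C = A then
        (G.branchingWalks p v B * χ B) * (G.branchingWalks (i - p) u C * χ C) else 0 else 0 := by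
    intro A
    rw [branchingWalks]
    push_cast
    rw [sum_mul]
    refine sum_congr rfl fun p _ => ?_
    rw [sum_mul]
    refine sum_congr rfl fun u _ => ?_
    split_ifs with hu
    · rw [sum_mul]
      refine sum_congr rfl fun B _ => ?_
      rw [sum_mul]
      refine sum_congr rfl fun C _ => ?_
      split_ifs with hA
      · rw [← hA, hχ]; ring
      · simp
    · simp
  simp only [h1]
  rw [sum_comm]
  refine sum_congr rfl fun p _ => ?_
  rw [sum_comm]
  refine sum_congr rfl fun u _ => ?_
  split_ifs with hu
  · rw [sum_comm, sum_mul]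
    refine sum_congr rfl fun B _ => ?_
    rw [sum_comm, mul_sum]
    refine sum_congr rfl fun C _ => ?_
    simp
  · simp

/-- The recurrence for the constant weight is that of the Catalan numbers with a choice of at most
`Fintype.card V` vertices per edge; and `catalan i ≤ 4 ^ i`. -/
theorem branchingWeight_one_le (i : ℕ) (v : V) :
    G.branchingWeight (fun _ => 1) i v ≤ 4 ^ i * Fintype.card V ^ i := by
  classical
  have key : ∀ i v, G.branchingWeight (fun _ => 1) i v ≤ catalan i * Fintype.card V ^ i := by
    intro i
    induction i using Nat.strong_induction_on with
    | _ i ih =>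
      intro v
      cases i with
      | zero => simp [branchingWeight_zero]
      | succ i =>
        rw [branchingWeight_succ (by simp), catalan_succ, sum_mul, sum_range]
        refine sum_le_sum fun p _ => ?_
        have hp := p.2
        calc _ ≤ ∑ _u : V, catalan p * Fintype.card V ^ (p : ℕ) *
              (catalan (i - p) * Fintype.card V ^ (i - p)) := by
              refine sum_le_sum fun u _ => ?_
              split_ifs
              · exact Nat.mul_le_mul (ih p (by omega) v) (ih (i - p) (by omega) u)
              · exact Nat.zero_le _
          _ = _ := by
              obtain ⟨m, hm⟩ : ∃ m, i = p + m := ⟨i - p, by omega⟩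
              rw [sum_const, card_univ, smul_eq_mul, show i - p = m by omega]
              have hpow : Fintype.card V ^ (i + 1) =
                  Fintype.card V * (Fintype.card V ^ (p : ℕ) * Fintype.card V ^ m) := by
                rw [← pow_add, ← hm, pow_succ, mul_comm]
              rw [hpow]
              ring
  refine (key i v).trans (Nat.mul_le_mul_right _ ?_)
  rw [catalan_eq_centralBinom_div]
  exact (Nat.div_le_self _ _).trans (Nat.centralBinom_le_four_pow i)

end SimpleGraph

/-! ### Inclusion and exclusion -/

namespace MinConnectedCore

open Finset

open Classical in
/-- The contribution to the signed sum of the vertices below `N`, when the bits of `q` tell which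
elements of `S` are forbidden, for an object with the vertex set `A`. -/
noncomputable def signedTerm (S A : Finset ℕ) : ℕ → ℕ → ℤ
  | 0, _ => 1
  | N + 1, q =>
    if N ∈ S then (if q % 2 = 1 then (if N ∈ A then 0 else -1) else 1) * signedTerm S A N (q / 2)
    else signedTerm S A N q

theorem sum_range_mul_two {M : Type*} [AddCommMonoid M] (f : ℕ → M) (m : ℕ) :
    ∑ w ∈ range (m * 2), f w = ∑ q ∈ range m, (f (2 * q) + f (2 * q + 1)) := by
  induction m with
  | zero => simp
  | succ m ih =>
    rw [add_mul, one_mul, sum_range_succ, sum_range_succ, ih, sum_range_succ, mul_comm m 2, add_assoc]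

-- Pair `2 * q` with `2 * q + 1`. For an element `N` of `S` the low bit contributes `1 - 1 = 0` if
-- `N ∉ A` and `1 + 0 = 1` if `N ∈ A`. The bits of `w` that are never read account for the power of
-- two, so the range of summation need not depend on `S`.
open Classical in
theorem sum_signedTerm (S A : Finset ℕ) : ∀ N K : ℕ, #{v ∈ range N | v ∈ S} ≤ K →
    ∑ w ∈ range (2 ^ K), signedTerm S A N w =
      2 ^ (K - #{v ∈ range N | v ∈ S}) * if ∀ v < N, v ∈ S → v ∈ A then 1 else 0 := by
  intro N
  induction N with
  | zero => intro K _; simp [signedTerm]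
  | succ N ih =>
    intro K hK
    rw [range_add_one, filter_insert] at hK ⊢
    by_cases hN : N ∈ S
    · rw [if_pos hN, card_insert_of_notMem (by simp)] at hK ⊢
      obtain ⟨K, rfl⟩ : ∃ K', K = K' + 1 := ⟨K - 1, by omega⟩
      rw [pow_succ, sum_range_mul_two, Nat.add_sub_add_right]
      have h1 : ∀ q, signedTerm S A (N + 1) (2 * q) + signedTerm S A (N + 1) (2 * q + 1) =
          (if N ∈ A then 1 else 0) * signedTerm S A N q := by
        intro q
        have e1 : 2 * q % 2 = 0 := by omega
        have e2 : (2 * q + 1) % 2 = 1 := by omega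
        have e3 : 2 * q / 2 = q := by omega
        have e4 : (2 * q + 1) / 2 = q := by omega
        simp only [signedTerm, hN, if_true, e1, e2, e3, e4]
        split_ifs <;> simp_all
      simp only [h1]
      rw [← mul_sum, ih K (by omega), mul_left_comm]
      congr 1
      by_cases hA : N ∈ A
      · simp only [hA, if_true, one_mul]
        congr 1
        refine propext ⟨fun h v hv hvS => ?_, fun h v hv => h v (by omega)⟩
        rcases (Nat.lt_succ_iff_lt_or_eq.1 hv) with hv | rfl
        exacts [h v hv hvS, hA]
      · rw [if_neg hA, zero_mul, if_neg fun h => hA (h N (by omega) hN)]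
    · rw [if_neg hN] at hK ⊢
      simp only [signedTerm, hN, if_false]
      rw [ih K hK]
      congr 2
      refine propext ⟨fun h v hv hvS => ?_, fun h v hv => h v (by omega)⟩
      rcases (Nat.lt_succ_iff_lt_or_eq.1 hv) with hv | rfl
      exacts [h v hv hvS, absurd hvS hN]

/-! ### Searching for obstructions, and branching on them -/

open Classical in
/-- The entries of the adjacency matrix. -/
noncomputable def adjN {n : ℕ} (G : SimpleGraph (Fin n)) (a b : ℕ) : ℕ :=
  if ∃ u v : Fin n, G.Adj u v ∧ a = u ∧ b = v then 1 else 0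

/-- The indicator function of a set. -/
def indN (S : Finset ℕ) (a : ℕ) : ℕ := if a ∈ S then 1 else 0

/-- The vertices of a set as numbers. -/
def toNat {n : ℕ} (S : Finset (Fin n)) : Finset ℕ := S.map Fin.valEmbedding

@[simp] theorem mem_toNat {n : ℕ} {S : Finset (Fin n)} {a : Fin n} : (a : ℕ) ∈ toNat S ↔ a ∈ S :=
  mem_map' Fin.valEmbedding

theorem lt_of_mem_toNat {n : ℕ} {S : Finset (Fin n)} {a : ℕ} (h : a ∈ toNat S) : a < n := by
  obtain ⟨x, _, rfl⟩ := mem_map.1 h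
  exact x.2

theorem card_toNat {n : ℕ} (S : Finset (Fin n)) : (toNat S).card = S.card := card_map _

variable {n : ℕ} (G : SimpleGraph (Fin n))

@[simp] theorem adjN_val (u v : Fin n) [Decidable (G.Adj u v)] :
    adjN G u v = if G.Adj u v then 1 else 0 := by
  classical
  have h : (∃ u' v' : Fin n, G.Adj u' v' ∧ (u : ℕ) = u' ∧ (v : ℕ) = v') ↔ G.Adj u v := by
    refine ⟨?_, fun h => ⟨u, v, h, rfl, rfl⟩⟩
    rintro ⟨u', v', h, hu, hv⟩
    rwa [Fin.ext hu, Fin.ext hv]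
  simp only [adjN, h]

theorem adjN_le_one (a b : ℕ) : adjN G a b ≤ 1 := by
  unfold adjN; split_ifs <;> simp

/-- The degree of a vertex. -/
noncomputable def degN (a : ℕ) : ℕ := ∑ u ∈ range n, adjN G a u

theorem degN_le (a : ℕ) : degN G a ≤ n :=
  (sum_le_card_nsmul _ _ 1 fun u _ => adjN_le_one G a u).trans (by simp)

theorem degN_val (a : Fin n) : degN G a = (G.neighborSet a).ncard := by
  classical
  rw [degN, sum_range]
  simp only [adjN_val]
  rw [sum_boole, Set.ncard_eq_toFinset_card', Nat.cast_id]
  congr 1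
  ext
  simp

/-- A number which is nonzero if `a`, `b`, `c` form an obstruction that avoids `S`. -/
noncomputable def violation (S : Finset ℕ) (a b c : ℕ) : ℕ :=
  adjN G a b * adjN G a c * ((degN G a - 2) * (b - c + (c - b)) + (2 - degN G a)) *
    ((1 - indN S a) * ((1 - indN S b) * (1 - indN S c)))

/-- With truncated subtraction, `b - c + (c - b)` vanishes only for `b = c`, `degN - 2` is nonzero
from degree three on, and `2 - degN` is nonzero for degree at most one. Degree zero is excluded by
the adjacency factors. -/
theorem violation_ne_zero {S : Finset ℕ} {a b c : Fin n} :
    violation G S a b c ≠ 0 ↔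
      G.IsObstruction a b c ∧ (a : ℕ) ∉ S ∧ (b : ℕ) ∉ S ∧ (c : ℕ) ∉ S := by
  classical
  have hS : ∀ x : ℕ, 1 - indN S x ≠ 0 ↔ x ∉ S := by
    intro x; unfold indN; split_ifs <;> simp_all
  simp only [violation, mul_ne_zero_iff, hS, SimpleGraph.IsObstruction, adjN_val, degN_val,
    and_assoc]
  rw [ite_ne_right_iff, ite_ne_right_iff]
  simp only [ne_eq, one_ne_zero, not_false_eq_true, and_true]
  refine and_congr_right fun hab => and_congr_right fun hac => and_congr ?_ Iff.rfl
  have hpos : 0 < (G.neighborSet a).ncard := (Set.ncard_pos (Set.toFinite _)).2 ⟨b, hab⟩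
  rw [Fin.ext_iff]
  rw [Nat.add_eq_zero_iff, mul_eq_zero]
  omega

/-- The violation with the given index. -/
noncomputable def violationAt (S : Finset ℕ) (x : ℕ) : ℕ :=
  violation G S (x / (n * n)) (x / n % n) (x % n)

/-- A linear search: the successor of the least `x < i` with `p x ≠ 0`, and `F` if there is none. -/
def search (p : ℕ → ℕ) : ℕ → ℕ → ℕ
  | 0, F => F
  | i + 1, F => search p i (if p i ≠ 0 then i + 1 else F)

theorem search_cases (p : ℕ → ℕ) : ∀ i F, (search p i F = F ∧ ∀ x < i, p x = 0) ∨
    ∃ x < i, search p i F = x + 1 ∧ p x ≠ 0 := by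
  intro i
  induction i with
  | zero => intro F; exact .inl ⟨rfl, by simp⟩
  | succ i ih =>
    intro F
    simp only [search]
    rcases ih (if p i ≠ 0 then i + 1 else F) with ⟨h1, h2⟩ | ⟨x, hx, h⟩
    · by_cases h0 : p i = 0
      · rw [if_neg (by simpa using h0)] at h1 ⊢
        refine .inl ⟨h1, fun x hx => ?_⟩
        rcases (Nat.lt_succ_iff_lt_or_eq.1 hx) with hx | rfl
        exacts [h2 x hx, h0]
      · rw [if_pos h0] at h1 ⊢
        exact .inr ⟨i, by omega, h1, h0⟩
    · exact .inr ⟨x, by omega, h⟩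

/-- The successor of the index of the first violation, or `0`. -/
noncomputable def firstViolation (S : Finset ℕ) : ℕ := search (violationAt G S) (n * n * n) 0

theorem exists_of_firstViolation_ne_zero {S : Finset ℕ} (h : firstViolation G S ≠ 0) :
    ∃ a b c : Fin n, (firstViolation G S - 1) / (n * n) = a ∧
      (firstViolation G S - 1) / n % n = b ∧ (firstViolation G S - 1) % n = c ∧
      G.IsObstruction a b c ∧ (a : ℕ) ∉ S ∧ (b : ℕ) ∉ S ∧ (c : ℕ) ∉ S := by
  rcases search_cases (violationAt G S) (n * n * n) 0 with ⟨h1, _⟩ | ⟨x, hx, h1, h2⟩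
  · exact absurd h1 h
  · have hF : firstViolation G S - 1 = x := by unfold firstViolation; omega
    have hn : 0 < n := by
      rcases Nat.eq_zero_or_pos n with h | h
      · subst h; simp at hx
      · exact h
    rw [hF]
    refine ⟨⟨x / (n * n), ?_⟩, ⟨x / n % n, Nat.mod_lt _ hn⟩, ⟨x % n, Nat.mod_lt _ hn⟩, rfl, rfl, rfl,
      (violation_ne_zero G).1 h2⟩
    rw [Nat.div_lt_iff_lt_mul (by positivity)]
    linarith

/-- The triple is found at the index with base `n` digits `a`, `b`, `c`, which is below `n ^ 3`. -/
theorem hits_of_firstViolation_eq_zero {S : Finset ℕ} (h : firstViolation G S = 0) {a b c : Fin n}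
    (hv : G.IsObstruction a b c) : (a : ℕ) ∈ S ∨ (b : ℕ) ∈ S ∨ (c : ℕ) ∈ S := by
  rcases search_cases (violationAt G S) (n * n * n) 0 with ⟨_, h1⟩ | ⟨x, _, h1, _⟩
  · by_contra! hcon
    have hn : 0 < n := a.pos
    have hx := h1 (a * (n * n) + (b * n + c)) (by
      have ha := a.2; have hb := b.2; have hc := c.2
      have e1 : (b : ℕ) * n + c < n * n := by nlinarith
      nlinarith)
    have e1 : (b : ℕ) * n + c < n * n := by have hb := b.2; have hc := c.2; nlinarith
    rw [violationAt] at hx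
    have d1 : ((a : ℕ) * (n * n) + (b * n + c)) / (n * n) = a := by
      rw [mul_comm, Nat.mul_add_div (by positivity), Nat.div_eq_of_lt e1, add_zero]
    have d2 : ((a : ℕ) * (n * n) + (b * n + c)) / n % n = b := by
      rw [show (a : ℕ) * (n * n) + (b * n + c) = n * (n * a + b) + c by ring,
        Nat.mul_add_div hn, Nat.div_eq_of_lt c.2, add_zero, Nat.mul_add_mod, Nat.mod_eq_of_lt b.2]
    have d3 : ((a : ℕ) * (n * n) + (b * n + c)) % n = c := by
      rw [show (a : ℕ) * (n * n) + (b * n + c) = n * (n * a + b) + c by ring,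
        Nat.mul_add_mod, Nat.mod_eq_of_lt c.2]
    rw [d1, d2, d3] at hx
    exact (violation_ne_zero G).2 ⟨hv, hcon⟩ hx
  · unfold firstViolation at h; omega

/-- The vertex of the violation with index `x` selected by `d`. -/
def pick (n d x : ℕ) : ℕ := if d = 0 then x / (n * n) else if d = 1 then x / n % n else x % n

/-- The result of branching for `i` steps, starting from `S`, according to the digits of `q`. -/
noncomputable def branch : ℕ → Finset ℕ → ℕ → Finset ℕ
  | 0, S, _ => S
  | i + 1, S, q =>
    if firstViolation G S = 0 then branch i S q
    else branch i (insert (pick n (q % 3) (firstViolation G S - 1)) S) (q / 3)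

theorem subset_branch : ∀ (i : ℕ) (S : Finset ℕ) (q : ℕ), S ⊆ branch G i S q := by
  intro i
  induction i with
  | zero => intro S q; exact Subset.rfl
  | succ i ih =>
    intro S q
    rw [branch]
    split_ifs
    · exact ih S q
    · exact (subset_insert _ _).trans (ih _ _)

theorem pick_lt {S : Finset ℕ} (h : firstViolation G S ≠ 0) (d : ℕ) :
    pick n d (firstViolation G S - 1) < n := by
  obtain ⟨a, b, c, ha, hb, hc, _⟩ := exists_of_firstViolation_ne_zero G h
  unfold pick
  rw [ha, hb, hc]
  split_ifs
  exacts [a.2, b.2, c.2]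

theorem branch_lt : ∀ (i : ℕ) (S : Finset ℕ) (q : ℕ), (∀ v ∈ S, v < n) →
    ∀ v ∈ branch G i S q, v < n := by
  intro i
  induction i with
  | zero => intro S q h; exact h
  | succ i ih =>
    intro S q h
    rw [branch]
    split_ifs with h0
    · exact ih S q h
    · refine ih _ _ fun v hv => ?_
      rcases mem_insert.1 hv with rfl | hv
      exacts [pick_lt G h0 _, h v hv]

theorem branch_of_firstViolation_eq_zero {S : Finset ℕ} (h : firstViolation G S = 0) (i q : ℕ) :
    branch G i S q = S := by
  induction i with
  | zero => rfl
  | succ i ih => rw [branch, if_pos h, ih]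

/-- Let `Z` choose the digits: it meets the current violation in a vertex outside `S`, and adding
this vertex keeps `S ⊆ Z`. After enough steps `S = Z`, which has no violations. If `S` has no
violation earlier, the remaining steps do nothing. -/
theorem exists_branch {Z : Finset (Fin n)}
    (hZ : ∀ a b c, G.IsObstruction a b c → a ∈ Z ∨ b ∈ Z ∨ c ∈ Z) :
    ∀ (i : ℕ) (S : Finset ℕ), S ⊆ toNat Z → Z.card ≤ S.card + i →
      ∃ m < 3 ^ i, branch G i S m ⊆ toNat Z ∧ firstViolation G (branch G i S m) = 0 := by
  intro i
  induction i with
  | zero =>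
    intro S hS hc
    have : S = toNat Z := eq_of_subset_of_card_le hS (by rw [card_toNat]; omega)
    refine ⟨0, by simp, hS, ?_⟩
    by_contra h0
    obtain ⟨a, b, c, _, _, _, hv, ha, hb, hc⟩ := exists_of_firstViolation_ne_zero G h0
    simp only [branch, this, mem_toNat] at ha hb hc
    rcases hZ a b c hv with h | h | h <;> contradiction
  | succ i ih =>
    intro S hS hc
    by_cases h0 : firstViolation G S = 0
    · refine ⟨0, by positivity, ?_⟩
      rw [branch_of_firstViolation_eq_zero G h0]
      exact ⟨hS, h0⟩
    obtain ⟨a, b, c, ea, eb, ec, hv, ha, hb, hc'⟩ := exists_of_firstViolation_ne_zero G h0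
    obtain ⟨d, hd, x, hx, hxZ, hxS⟩ : ∃ d < 3, ∃ x : Fin n,
        pick n d (firstViolation G S - 1) = x ∧ x ∈ Z ∧ (x : ℕ) ∉ S := by
      rcases hZ a b c hv with h | h | h
      · exact ⟨0, by norm_num, a, by simp [pick, ea], h, ha⟩
      · exact ⟨1, by norm_num, b, by simp [pick, eb], h, hb⟩
      · exact ⟨2, by norm_num, c, by simp [pick, ec], h, hc'⟩
    obtain ⟨m, hm, h1, h2⟩ := ih (insert (x : ℕ) S) (insert_subset (mem_toNat.2 hxZ) hS)
      (by rw [card_insert_of_notMem hxS]; omega)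
    -- `branch` reads the lowest digit first, so the present choice `d` goes below the later ones in
    -- `m`.
    refine ⟨3 * m + d, by rw [pow_succ]; omega, ?_⟩
    rw [branch, if_neg h0, show (3 * m + d) % 3 = d by omega, show (3 * m + d) / 3 = m by omega, hx]
    exact ⟨h1, h2⟩

end MinConnectedCore

namespace RAM.St

/-- Sequential composition. -/
notation:60 s:61 " ;; " t:60 => St.seq s t

@[simp] theorem den_skip (σ : State) : skip.den σ = σ := rfl
@[simp] theorem den_set (x : ℕ) (e : Ex) (σ : State) : (set x e).den σ = σ.setReg x (e.eval σ) :=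
  rfl
@[simp] theorem den_store (a e : Ex) (σ : State) :
    (store a e).den σ = σ.setMem (a.eval σ) (e.eval σ) := rfl
@[simp] theorem den_seq (s t : St) (σ : State) : (s ;; t).den σ = t.den (s.den σ) := rfl
@[simp] theorem den_ite (e : Ex) (s t : St) (σ : State) :
    (ite e s t).den σ = if e.eval σ ≠ 0 then s.den σ else t.den σ := rfl

theorem den_ite_pos {e : Ex} {s t : St} {σ : State} (h : e.eval σ ≠ 0) :
    (ite e s t).den σ = s.den σ := if_pos h

theorem den_ite_neg {e : Ex} {s t : St} {σ : State} (h : e.eval σ = 0) :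
    (ite e s t).den σ = t.den σ := if_neg (not_not.2 h)

end RAM.St

namespace MinConnectedCore

open RAM RAM.Ex RAM.St Finset

/-! ### The program

The memory is divided into rows of `n` cells: row `0` holds the set `X`, the rows `1, …, n` hold the
adjacency matrix, row `n + 1` a set `S` that grows by branching, row `n + 2` the set of the forbidden
vertices, and row `n + 3 + i` the numbers of branching walks with `i` edges.

Variables: `0` the number `n` of vertices, `1` the input `k`, `2` the number of edges of the
branching walks, `3` the minimum `K` of `n` and `k`, `4` the modulus, `5` `3 ^ K`, `6` `2 ^ K`,
`7` `n ^ 3`, `8` the minimum size, `9` the result of the search for a core, `16` the result of the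
search for a violation, `17` the number that guides the branching, `22` the signed sum, `23` the
number that determines the set of the forbidden vertices. -/

/-- The cell in the row `r` and the column `a`. -/
def cell (r a : Ex) : Ex := v 0 * r + a

/-- The degree of vertex `11`. -/
def degreeProg : St :=
  set 14 (c 0) ;; for_ 15 (v 0) (set 14 ((v 14 + ld (cell (v 11 + c 1) (v 15))) % v 4))

/-- The body of the search for a violation. -/
def searchBody : St :=
  set 11 (v 10 / (v 0 * v 0)) ;; set 12 (v 10 / v 0 % v 0) ;; set 13 (v 10 % v 0) ;; degreeProg ;;
  ite (ld (cell (v 11 + c 1) (v 12)) * ld (cell (v 11 + c 1) (v 13)) *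
      ((v 14 - c 2) * (v 12 - v 13 + (v 13 - v 12)) + (c 2 - v 14)) *
      ((c 1 - ld (cell (v 0 + c 1) (v 11))) * ((c 1 - ld (cell (v 0 + c 1) (v 12))) *
        (c 1 - ld (cell (v 0 + c 1) (v 13))))))
    (set 16 ((v 10 + c 1) % v 4)) skip

/-- The search for a violation. -/
def searchProg : St := set 16 (c 0) ;; for_ 10 (v 7) searchBody

/-- Copy the row `0` to the row `n + 1`. -/
def copyProg : St := for_ 19 (v 0) (store (cell (v 0 + c 1) (v 19)) (ld (v 19)))

/-- One branching step. -/
def branchBody : St :=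
  searchProg ;; ite (v 16)
    (set 16 (v 16 - c 1) ;;
      ite (v 18 % c 3) (ite (v 18 % c 3 - c 1) (set 21 (v 16 % v 0)) (set 21 (v 16 / v 0 % v 0)))
        (set 21 (v 16 / (v 0 * v 0))) ;;
      set 18 (v 18 / c 3) ;; store (cell (v 0 + c 1) (v 21)) (c 1))
    skip

/-- Branching. -/
def branchProg : St := for_ 20 (v 3) branchBody

/-- The size of the set `S`. -/
def cardProg : St :=
  set 21 (c 0) ;; for_ 19 (v 0) (set 21 ((v 21 + ld (cell (v 0 + c 1) (v 19))) % v 4))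

/-- The forbidden vertices. -/
def forbidProg : St :=
  set 24 (v 23) ;; set 25 (c 0) ;; for_ 19 (v 0) (ite (ld (cell (v 0 + c 1) (v 19)))
    (store (cell (v 0 + c 2) (v 19)) (v 24 % c 2) ;; set 25 ((v 25 + v 24) % c 2 % v 4) ;;
      set 24 (v 24 / c 2))
    (store (cell (v 0 + c 2) (v 19)) (c 0)))

/-- The contribution of one splitting of the edges to the number of branching walks. -/
def splitProg : St :=
  for_ 15 (v 0) (set 29 ((v 29 + ld (cell (v 19 + c 1) (v 15)) *
    (ld (cell (v 0 + c 3 + v 28) (v 19)) * ld (cell (v 0 + c 3 + (v 27 - c 1 - v 28)) (v 15)))) %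
      v 4))

/-- The number of branching walks with `27` edges from vertex `19`. -/
def walkProg : St :=
  set 29 (c 1 - ld (cell (v 0 + c 2) (v 19)) - v 27) ;; for_ 28 (v 3 - c 1 - v 26) splitProg

/-- The numbers of branching walks with `27` edges. -/
def rowProg : St :=
  for_ 19 (v 0) (walkProg ;; store (cell (v 0 + c 3 + v 27) (v 19)) (v 29))

/-- The table of the numbers of branching walks. -/
def tableProg : St := for_ 26 (v 3) (set 27 (v 3 - c 1 - v 26) ;; rowProg)

/-- The sum of the numbers of branching walks with `2` edges. -/
def totalProg : St :=
  set 29 (c 0) ;; for_ 19 (v 0) (set 29 ((v 29 + ld (cell (v 0 + c 3 + v 2) (v 19))) % v 4))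

/-- The contribution of one set of forbidden vertices to the signed sum. -/
def summandProg : St :=
  forbidProg ;; tableProg ;; totalProg ;;
  ite (v 25) (set 22 ((v 22 + (v 4 - v 29)) % v 4)) (set 22 ((v 22 + v 29) % v 4))

/-- The signed sum over all sets of forbidden vertices. -/
def sumProg : St := set 22 (c 0) ;; for_ 23 (v 6) summandProg

/-- The test of one result of branching. -/
def testBody : St :=
  set 18 (v 17) ;; copyProg ;; branchProg ;; searchProg ;; cardProg ;;
  ite (v 16 + (v 21 - v 3)) skip (sumProg ;; ite (v 22) (set 9 (c 1)) skip)

/-- The search for a connected core with `2` edges in a spanning tree. -/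
def coreProg : St := set 9 (c 0) ;; for_ 17 (v 5) testBody

/-! ### Memory -/

/-- The row `r` of the memory holds the function `f`. -/
def Row (n r : ℕ) (f : ℕ → ℕ) (σ : State) : Prop := ∀ a < n, σ.mem (n * r + a) = f a

/-- The memory cells below `L` agree. -/
def Low (L : ℕ) (σ τ : State) : Prop := ∀ a < L, τ.mem a = σ.mem a

theorem Low.trans {L : ℕ} {σ τ ρ : State} (h : Low L σ τ) (h' : Low L τ ρ) : Low L σ ρ :=
  fun a ha => (h' a ha).trans (h a ha)

theorem Low.mono {L L' : ℕ} {σ τ : State} (h : Low L σ τ) (hL : L' ≤ L) : Low L' σ τ :=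
  fun a ha => h a (ha.trans_le hL)

theorem Low.of_mem_eq {L : ℕ} {σ τ : State} (h : τ.mem = σ.mem) : Low L σ τ :=
  fun a _ => by rw [h]

theorem Low.setMem {L a : ℕ} {σ τ : State} (h : Low L σ τ) (ha : L ≤ a) (x : ℕ) :
    Low L σ (τ.setMem a x) := fun b hb => by
  rw [State.setMem_mem, if_neg (by omega), h b hb]

theorem Row.low {n r : ℕ} {f : ℕ → ℕ} {σ τ : State} (h : Row n r f σ) {L : ℕ} (h' : Low L σ τ)
    (hL : n * (r + 1) ≤ L) : Row n r f τ := fun a ha => by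
  rw [h' _ (by rw [mul_add] at hL; omega), h a ha]

theorem Row.of_mem_eq {n r : ℕ} {f : ℕ → ℕ} {σ τ : State} (h : Row n r f σ)
    (h' : τ.mem = σ.mem) : Row n r f τ := fun a ha => by rw [h', h a ha]

theorem cell_eq_iff {n r a r' a' : ℕ} (ha : a < n) (ha' : a' < n) :
    n * r + a = n * r' + a' ↔ r = r' ∧ a = a' := by
  refine ⟨fun h => ?_, by rintro ⟨rfl, rfl⟩; rfl⟩
  have hn : 0 < n := by omega
  have h1 : (n * r + a) / n = (n * r' + a') / n := by rw [h]
  rw [Nat.mul_add_div hn, Nat.mul_add_div hn, Nat.div_eq_of_lt ha, Nat.div_eq_of_lt ha'] at h1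
  have h2 : r = r' := by omega
  subst h2
  exact ⟨rfl, by omega⟩

@[simp] theorem eval_cell (σ : State) (r a : Ex) :
    (cell r a).eval σ = σ.reg 0 * r.eval σ + a.eval σ := rfl

/-- The constant variables and the adjacency matrix. -/
structure Env {n : ℕ} (G : SimpleGraph (Fin n)) (K B : ℕ) (σ : State) : Prop where
  reg0 : σ.reg 0 = n
  reg3 : σ.reg 3 = K
  reg4 : σ.reg 4 = 2 ^ B
  reg5 : σ.reg 5 = 3 ^ K
  reg6 : σ.reg 6 = 2 ^ K
  reg7 : σ.reg 7 = n * n * n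
  adj : ∀ a < n, Row n (a + 1) (adjN G a) σ
  one_le : 1 ≤ B
  cube_lt : n * n * n < 2 ^ B
  count_lt : 2 ^ K * (n * (4 ^ K * n ^ K)) < 2 ^ B

variable {n : ℕ} {G : SimpleGraph (Fin n)} {K B : ℕ} {σ τ : State}

/-- The statement does not write the constant variables. -/
abbrev KeepsConst (s : St) : Prop :=
  s.wr 0 = false ∧ s.wr 3 = false ∧ s.wr 4 = false ∧ s.wr 5 = false ∧ s.wr 6 = false ∧
    s.wr 7 = false

/-- Row `0` is left free on purpose: the self-reduction changes the set stored there while the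
adjacency matrix stays. -/
theorem Env.frame_of_adj (h : Env G K B σ) {s : St} (hs : KeepsConst s)
    (hr : ∀ r, s.wr r = false → τ.reg r = σ.reg r)
    (hm : ∀ a, n ≤ a → a < n * (n + 1) → τ.mem a = σ.mem a) : Env G K B τ where
  reg0 := (hr 0 hs.1).trans h.reg0
  reg3 := (hr 3 hs.2.1).trans h.reg3
  reg4 := (hr 4 hs.2.2.1).trans h.reg4
  reg5 := (hr 5 hs.2.2.2.1).trans h.reg5
  reg6 := (hr 6 hs.2.2.2.2.1).trans h.reg6
  reg7 := (hr 7 hs.2.2.2.2.2).trans h.reg7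
  adj a ha b hb := by
    rw [hm _ (by nlinarith) (by nlinarith), h.adj a ha b hb]
  one_le := h.one_le
  cube_lt := h.cube_lt
  count_lt := h.count_lt

theorem Env.frame (h : Env G K B σ) {s : St} (hs : KeepsConst s)
    (hr : ∀ r, s.wr r = false → τ.reg r = σ.reg r) (hm : Low (n * (n + 1)) σ τ) :
    Env G K B τ :=
  h.frame_of_adj hs hr fun a _ ha => hm a ha

theorem Env.den (h : Env G K B σ) {s : St} (hs : KeepsConst s)
    (hm : Low (n * (n + 1)) σ (s.den σ)) : Env G K B (s.den σ) :=
  h.frame hs (fun _ hr => den_reg s hr σ) hm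

theorem Env.setReg (h : Env G K B σ) (d x : ℕ) (hd : KeepsConst (set d (c 0))) :
    Env G K B (σ.setReg d x) :=
  h.frame hd (fun r hr => by simp [wr] at hr; simp [hr]) (Low.of_mem_eq rfl)

theorem Env.lt_modulus (h : Env G K B σ) : n < 2 ^ B :=
  lt_of_le_of_lt (by nlinarith [Nat.zero_le n, Nat.le_mul_self n]) h.cube_lt

/-! ### The search for a violation -/

theorem degreeProg_spec (h : Env G K B σ) {a : ℕ} (ha : a < n) (h11 : σ.reg 11 = a) :
    (degreeProg.den σ).reg 14 = degN G a := by
  have hM := h.lt_modulus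
  have := den_for (x := 15) (e := v 0) (σ := σ.setReg 14 0) (N := n)
    (s := set 14 ((v 14 + ld (cell (v 11 + c 1) (v 15))) % v 4))
    (fun i τ => τ.reg 14 + ∑ u ∈ range i, adjN G a u = degN G a)
    (by simp [h.reg0]) (by simp [degN]) (by
      intro i hi τ hr hm hI
      have h0 : τ.reg 0 = n := (hr 0 rfl).trans (by simp [h.reg0])
      have h4 : τ.reg 4 = 2 ^ B := (hr 4 rfl).trans (by simp [h.reg4])
      have h11' : τ.reg 11 = a := (hr 11 rfl).trans (by simp [h11])
      have hadj : τ.mem (n * (a + 1) + i) = adjN G a i := by rw [hm rfl]; exact h.adj a ha i hi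
      rw [sum_range_succ] at hI
      have hle := degN_le G a
      have : τ.reg 14 + adjN G a i < 2 ^ B := by omega
      simp [h0, h4, h11', hadj, Nat.mod_eq_of_lt this]
      omega)
  simpa [degreeProg] using this

theorem searchProg_spec (h : Env G K B σ) {S : Finset ℕ} (hS : Row n (n + 1) (indN S) σ) :
    (searchProg.den σ).reg 16 = firstViolation G S := by
  have := den_for (x := 10) (e := v 7) (σ := σ.setReg 16 0) (N := n * n * n) (s := searchBody)
    (fun i τ => search (violationAt G S) i (τ.reg 16) = firstViolation G S)
    (by simp [h.reg7]) (by simp [firstViolation]) (by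
      intro i hi τ hr hm hI
      have hE : Env G K B τ := (h.setReg 16 0 (by decide)).frame (by decide) hr
        (Low.of_mem_eq (hm rfl))
      have hn : 0 < n := by
        rcases Nat.eq_zero_or_pos n with h | h
        · subst h; simp at hi
        · exact h
      have ha : i / (n * n) < n := by
        rw [Nat.div_lt_iff_lt_mul (by positivity)]; linarith
      have hb : i / n % n < n := Nat.mod_lt _ hn
      have hc : i % n < n := Nat.mod_lt _ hn
      have hS' : Row n (n + 1) (indN S) τ := hS.of_mem_eq (hm rfl)
      set ρ : State := (((τ.setReg 10 i).setReg 11 (i / (n * n))).setReg 12 (i / n % n)).setReg 13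
        (i % n) with hρ
      have hEρ : Env G K B ρ := (((hE.setReg 10 _ (by decide)).setReg 11 _ (by decide)).setReg 12 _
        (by decide)).setReg 13 _ (by decide)
      have h14 := degreeProg_spec hEρ ha (by simp [hρ])
      have hmem : (degreeProg.den ρ).mem = τ.mem := (den_mem degreeProg rfl ρ).trans rfl
      have hreg : ∀ r, degreeProg.wr r = false → (degreeProg.den ρ).reg r = ρ.reg r :=
        fun r hr => den_reg degreeProg hr ρ
      have e1 := hE.adj _ ha _ hb
      have e2 := hE.adj _ ha _ hc
      have e3 := hS' _ ha
      have e4 := hS' _ hb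
      have e5 := hS' _ hc
      have hbody : searchBody.den (τ.setReg 10 i) = if violationAt G S i ≠ 0 then
          (degreeProg.den ρ).setReg 16 ((i + 1) % 2 ^ B) else degreeProg.den ρ := by
        have r0 : (degreeProg.den ρ).reg 0 = n := (hreg 0 rfl).trans hEρ.reg0
        have r4 : (degreeProg.den ρ).reg 4 = 2 ^ B := (hreg 4 rfl).trans hEρ.reg4
        have r10 : (degreeProg.den ρ).reg 10 = i := (hreg 10 rfl).trans (by simp [hρ])
        have r11 : (degreeProg.den ρ).reg 11 = i / (n * n) := (hreg 11 rfl).trans (by simp [hρ])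
        have r12 : (degreeProg.den ρ).reg 12 = i / n % n := (hreg 12 rfl).trans (by simp [hρ])
        have r13 : (degreeProg.den ρ).reg 13 = i % n := (hreg 13 rfl).trans (by simp [hρ])
        have hstart : searchBody.den (τ.setReg 10 i) =
            (ite (ld (cell (v 11 + c 1) (v 12)) * ld (cell (v 11 + c 1) (v 13)) *
              ((v 14 - c 2) * (v 12 - v 13 + (v 13 - v 12)) + (c 2 - v 14)) *
              ((c 1 - ld (cell (v 0 + c 1) (v 11))) * ((c 1 - ld (cell (v 0 + c 1) (v 12))) *
              (c 1 - ld (cell (v 0 + c 1) (v 13)))))) (set 16 ((v 10 + c 1) % v 4)) skip).den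
              (degreeProg.den ρ) := by
          simp only [searchBody, den_seq]
          congr 2
          simp [hρ, hE.reg0]
        rw [hstart]
        simp only [den_ite, eval_mul, eval_ld, eval_cell, eval_add, eval_sub, eval_v, eval_c, r0, r4,
          r10, r11, r12, r13, h14, hmem, e1, e2, e3, e4, e5, den_set, eval_mod, den_skip]
        rfl
      rw [hbody]
      rw [search] at hI
      split_ifs with hv
      · rw [if_pos hv] at hI
        have : i + 1 < 2 ^ B := by have := h.cube_lt; omega
        simpa [Nat.mod_eq_of_lt this] using hI
      · rw [if_neg hv] at hI
        rw [hreg 16 rfl]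
        simpa [hρ] using hI)
  simpa [searchProg, search] using this

/-! ### Branching -/

theorem copyProg_spec (h : Env G K B σ) {f : ℕ → ℕ} (hf : Row n 0 f σ) :
    Row n (n + 1) f (copyProg.den σ) ∧ Low (n * (n + 1)) σ (copyProg.den σ) := by
  have := den_for (x := 19) (e := v 0) (σ := σ) (N := n)
    (s := store (cell (v 0 + c 1) (v 19)) (ld (v 19)))
    (fun i τ => (∀ a < n, i ≤ a → τ.mem (n * (n + 1) + a) = f a) ∧ Low (n * (n + 1)) σ τ)
    (by simp [h.reg0]) ⟨fun a ha ha' => by omega, Low.of_mem_eq rfl⟩ (by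
      intro i hi τ hr hm ⟨h1, h2⟩
      have h0 : τ.reg 0 = n := (hr 0 rfl).trans h.reg0
      have hfi : τ.mem i = f i := by
        rw [h2 i (by nlinarith)]
        simpa using hf i hi
      simp only [den_store, eval_cell, eval_add, eval_v, eval_c, eval_ld, State.setReg_reg,
        State.setReg_mem, h0]
      norm_num
      simp only [hfi]
      refine ⟨fun a ha ha' => ?_, (h2.trans (Low.of_mem_eq rfl)).setMem (by omega) _⟩
      rw [State.setMem_mem]
      split_ifs with he
      · rw [cell_eq_iff ha hi] at he; rw [he.2]
      · exact h1 a ha (by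
          rcases Nat.lt_or_eq_of_le ha' with h | h
          · exact h
          · subst h; exact absurd rfl he))
  exact ⟨fun a ha => this.1 a ha (Nat.zero_le _), this.2⟩

theorem indN_insert (S : Finset ℕ) (x a : ℕ) :
    indN (insert x S) a = if a = x then 1 else indN S a := by
  unfold indN
  by_cases h : a = x <;> simp [h]

/-- The invariant is that branching from the stored set with the remaining steps and the remaining
digits still gives the intended final set. -/
theorem branchProg_spec (h : Env G K B σ) {S : Finset ℕ} (hS : Row n (n + 1) (indN S) σ) {q : ℕ}
    (hq : σ.reg 18 = q) : Row n (n + 1) (indN (branch G K S q)) (branchProg.den σ) ∧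
      Low (n * (n + 1)) σ (branchProg.den σ) := by
  have := den_for (x := 20) (e := v 3) (σ := σ) (N := K) (s := branchBody)
    (fun i τ => ∃ S', Row n (n + 1) (indN S') τ ∧ branch G i S' (τ.reg 18) = branch G K S q ∧
      Low (n * (n + 1)) σ τ)
    (by simp [h.reg3]) ⟨S, hS.of_mem_eq rfl, by simp [hq], Low.of_mem_eq rfl⟩ (by
      rintro i hi τ hr - ⟨S', h1, h2, h3⟩
      have hE : Env G K B (τ.setReg 20 i) := (h.frame (by decide) hr h3).setReg 20 _ (by decide)
      have hS' : Row n (n + 1) (indN S') (τ.setReg 20 i) := h1.of_mem_eq rfl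
      have h16 := searchProg_spec hE hS'
      have hmem : (searchProg.den (τ.setReg 20 i)).mem = τ.mem := (den_mem searchProg rfl _).trans rfl
      have hreg : ∀ r, searchProg.wr r = false →
        (searchProg.den (τ.setReg 20 i)).reg r = (τ.setReg 20 i).reg r :=
        fun r hr => den_reg searchProg hr _
      have r0 := (hreg 0 rfl).trans hE.reg0
      have r18 : (searchProg.den (τ.setReg 20 i)).reg 18 = τ.reg 18 :=
        (hreg 18 rfl).trans (by simp)
      simp only [branchBody, den_seq]
      set ρ := searchProg.den (τ.setReg 20 i) with hρ
      rw [branch] at h2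
      by_cases h0 : firstViolation G S' = 0
      · rw [if_pos h0] at h2
        rw [den_ite, eval_v, h16, if_neg (by simpa using h0), den_skip]
        exact ⟨S', h1.of_mem_eq hmem, by rw [r18, h2], h3.trans (Low.of_mem_eq hmem)⟩
      · rw [if_neg h0] at h2
        have hp := pick_lt G h0 (τ.reg 18 % 3)
        set x := pick n (τ.reg 18 % 3) (firstViolation G S' - 1) with hx
        have key : ∃ ρ' : State, (ite (v 16)
            (set 16 (v 16 - c 1) ;;
              ite (v 18 % c 3) (ite (v 18 % c 3 - c 1) (set 21 (v 16 % v 0))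
                (set 21 (v 16 / v 0 % v 0))) (set 21 (v 16 / (v 0 * v 0))) ;;
              set 18 (v 18 / c 3) ;; store (cell (v 0 + c 1) (v 21)) (c 1)) skip).den ρ =
            ρ'.setMem (n * (n + 1) + x) 1 ∧ ρ'.mem = τ.mem ∧ ρ'.reg 18 = τ.reg 18 / 3 := by
          rw [den_ite, eval_v, h16, if_pos h0]
          have hd : τ.reg 18 % 3 < 3 := Nat.mod_lt _ (by norm_num)
          refine ⟨((ρ.setReg 16 (firstViolation G S' - 1)).setReg 21 x).setReg 18 (τ.reg 18 / 3),
            ?_, hmem, by simp⟩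
          rw [hx, pick]
          by_cases d0 : τ.reg 18 % 3 = 0
          · simp [r18, r0, h16, d0]
          · by_cases d1 : τ.reg 18 % 3 = 1
            · simp [r18, r0, h16, d1]
            · have d2 : τ.reg 18 % 3 = 2 := by omega
              simp [r18, r0, h16, d2]
        obtain ⟨ρ', e1, e2, e3⟩ := key
        rw [e1]
        refine ⟨insert x S', fun a ha => ?_, ?_, ?_⟩
        · rw [State.setMem_mem, indN_insert]
          simp only [cell_eq_iff ha hp, true_and]
          rw [e2, h1 a ha]
        · rw [State.setMem_reg, e3]; exact h2
        · exact (h3.trans (Low.of_mem_eq e2)).setMem (by omega) _)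
  obtain ⟨S', h1, h2, h3⟩ := this
  rw [branch] at h2
  rw [← h2]
  exact ⟨h1, h3⟩

theorem cardProg_spec (h : Env G K B σ) {S : Finset ℕ} (hS : Row n (n + 1) (indN S) σ) :
    (cardProg.den σ).reg 21 = #{a ∈ range n | a ∈ S} := by
  have hM := h.lt_modulus
  have hle : ∑ u ∈ range n, indN S u ≤ n :=
    (sum_le_card_nsmul _ _ 1 fun u _ => by unfold indN; split_ifs <;> simp).trans (by simp)
  have := den_for (x := 19) (e := v 0) (σ := σ.setReg 21 0) (N := n)
    (s := set 21 ((v 21 + ld (cell (v 0 + c 1) (v 19))) % v 4))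
    (fun i τ => τ.reg 21 + ∑ u ∈ range i, indN S u = ∑ u ∈ range n, indN S u)
    (by simp [h.reg0]) (by simp) (by
      intro i hi τ hr hm hI
      have h0 : τ.reg 0 = n := (hr 0 rfl).trans (by simp [h.reg0])
      have h4 : τ.reg 4 = 2 ^ B := (hr 4 rfl).trans (by simp [h.reg4])
      have hadj : τ.mem (n * (n + 1) + i) = indN S i := by rw [hm rfl]; exact hS i hi
      rw [sum_range_succ] at hI
      have : τ.reg 21 + indN S i < 2 ^ B := by omega
      simp [h0, h4, hadj, Nat.mod_eq_of_lt this]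
      omega)
  have h2 : ∑ u ∈ range n, indN S u = #{a ∈ range n | a ∈ S} := by
    simp only [indN, sum_boole, Nat.cast_id]
  rw [← h2]
  simpa [cardProg] using this

end MinConnectedCore

namespace MinConnectedCore

open RAM RAM.Ex RAM.St Finset

variable {n : ℕ} {G : SimpleGraph (Fin n)} {K B : ℕ} {σ τ : State}

/-! ### The forbidden vertices -/

/-- The weight that selects the sets without forbidden vertices. -/
def avoid (R : Type*) [CommSemiring R] (e : ℕ → ℕ) (A : Finset (Fin n)) : R :=
  if ∀ a ∈ A, e a = 0 then 1 else 0

theorem avoid_union (R : Type*) [CommSemiring R] (e : ℕ → ℕ) (A A' : Finset (Fin n)) :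
    avoid R e (A ∪ A') = avoid R e A * avoid R e A' := by
  unfold avoid
  by_cases h : ∀ a ∈ A, e a = 0
  · by_cases h' : ∀ a ∈ A', e a = 0
    · rw [if_pos h, if_pos h', if_pos, one_mul]
      intro a ha
      rcases mem_union.1 ha with ha | ha
      exacts [h a ha, h' a ha]
    · rw [if_neg h', if_neg, mul_zero]
      exact fun h'' => h' fun a ha => h'' a (mem_union_right _ ha)
  · rw [if_neg h, if_neg, zero_mul]
    exact fun h'' => h fun a ha => h'' a (mem_union_left _ ha)

theorem neg_one_pow_mod_two (a : ℕ) : (-1 : ℤ) ^ (a % 2) = (-1) ^ a :=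
  (neg_one_pow_eq_pow_mod_two a).symm

/-- The weight that selects the sets without forbidden vertices in the interval from `i` to `N`. -/
def avoidFrom (N i : ℕ) (A : Finset ℕ) (f : ℕ → ℕ) : ℤ :=
  if ∀ a < N, i ≤ a → a ∈ A → f a = 0 then 1 else 0

theorem avoidFrom_step {N i b : ℕ} {A : Finset ℕ} {f f' : ℕ → ℕ} (hi : i < N) (hfi : f' i = b)
    (hf : ∀ a < N, i + 1 ≤ a → f' a = f a) :
    avoidFrom N i A f' = (if i ∈ A → b = 0 then 1 else 0) * avoidFrom N (i + 1) A f := by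
  have : (∀ a < N, i ≤ a → a ∈ A → f' a = 0) ↔
      (i ∈ A → b = 0) ∧ ∀ a < N, i + 1 ≤ a → a ∈ A → f a = 0 := by
    constructor
    · intro h
      refine ⟨fun hA => hfi ▸ h i hi le_rfl hA, fun a ha hia hA => ?_⟩
      rw [← hf a ha hia]
      exact h a ha (by omega) hA
    · rintro ⟨h1, h2⟩ a ha hia hA
      rcases hia.lt_or_eq with hia | rfl
      · rw [hf a ha hia]; exact h2 a ha hia hA
      · rw [hfi]; exact h1 hA
  unfold avoidFrom
  rw [if_congr this rfl rfl, ite_and]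
  split_ifs <;> rfl

/-- Loops run downwards, so the bits of `w` are consumed in the order in which `signedTerm` reads
them. Variable `25` keeps the parity of the number of forbidden vertices, hence the sign, and
`avoid` discards the sets that contain a forbidden vertex. -/
theorem forbidProg_spec (h : Env G K B σ) {S : Finset ℕ} (hS : Row n (n + 1) (indN S) σ) {w : ℕ}
    (hw : σ.reg 23 = w) : ∃ e : ℕ → ℕ, Row n (n + 2) e (forbidProg.den σ) ∧
      (∀ a < n, e a ≤ 1) ∧ Low (n * (n + 2)) σ (forbidProg.den σ) ∧
      (forbidProg.den σ).reg 25 ≤ 1 ∧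
      ∀ A : Finset (Fin n), (-1) ^ (forbidProg.den σ).reg 25 * avoid ℤ e A =
        signedTerm S (toNat A) n w := by
  have hB2 : 2 ≤ 2 ^ B := Nat.le_self_pow (by have := h.one_le; omega) 2
  have := den_for (x := 19) (e := v 0) (σ := (σ.setReg 24 w).setReg 25 0) (N := n)
    (s := ite (ld (cell (v 0 + c 1) (v 19)))
      (store (cell (v 0 + c 2) (v 19)) (v 24 % c 2) ;; set 25 ((v 25 + v 24) % c 2 % v 4) ;;
        set 24 (v 24 / c 2))
      (store (cell (v 0 + c 2) (v 19)) (c 0)))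
    (fun i τ => Low (n * (n + 2)) σ τ ∧ τ.reg 25 ≤ 1 ∧ (∀ a < n, i ≤ a → τ.mem (n * (n + 2) + a) ≤ 1) ∧
      ∀ A : Finset ℕ, (-1 : ℤ) ^ τ.reg 25 *
        avoidFrom n i A (fun a => τ.mem (n * (n + 2) + a)) *
        signedTerm S A i (τ.reg 24) = signedTerm S A n w)
    (by simp [h.reg0]) ⟨Low.of_mem_eq rfl, by simp, fun a ha ha' => by omega, fun A => by
      rw [avoidFrom, if_pos fun a ha ha' => absurd ha (by omega)]; simp⟩ (by
      rintro i hi τ hr - ⟨h1, h25, h2, h3⟩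
      have h0 : τ.reg 0 = n := (hr 0 rfl).trans (by simp [h.reg0])
      have h4 : τ.reg 4 = 2 ^ B := (hr 4 rfl).trans (by simp [h.reg4])
      have hSi : τ.mem (n * (n + 1) + i) = indN S i :=
        (hS.low h1 le_rfl) i hi
      have hcell : ∀ (b : ℕ), ∀ a < n,
          ((τ.setReg 19 i).setMem (n * (n + 2) + i) b).mem (n * (n + 2) + a) =
            if a = i then b else τ.mem (n * (n + 2) + a) := by
        intro b a ha
        rw [State.setMem_mem, State.setReg_mem]
        simp only [cell_eq_iff ha hi, true_and]
      by_cases hiS : i ∈ S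
      · have hind : indN S i = 1 := if_pos hiS
        have hmod : (τ.reg 25 + τ.reg 24) % 2 % 2 ^ B = (τ.reg 25 + τ.reg 24) % 2 :=
          Nat.mod_eq_of_lt (by omega)
        have hden : (ite (ld (cell (v 0 + c 1) (v 19)))
            (store (cell (v 0 + c 2) (v 19)) (v 24 % c 2) ;; set 25 ((v 25 + v 24) % c 2 % v 4) ;;
              set 24 (v 24 / c 2))
            (store (cell (v 0 + c 2) (v 19)) (c 0))).den (τ.setReg 19 i) =
            ((((τ.setReg 19 i).setMem (n * (n + 2) + i) (τ.reg 24 % 2)).setReg 25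
              ((τ.reg 25 + τ.reg 24) % 2)).setReg 24 (τ.reg 24 / 2)) := by
          simp [h0, h4, hSi, hind, hmod]
        rw [hden]
        refine ⟨(h1.trans (Low.of_mem_eq rfl)).setMem (Nat.le_add_right _ _) _, ?_, ?_, fun A => ?_⟩
        · simp only [State.setReg_reg]; norm_num; omega
        · intro a ha hia
          change ((τ.setReg 19 i).setMem _ _).mem _ ≤ 1
          rw [hcell _ a ha]
          split_ifs with hai
          · omega
          · exact h2 a ha (by omega)
        · rw [← h3 A, signedTerm, if_pos hiS]
          simp only [State.setReg_mem]
          rw [avoidFrom_step (b := τ.reg 24 % 2) (f := fun a => τ.mem (n * (n + 2) + a)) hi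
            ((hcell _ i hi).trans (if_pos rfl)) (fun a ha hia =>
              (hcell _ a ha).trans (if_neg (by omega)))]
          simp only [State.setReg_reg, State.setMem_reg]
          norm_num
          -- The program adds the whole number in variable `24` to the parity; only its lowest bit
          -- matters.
          rw [neg_one_pow_mod_two, pow_add]
          rcases Nat.mod_two_eq_zero_or_one (τ.reg 24) with hq | hq
          · rw [(Nat.even_iff.2 hq).neg_one_pow, hq]
            simp
          · rw [(Nat.odd_iff.2 hq).neg_one_pow, hq]
            by_cases hA : i ∈ A <;> simp [hA]
      · have hind : indN S i = 0 := if_neg hiS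
        have hden : (ite (ld (cell (v 0 + c 1) (v 19)))
            (store (cell (v 0 + c 2) (v 19)) (v 24 % c 2) ;; set 25 ((v 25 + v 24) % c 2 % v 4) ;;
              set 24 (v 24 / c 2))
            (store (cell (v 0 + c 2) (v 19)) (c 0))).den (τ.setReg 19 i) =
            (τ.setReg 19 i).setMem (n * (n + 2) + i) 0 := by
          simp [h0, hSi, hind]
        rw [hden]
        refine ⟨(h1.trans (Low.of_mem_eq rfl)).setMem (Nat.le_add_right _ _) _, by simpa using h25, ?_,
          fun A => ?_⟩
        · intro a ha hia
          rw [hcell _ a ha]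
          split_ifs with hai
          · omega
          · exact h2 a ha (by omega)
        · rw [← h3 A, signedTerm, if_neg hiS]
          rw [avoidFrom_step (b := 0) (f := fun a => τ.mem (n * (n + 2) + a)) hi
            ((hcell _ i hi).trans (if_pos rfl)) (fun a ha hia =>
              (hcell _ a ha).trans (if_neg (by omega)))]
          simp)
  have hprog : forbidProg.den σ = (for_ 19 (v 0) (ite (ld (cell (v 0 + c 1) (v 19)))
      (store (cell (v 0 + c 2) (v 19)) (v 24 % c 2) ;; set 25 ((v 25 + v 24) % c 2 % v 4) ;;
        set 24 (v 24 / c 2))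
      (store (cell (v 0 + c 2) (v 19)) (c 0)))).den ((σ.setReg 24 w).setReg 25 0) := by
    simp only [forbidProg, den_seq, den_set, eval_v, eval_c, hw]
  rw [← hprog] at this
  obtain ⟨h1, h25, h2, h3⟩ := this
  refine ⟨fun a => (forbidProg.den σ).mem (n * (n + 2) + a), fun a _ => rfl,
    fun a ha => h2 a ha (Nat.zero_le _), h1, h25, fun A => ?_⟩
  rw [← h3 (toNat A), signedTerm, mul_one, avoid, avoidFrom]
  congr 1
  refine if_congr ⟨fun h a ha _ hA => ?_, fun h a hA => h a a.2 (Nat.zero_le _) (mem_toNat.2 hA)⟩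
    rfl rfl
  exact h ⟨a, ha⟩ (mem_toNat.1 hA)

/-! ### The number of branching walks -/

variable (G) in
/-- The number of branching walks that avoid the forbidden vertices. -/
noncomputable def walkCount (R : Type*) [CommSemiring R] (e : ℕ → ℕ) (i a : ℕ) : R :=
  if h : a < n then G.branchingWeight (avoid R e) i ⟨a, h⟩ else 0

/-- This form merges base case and recursion: the truncated difference `1 - e a - i` is one only if
`i = 0` and `a` is allowed, and the sum is empty for `i = 0`. -/
theorem walkCount_eq (R : Type*) [CommSemiring R] {e : ℕ → ℕ} (he : ∀ a < n, e a ≤ 1) (i : ℕ)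
    {a : ℕ} (ha : a < n) : walkCount G R e i a = ((1 - e a - i : ℕ) : R) +
      ∑ p ∈ range i, ∑ u ∈ range n, (adjN G a u : R) *
        (walkCount G R e p a * walkCount G R e (i - 1 - p) u) := by
  classical
  cases i with
  | zero =>
    rw [walkCount, dif_pos ha, SimpleGraph.branchingWeight_zero, avoid]
    have := he a ha
    by_cases h0 : e a = 0
    · simp [h0]
    · have h1 : e a = 1 := by omega
      simp [h1]
  | succ i =>
    rw [walkCount, dif_pos ha,
      SimpleGraph.branchingWeight_succ fun A A' => by convert avoid_union R e A A']
    rw [show 1 - e a - (i + 1) = 0 by omega, Nat.cast_zero, zero_add]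
    refine sum_congr rfl fun p _ => ?_
    rw [sum_range]
    refine sum_congr rfl fun u _ => ?_
    have := adjN_val G ⟨a, ha⟩ u
    simp only at this
    rw [this, Nat.add_sub_cancel, walkCount, dif_pos ha, walkCount, dif_pos u.2]
    split_ifs <;> simp

/-- Table entries are specified in `ZMod (2 ^ B)` only, where the reductions made by the program
disappear and the recurrence holds exactly. -/
theorem splitProg_spec (h : Env G K B σ) {a i p : ℕ} (ha : a < n) (hp : p < i)
    (h19 : σ.reg 19 = a) (h27 : σ.reg 27 = i) (h28 : σ.reg 28 = p) {t : ℕ → ℕ → ZMod (2 ^ B)}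
    (ht : ∀ j < i, ∀ b < n, (σ.mem (n * (n + 3 + j) + b) : ZMod (2 ^ B)) = t j b) :
    ((splitProg.den σ).reg 29 : ZMod (2 ^ B)) = σ.reg 29 +
      ∑ u ∈ range n, (adjN G a u : ZMod (2 ^ B)) * (t p a * t (i - 1 - p) u) := by
  have := den_for (x := 15) (e := v 0) (σ := σ) (N := n)
    (s := set 29 ((v 29 + ld (cell (v 19 + c 1) (v 15)) *
    (ld (cell (v 0 + c 3 + v 28) (v 19)) * ld (cell (v 0 + c 3 + (v 27 - c 1 - v 28)) (v 15)))) %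
      v 4))
    (fun x τ => (τ.reg 29 : ZMod (2 ^ B)) +
      ∑ u ∈ range x, (adjN G a u : ZMod (2 ^ B)) * (t p a * t (i - 1 - p) u) = σ.reg 29 +
      ∑ u ∈ range n, (adjN G a u : ZMod (2 ^ B)) * (t p a * t (i - 1 - p) u))
    (by simp [h.reg0]) (by simp) (by
      intro x hx τ hr hm hI
      have r0 : τ.reg 0 = n := (hr 0 rfl).trans h.reg0
      have r4 : τ.reg 4 = 2 ^ B := (hr 4 rfl).trans h.reg4
      have r19 : τ.reg 19 = a := (hr 19 rfl).trans h19
      have r27 : τ.reg 27 = i := (hr 27 rfl).trans h27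
      have r28 : τ.reg 28 = p := (hr 28 rfl).trans h28
      have e1 : τ.mem (n * (a + 1) + x) = adjN G a x := by rw [hm rfl]; exact h.adj a ha x hx
      have e2 : (τ.mem (n * (n + 3 + p) + a) : ZMod (2 ^ B)) = t p a := by
        rw [hm rfl]; exact ht p hp a ha
      have e3 : (τ.mem (n * (n + 3 + (i - 1 - p)) + x) : ZMod (2 ^ B)) = t (i - 1 - p) x := by
        rw [hm rfl]; exact ht _ (by omega) x hx
      rw [sum_range_succ] at hI
      simp only [den_set, eval_mod, eval_add, eval_mul, eval_ld, eval_cell, eval_sub, eval_v, eval_c,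
        State.setReg_reg, State.setReg_mem]
      norm_num [r0, r4, r19, r27, r28, e1]
      rw [e2, e3, ← hI]
      have hc : ((2 : ZMod (2 ^ B)) ^ B) = 0 := by
        have := ZMod.natCast_self (2 ^ B)
        push_cast at this
        exact this
      ring)
  simpa [splitProg] using this

/-- The loop bound is written as a difference that starts from variable `3`, though it equals the
value `i` of variable `27`: the cost check accepts only bounds dominated by an unwritten variable.
This is why `h26` accompanies `h27`. -/
theorem walkProg_spec (h : Env G K B σ) {e : ℕ → ℕ} (he : Row n (n + 2) e σ)
    (he1 : ∀ a < n, e a ≤ 1) {a i : ℕ} (ha : a < n)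
    (h19 : σ.reg 19 = a) (h27 : σ.reg 27 = i) (h26 : K - 1 - σ.reg 26 = i)
    (ht : ∀ j < i, ∀ b < n, (σ.mem (n * (n + 3 + j) + b) : ZMod (2 ^ B)) =
      walkCount G (ZMod (2 ^ B)) e j b) :
    ((walkProg.den σ).reg 29 : ZMod (2 ^ B)) = walkCount G (ZMod (2 ^ B)) e i a := by
  rw [walkCount_eq _ he1 i ha]
  set f : ℕ → ZMod (2 ^ B) := fun p => ∑ u ∈ range n, (adjN G a u : ZMod (2 ^ B)) *
    (walkCount G (ZMod (2 ^ B)) e p a * walkCount G (ZMod (2 ^ B)) e (i - 1 - p) u) with hf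
  have := den_for (x := 28) (e := v 3 - c 1 - v 26) (σ := σ.setReg 29 (1 - e a - i)) (N := i)
    (s := splitProg)
    (fun x τ => (τ.reg 29 : ZMod (2 ^ B)) + ∑ p ∈ range x, f p =
      ((1 - e a - i : ℕ) : ZMod (2 ^ B)) + ∑ p ∈ range i, f p)
    (by simp [h.reg3, h26]) (by simp) (by
      intro x hx τ hr hm hI
      have hE : Env G K B (τ.setReg 28 x) := ((h.setReg 29 _ (by decide)).frame (by decide) hr
        (Low.of_mem_eq (hm rfl))).setReg 28 _ (by decide)
      have r19 : (τ.setReg 28 x).reg 19 = a := by simp [hr 19 rfl, h19]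
      have r27 : (τ.setReg 28 x).reg 27 = i := by simp [hr 27 rfl, h27]
      rw [splitProg_spec hE ha hx r19 r27 (by simp) (t := walkCount G (ZMod (2 ^ B)) e)
        (fun j hj b hb => by
          rw [State.setReg_mem, hm rfl]; exact ht j hj b hb)]
      rw [sum_range_succ] at hI
      rw [← hI]
      simp only [State.setReg_reg, hf]
      norm_num
      ring)
  have hprog : walkProg.den σ = (for_ 28 (v 3 - c 1 - v 26) splitProg).den
      (σ.setReg 29 (1 - e a - i)) := by
    simp [walkProg, h.reg0, h19, h27, he a ha]
  rw [hprog]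
  simpa using this

theorem rowProg_spec (h : Env G K B σ) {e : ℕ → ℕ} (he : Row n (n + 2) e σ)
    (he1 : ∀ a < n, e a ≤ 1) {i : ℕ} (h27 : σ.reg 27 = i) (h26 : K - 1 - σ.reg 26 = i)
    (ht : ∀ j < i, ∀ b < n, (σ.mem (n * (n + 3 + j) + b) : ZMod (2 ^ B)) =
      walkCount G (ZMod (2 ^ B)) e j b) :
    (∀ b < n, ((rowProg.den σ).mem (n * (n + 3 + i) + b) : ZMod (2 ^ B)) =
      walkCount G (ZMod (2 ^ B)) e i b) ∧ Low (n * (n + 3 + i)) σ (rowProg.den σ) := by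
  have := den_for (x := 19) (e := v 0) (σ := σ) (N := n)
    (s := walkProg ;; store (cell (v 0 + c 3 + v 27) (v 19)) (v 29))
    (fun x τ => (∀ b < n, x ≤ b → (τ.mem (n * (n + 3 + i) + b) : ZMod (2 ^ B)) =
      walkCount G (ZMod (2 ^ B)) e i b) ∧ Low (n * (n + 3 + i)) σ τ)
    (by simp [h.reg0]) ⟨fun b hb hb' => by omega, Low.of_mem_eq rfl⟩ (by
      rintro x hx τ hr - ⟨h1, h2⟩
      have hl1 : n * (n + 1) ≤ n * (n + 3 + i) := Nat.mul_le_mul_left _ (by omega)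
      have hl2 : n * (n + 2 + 1) ≤ n * (n + 3 + i) := Nat.mul_le_mul_left _ (by omega)
      have hE : Env G K B (τ.setReg 19 x) :=
        (h.frame (by decide) hr (h2.mono hl1)).setReg 19 _ (by decide)
      have he' : Row n (n + 2) e (τ.setReg 19 x) := (he.low h2 hl2).of_mem_eq rfl
      have h29 := walkProg_spec hE he' he1 hx (by simp)
        (show (τ.setReg 19 x).reg 27 = i by simp [hr 27 rfl, h27])
        (by simp [hr 26 rfl, h26]) (fun j hj b hb => by
          rw [State.setReg_mem, h2 _ ?_]
          · exact ht j hj b hb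
          · calc n * (n + 3 + j) + b < n * (n + 3 + j) + n := by omega
              _ = n * (n + 3 + j + 1) := by ring
              _ ≤ _ := Nat.mul_le_mul_left _ (by omega))
      set ρ := walkProg.den (τ.setReg 19 x) with hρ
      have hmem : ρ.mem = τ.mem := (den_mem walkProg rfl _).trans rfl
      have hreg : ∀ r, walkProg.wr r = false → ρ.reg r = (τ.setReg 19 x).reg r :=
        fun r hr => den_reg walkProg hr _
      have r0 : ρ.reg 0 = n := (hreg 0 rfl).trans hE.reg0
      have r19 : ρ.reg 19 = x := (hreg 19 rfl).trans (by simp)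
      have r27 : ρ.reg 27 = i := (hreg 27 rfl).trans (by simp [hr 27 rfl, h27])
      have hden : (walkProg ;; store (cell (v 0 + c 3 + v 27) (v 19)) (v 29)).den
          (τ.setReg 19 x) = ρ.setMem (n * (n + 3 + i) + x) (ρ.reg 29) := by
        simp [← hρ, r0, r19, r27]
      rw [hden]
      refine ⟨fun b hb hxb => ?_, (h2.trans (Low.of_mem_eq hmem)).setMem (Nat.le_add_right _ _) _⟩
      rw [State.setMem_mem]
      simp only [cell_eq_iff hb hx, true_and]
      split_ifs with hbx
      · rw [h29, hbx]
      · rw [hmem]; exact h1 b hb (by omega))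
  exact ⟨fun b hb => this.1 b hb (Nat.zero_le _), this.2⟩

/-- Since loops run downwards, the length is `K - 1 - y`; so the rows are filled in increasing
order, and each finds the shorter lengths ready. -/
theorem tableProg_spec (h : Env G K B σ) {e : ℕ → ℕ} (he : Row n (n + 2) e σ)
    (he1 : ∀ a < n, e a ≤ 1) :
    (∀ i < K, ∀ b < n, ((tableProg.den σ).mem (n * (n + 3 + i) + b) : ZMod (2 ^ B)) =
      walkCount G (ZMod (2 ^ B)) e i b) ∧ Low (n * (n + 3)) σ (tableProg.den σ) := by
  have := den_for (x := 26) (e := v 3) (σ := σ) (N := K)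
    (s := set 27 (v 3 - c 1 - v 26) ;; rowProg)
    (fun y τ => (∀ i < K - y, ∀ b < n, (τ.mem (n * (n + 3 + i) + b) : ZMod (2 ^ B)) =
      walkCount G (ZMod (2 ^ B)) e i b) ∧ Low (n * (n + 3)) σ τ)
    (by simp [h.reg3]) ⟨fun i hi => by omega, Low.of_mem_eq rfl⟩ (by
      rintro y hy τ hr - ⟨h1, h2⟩
      have hl1 : n * (n + 1) ≤ n * (n + 3) := Nat.mul_le_mul_left _ (by omega)
      have hE : Env G K B τ := h.frame (by decide) hr (h2.mono hl1)
      set ρ := (τ.setReg 26 y).setReg 27 (K - 1 - y) with hρ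
      have hEρ : Env G K B ρ := (hE.setReg 26 _ (by decide)).setReg 27 _ (by decide)
      obtain ⟨h3, h4⟩ := rowProg_spec hEρ ((he.low h2 le_rfl).of_mem_eq rfl) he1
        (i := K - 1 - y) (by simp [hρ]) (by simp [hρ])
        (fun j hj b hb => h1 j (by omega) b hb)
      have hden : (set 27 (v 3 - c 1 - v 26) ;; rowProg).den (τ.setReg 26 y) = rowProg.den ρ := by
        simp [hρ, hE.reg3]
      rw [hden]
      refine ⟨fun i hi b hb => ?_, fun a ha => ?_⟩
      · rcases Nat.lt_or_ge i (K - 1 - y) with hlt | hge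
        · rw [h4 _ ?_]
          · exact h1 i (by omega) b hb
          · calc n * (n + 3 + i) + b < n * (n + 3 + i) + n := by omega
              _ = n * (n + 3 + i + 1) := by ring
              _ ≤ _ := Nat.mul_le_mul_left _ (by omega)
        · obtain rfl : i = K - 1 - y := by omega
          exact h3 b hb
      · rw [h4 a (ha.trans_le (Nat.mul_le_mul_left _ (by omega)))]
        exact h2 a ha)
  exact ⟨fun i hi => this.1 i (by omega), this.2⟩

theorem totalProg_spec (h : Env G K B σ) {i : ℕ} (h2 : σ.reg 2 = i) {t : ℕ → ZMod (2 ^ B)}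
    (ht : ∀ b < n, (σ.mem (n * (n + 3 + i) + b) : ZMod (2 ^ B)) = t b) :
    ((totalProg.den σ).reg 29 : ZMod (2 ^ B)) = ∑ b ∈ range n, t b ∧
      (totalProg.den σ).reg 29 < 2 ^ B := by
  have := den_for (x := 19) (e := v 0) (σ := σ.setReg 29 0) (N := n)
    (s := set 29 ((v 29 + ld (cell (v 0 + c 3 + v 2) (v 19))) % v 4))
    (fun x τ => (τ.reg 29 : ZMod (2 ^ B)) + ∑ b ∈ range x, t b = ∑ b ∈ range n, t b ∧
      τ.reg 29 < 2 ^ B)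
    (by simp [h.reg0]) (by simp) (by
      rintro x hx τ hr hm ⟨hI, -⟩
      have r0 : τ.reg 0 = n := (hr 0 rfl).trans (by simp [h.reg0])
      have r4 : τ.reg 4 = 2 ^ B := (hr 4 rfl).trans (by simp [h.reg4])
      have r2 : τ.reg 2 = i := (hr 2 rfl).trans (by simp [h2])
      have e1 : (τ.mem (n * (n + 3 + i) + x) : ZMod (2 ^ B)) = t x := by
        rw [hm rfl]; exact ht x hx
      have hden : (set 29 ((v 29 + ld (cell (v 0 + c 3 + v 2) (v 19))) % v 4)).den
          (τ.setReg 19 x) = (τ.setReg 19 x).setReg 29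
            ((τ.reg 29 + τ.mem (n * (n + 3 + i) + x)) % 2 ^ B) := by
        simp [r0, r4, r2]
      rw [hden]
      rw [sum_range_succ] at hI
      simp only [State.setReg_reg, if_true]
      refine ⟨?_, Nat.mod_lt _ (by positivity)⟩
      rw [ZMod.natCast_mod, Nat.cast_add, e1, ← hI]
      ring)
  simpa [totalProg] using this

end MinConnectedCore

namespace MinConnectedCore

open RAM RAM.Ex RAM.St Finset

variable {n : ℕ} {G : SimpleGraph (Fin n)} {K B : ℕ} {σ τ : State}

/-! ### The signed sum -/

variable (G) in
/-- The signed number of branching walks with `i` edges, for the forbidden vertices given by `w`. -/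
noncomputable def signedCount (S : Finset ℕ) (i w : ℕ) : ℤ :=
  ∑ a : Fin n, ∑ A, (G.branchingWalks i a A : ℤ) * signedTerm S (toNat A) n w

open Classical in
variable (G) in
/-- The number of branching walks with `i` edges that visit all vertices of `S`. -/
noncomputable def coverCount (S : Finset ℕ) (i : ℕ) : ℕ :=
  ∑ a : Fin n, G.branchingWeight (fun A => if S ⊆ toNat A then 1 else 0) i a

theorem coverCount_le (S : Finset ℕ) (i : ℕ) : coverCount G S i ≤ n * (4 ^ i * n ^ i) := by
  classical
  calc coverCount G S i ≤ ∑ _a : Fin n, 4 ^ i * n ^ i := by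
        refine sum_le_sum fun a _ => ?_
        have h1 := SimpleGraph.branchingWeight_one_le (G := G) i a
        rw [Fintype.card_fin] at h1
        refine le_trans (sum_le_sum fun A _ => Nat.mul_le_mul_left _ ?_) h1
        dsimp only
        split_ifs <;> simp
    _ = _ := by simp

theorem coverCount_pos {S : Finset ℕ} {i : ℕ} : 0 < coverCount G S i ↔
    ∃ (a : Fin n) (A : Finset (Fin n)), S ⊆ toNat A ∧ 0 < G.branchingWalks i a A := by
  classical
  simp only [coverCount, SimpleGraph.branchingWeight, sum_pos_iff, mem_univ, true_and, Nat.cast_id]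
  refine exists_congr fun a => exists_congr fun A => ?_
  split_ifs with h <;> simp [h]

/-- After exchanging the sums, inclusion and exclusion applies to each start vertex and vertex set
`A` separately and keeps those with `S ⊆ A`. -/
theorem sum_signedCount {S : Finset ℕ} (hS : ∀ a ∈ S, a < n) (hK : S.card ≤ K) (i : ℕ) :
    ∑ w ∈ range (2 ^ K), signedCount G S i w = (2 ^ (K - S.card) * coverCount G S i : ℕ) := by
  classical
  have hf : {a ∈ range n | a ∈ S} = S := by
    ext a
    simp only [mem_filter, mem_range]
    exact ⟨fun h => h.2, fun h => ⟨hS a h, h⟩⟩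
  simp only [signedCount, coverCount, SimpleGraph.branchingWeight]
  rw [sum_comm]
  push_cast
  rw [mul_sum]
  refine sum_congr rfl fun a _ => ?_
  rw [sum_comm, mul_sum]
  refine sum_congr rfl fun A _ => ?_
  rw [← mul_sum, sum_signedTerm S (toNat A) n K (by rwa [hf]), hf]
  have : (∀ v < n, v ∈ S → v ∈ toNat A) ↔ S ⊆ toNat A :=
    ⟨fun h v hv => h v (hS v hv) hv, fun h v _ hv => h hv⟩
  rw [if_congr this rfl rfl]
  split_ifs
  · simp; ring
  · simp

theorem summandProg_spec (h : Env G K B σ) {S : Finset ℕ} (hS : Row n (n + 1) (indN S) σ) {w i : ℕ}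
    (hw : σ.reg 23 = w) (h2 : σ.reg 2 = i) (hi : i < K) :
    ((summandProg.den σ).reg 22 : ZMod (2 ^ B)) =
      σ.reg 22 + ((signedCount G S i w : ℤ) : ZMod (2 ^ B)) ∧
      (summandProg.den σ).reg 22 < 2 ^ B ∧ Low (n * (n + 2)) σ (summandProg.den σ) := by
  obtain ⟨e, he, he1, hlow, h25, hsign⟩ := forbidProg_spec h hS hw
  set ρ := forbidProg.den σ with hρ
  have hEρ : Env G K B ρ := h.den (by decide) (hlow.mono (Nat.mul_le_mul_left _ (by omega)))
  obtain ⟨htab, hlow'⟩ := tableProg_spec hEρ he he1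
  set ρ' := tableProg.den ρ with hρ'
  have hEρ' : Env G K B ρ' := hEρ.den (by decide) (hlow'.mono (Nat.mul_le_mul_left _ (by omega)))
  have r2 : ρ'.reg 2 = i := by
    rw [hρ', den_reg tableProg rfl, hρ, den_reg forbidProg rfl, h2]
  obtain ⟨htot, hlt⟩ := totalProg_spec hEρ' r2 (t := walkCount G (ZMod (2 ^ B)) e i)
    (fun b hb => htab i hi b hb)
  set ρ'' := totalProg.den ρ' with hρ''
  have hmem : ρ''.mem = ρ'.mem := den_mem totalProg rfl _
  have r4 : ρ''.reg 4 = 2 ^ B := by rw [hρ'', den_reg totalProg rfl, hEρ'.reg4]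
  have r25 : ρ''.reg 25 = ρ.reg 25 := by
    rw [hρ'', den_reg totalProg rfl, hρ', den_reg tableProg rfl]
  have r22 : ρ''.reg 22 = σ.reg 22 := by
    rw [hρ'', den_reg totalProg rfl, hρ', den_reg tableProg rfl, hρ, den_reg forbidProg rfl]
  have hcount : ((signedCount G S i w : ℤ) : ZMod (2 ^ B)) =
      (-1) ^ ρ.reg 25 * ∑ b ∈ range n, walkCount G (ZMod (2 ^ B)) e i b := by
    rw [sum_range, mul_sum, signedCount]
    push_cast
    refine sum_congr rfl fun a _ => ?_
    rw [walkCount, dif_pos a.2, SimpleGraph.branchingWeight, mul_sum]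
    refine sum_congr rfl fun A _ => ?_
    rw [← hsign A]
    unfold avoid
    push_cast
    ring
  have hden : summandProg.den σ =
      (ite (v 25) (set 22 ((v 22 + (v 4 - v 29)) % v 4)) (set 22 ((v 22 + v 29) % v 4))).den ρ'' := by
    simp only [summandProg, den_seq, hρ, hρ', hρ'']
  have hval : ((summandProg.den σ).reg 22 : ZMod (2 ^ B)) =
      σ.reg 22 + ((signedCount G S i w : ℤ) : ZMod (2 ^ B)) ∧
      (summandProg.den σ).reg 22 < 2 ^ B ∧ (summandProg.den σ).mem = ρ''.mem := by
    have hM : 0 < 2 ^ B := by positivity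
    rw [hden, hcount, ← htot]
    simp only [den_ite, eval_v, r25]
    split_ifs with h0
    · have h1 : ρ.reg 25 = 1 := by omega
      simp only [den_set, eval_mod, eval_add, eval_sub, eval_v, r4, r22, State.setReg_reg, if_true,
        State.setReg_mem, ZMod.natCast_mod, h1, pow_one]
      refine ⟨?_, Nat.mod_lt _ hM, trivial⟩
      -- A negative summand is added as `2 ^ B` minus its absolute residue, as subtraction is
      -- truncated.
      rw [Nat.cast_add, Nat.cast_sub hlt.le, ZMod.natCast_self]
      ring
    · have h1 : ρ.reg 25 = 0 := by omega
      simp only [den_set, eval_mod, eval_add, eval_v, r4, r22, State.setReg_reg, if_true,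
        State.setReg_mem, ZMod.natCast_mod, h1, pow_zero, Nat.cast_add, one_mul]
      exact ⟨trivial, Nat.mod_lt _ hM, trivial⟩
  refine ⟨hval.1, hval.2.1, ?_⟩
  exact (hlow.trans (hlow'.mono (Nat.mul_le_mul_left _ (by omega)))).trans
    (Low.of_mem_eq (hval.2.2.trans hmem))

/-- The computed number is congruent to `2 ^ (K - S.card) * coverCount G S i` modulo `2 ^ B`, and
both are below `2 ^ B`; so they are equal. The power of two does not affect vanishing. -/
theorem sumProg_spec (h : Env G K B σ) {S : Finset ℕ} (hS : Row n (n + 1) (indN S) σ)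
    (hSn : ∀ a ∈ S, a < n) (hSK : S.card ≤ K) {i : ℕ} (h2 : σ.reg 2 = i) (hi : i < K) :
    ((sumProg.den σ).reg 22 ≠ 0 ↔ 0 < coverCount G S i) ∧
      Low (n * (n + 2)) σ (sumProg.den σ) := by
  have := den_for (x := 23) (e := v 6) (σ := σ.setReg 22 0) (N := 2 ^ K) (s := summandProg)
    (fun w τ => (τ.reg 22 : ZMod (2 ^ B)) + ((∑ w ∈ range w, signedCount G S i w : ℤ) : ZMod _) =
      ((∑ w ∈ range (2 ^ K), signedCount G S i w : ℤ) : ZMod _) ∧ τ.reg 22 < 2 ^ B ∧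
      Low (n * (n + 2)) σ τ)
    (by simp [h.reg6]) ⟨by simp, by simp, Low.of_mem_eq rfl⟩ (by
      rintro w hw τ hr - ⟨h1, -, h3⟩
      have hE : Env G K B (τ.setReg 23 w) := ((h.setReg 22 0 (by decide)).frame (by decide) hr
        (h3.mono (Nat.mul_le_mul_left _ (by omega)))).setReg 23 _ (by decide)
      obtain ⟨h4, h5, h6⟩ := summandProg_spec hE ((hS.low h3 le_rfl).of_mem_eq rfl) (w := w)
        (by simp) (show (τ.setReg 23 w).reg 2 = i by simp [hr 2 rfl, h2]) hi
      refine ⟨?_, h5, (h3.trans (Low.of_mem_eq rfl)).trans h6⟩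
      rw [h4, ← h1, sum_range_succ]
      push_cast
      simp
      ring)
  have hprog : sumProg.den σ = (for_ 23 (v 6) summandProg).den (σ.setReg 22 0) := by
    simp [sumProg]
  rw [← hprog, sum_signedCount hSn hSK] at this
  obtain ⟨h1, h2, h3⟩ := this
  refine ⟨?_, h3⟩
  simp only [range_zero, sum_empty, Int.cast_zero, add_zero, Int.cast_natCast] at h1
  have hlt : 2 ^ (K - S.card) * coverCount G S i < 2 ^ B := by
    refine lt_of_le_of_lt ?_ h.count_lt
    refine Nat.mul_le_mul (Nat.pow_le_pow_right (by norm_num) (Nat.sub_le _ _)) ?_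
    rcases Nat.eq_zero_or_pos n with h0 | h0
    · have := coverCount_le (G := G) S i
      have h0' : n * (4 ^ i * n ^ i) = 0 := by rw [h0, zero_mul]
      omega
    · refine (coverCount_le S i).trans (Nat.mul_le_mul_left _ (Nat.mul_le_mul ?_ ?_))
      · exact Nat.pow_le_pow_right (by norm_num) hi.le
      · exact Nat.pow_le_pow_right h0 hi.le
  have heq : (sumProg.den σ).reg 22 = 2 ^ (K - S.card) * coverCount G S i := by
    have := (ZMod.natCast_eq_natCast_iff _ _ _).1 h1
    rwa [Nat.ModEq, Nat.mod_eq_of_lt h2, Nat.mod_eq_of_lt hlt] at this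
  rw [heq, ← Nat.pos_iff_ne_zero]
  simp

/-! ### The search for a connected core -/

variable (G) in
/-- Branching from `Y` according to `m` leads to a set which hits all obstructions and is covered by
a branching walk with `i` edges. -/
def IsGood (K : ℕ) (Y : Finset ℕ) (i m : ℕ) : Prop :=
  firstViolation G (branch G K Y m) = 0 ∧ (branch G K Y m).card ≤ K ∧
    0 < coverCount G (branch G K Y m) i

/-- The set is copied from row `0` anew for every guiding number, and row `0` survives. The test
expression is zero exactly if no violation is left and the set has at most `K` elements; the size
limit ensures that `2 ^ K` covers all its subsets. -/
theorem testBody_spec (h : Env G K B σ) {Y : Finset ℕ} (hY : Row n 0 (indN Y) σ)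
    (hYn : ∀ a ∈ Y, a < n) {i m : ℕ} (h2 : σ.reg 2 = i) (hi : i < K) (h17 : σ.reg 17 = m) :
    (IsGood G K Y i m → (testBody.den σ).reg 9 = 1) ∧
      (¬ IsGood G K Y i m → (testBody.den σ).reg 9 = σ.reg 9) ∧
      Low (n * (n + 1)) σ (testBody.den σ) := by
  set σ₁ := σ.setReg 18 m with hσ₁
  have hE₁ : Env G K B σ₁ := h.setReg 18 _ (by decide)
  obtain ⟨hrow₂, hlow₂⟩ := copyProg_spec hE₁ (hY.of_mem_eq rfl)
  set σ₂ := copyProg.den σ₁ with hσ₂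
  have hE₂ : Env G K B σ₂ := hE₁.den (by decide) hlow₂
  obtain ⟨hrow₃, hlow₃⟩ := branchProg_spec hE₂ hrow₂ (q := m)
    (by rw [hσ₂, den_reg copyProg rfl]; simp [hσ₁])
  set σ₃ := branchProg.den σ₂ with hσ₃
  have hE₃ : Env G K B σ₃ := hE₂.den (by decide) hlow₃
  have h16 := searchProg_spec hE₃ hrow₃
  set S := branch G K Y m with hS
  have hSn : ∀ a ∈ S, a < n := branch_lt G K Y m hYn
  set σ₄ := searchProg.den σ₃ with hσ₄
  have hm₄ : σ₄.mem = σ₃.mem := den_mem searchProg rfl _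
  have hE₄ : Env G K B σ₄ := hE₃.den (by decide) (Low.of_mem_eq hm₄)
  have hrow₄ : Row n (n + 1) (indN S) σ₄ := hrow₃.of_mem_eq hm₄
  have h21 := cardProg_spec hE₄ hrow₄
  have hf : {a ∈ range n | a ∈ S} = S := by
    ext a
    simp only [mem_filter, mem_range]
    exact ⟨fun h => h.2, fun h => ⟨hSn a h, h⟩⟩
  rw [hf] at h21
  set σ₅ := cardProg.den σ₄ with hσ₅
  have hm₅ : σ₅.mem = σ₄.mem := den_mem cardProg rfl _
  have hE₅ : Env G K B σ₅ := hE₄.den (by decide) (Low.of_mem_eq hm₅)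
  have hrow₅ : Row n (n + 1) (indN S) σ₅ := hrow₄.of_mem_eq hm₅
  have r16 : σ₅.reg 16 = firstViolation G S := by rw [hσ₅, den_reg cardProg rfl, h16]
  have r2 : σ₅.reg 2 = i := by
    rw [hσ₅, den_reg cardProg rfl, hσ₄, den_reg searchProg rfl, hσ₃, den_reg branchProg rfl, hσ₂,
      den_reg copyProg rfl, ← h2]
    simp [hσ₁]
  have r9 : σ₅.reg 9 = σ.reg 9 := by
    rw [hσ₅, den_reg cardProg rfl, hσ₄, den_reg searchProg rfl, hσ₃, den_reg branchProg rfl, hσ₂,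
      den_reg copyProg rfl]
    simp [hσ₁]
  have hlow₅ : Low (n * (n + 1)) σ σ₅ := (((Low.of_mem_eq (σ := σ) (τ := σ₁) rfl).trans hlow₂).trans
    hlow₃).trans (Low.of_mem_eq (hm₅.trans hm₄))
  have hden : testBody.den σ = (ite (v 16 + (v 21 - v 3)) skip
      (sumProg ;; ite (v 22) (set 9 (c 1)) skip)).den σ₅ := by
    simp only [testBody, den_seq, den_set, eval_v, h17, hσ₁, hσ₂, hσ₃, hσ₄, hσ₅]
  rw [hden]
  have htest : (v 16 + (v 21 - v 3)).eval σ₅ = firstViolation G S + (S.card - K) := by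
    simp only [eval_add, eval_sub, eval_v, r16, h21, hE₅.reg3]
  by_cases h0 : firstViolation G S + (S.card - K) = 0
  · rw [den_ite_neg (htest.trans h0), den_seq]
    have hcard : S.card ≤ K := by omega
    have hv : firstViolation G S = 0 := by omega
    obtain ⟨h3, h4⟩ := sumProg_spec hE₅ hrow₅ hSn hcard r2 hi
    have hiff : IsGood G K Y i m ↔ (sumProg.den σ₅).reg 22 ≠ 0 := by
      rw [h3, IsGood, ← hS]
      simp [hcard, hv]
    have hlow : Low (n * (n + 1)) σ (sumProg.den σ₅) :=
      hlow₅.trans (h4.mono (Nat.mul_le_mul_left _ (by omega)))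
    rw [hiff]
    by_cases h5 : (sumProg.den σ₅).reg 22 = 0
    · rw [den_ite_neg (by simpa using h5), den_skip]
      refine ⟨fun h => absurd h5 h, fun _ => ?_, hlow⟩
      rw [den_reg sumProg rfl, r9]
    · rw [den_ite_pos (by simpa using h5)]
      exact ⟨fun _ => by simp, fun h => absurd h5 h, hlow.trans (Low.of_mem_eq rfl)⟩
  · rw [den_ite_pos (by rwa [htest]), den_skip]
    refine ⟨fun h => absurd h.2.1 ?_, fun _ => r9, hlow₅⟩
    have := h.1
    rw [← hS] at this ⊢
    omega

theorem coreProg_spec (h : Env G K B σ) {Y : Finset ℕ} (hY : Row n 0 (indN Y) σ)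
    (hYn : ∀ a ∈ Y, a < n) {i : ℕ} (h2 : σ.reg 2 = i) (hi : i < K) :
    ((∃ m < 3 ^ K, IsGood G K Y i m) → (coreProg.den σ).reg 9 = 1) ∧
      ((¬ ∃ m < 3 ^ K, IsGood G K Y i m) → (coreProg.den σ).reg 9 = 0) ∧
      Low (n * (n + 1)) σ (coreProg.den σ) := by
  have := den_for (x := 17) (e := v 5) (σ := σ.setReg 9 0) (N := 3 ^ K) (s := testBody)
    (fun x τ => ((∃ m < 3 ^ K, x ≤ m ∧ IsGood G K Y i m) → τ.reg 9 = 1) ∧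
      ((¬ ∃ m < 3 ^ K, x ≤ m ∧ IsGood G K Y i m) → τ.reg 9 = 0) ∧ Low (n * (n + 1)) σ τ)
    (by simp [h.reg5])
    ⟨by rintro ⟨m, h1, h2, _⟩; omega, fun _ => by simp, Low.of_mem_eq rfl⟩ (by
      rintro x hx τ hr - ⟨h3, h4, h5⟩
      have hE : Env G K B (τ.setReg 17 x) :=
        ((h.setReg 9 0 (by decide)).frame (by decide) hr h5).setReg 17 _ (by decide)
      have hY' : Row n 0 (indN Y) (τ.setReg 17 x) :=
        (hY.low h5 (Nat.mul_le_mul_left _ (by omega))).of_mem_eq rfl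
      obtain ⟨h6, h7, h8⟩ := testBody_spec hE hY' hYn
        (show (τ.setReg 17 x).reg 2 = i by simp [hr 2 rfl, h2]) hi (m := x) (by simp)
      refine ⟨?_, ?_, (h5.trans (Low.of_mem_eq rfl)).trans h8⟩
      · rintro ⟨m, hm, hxm, hg⟩
        by_cases hgx : IsGood G K Y i x
        · exact h6 hgx
        · rw [h7 hgx]
          have : x ≠ m := by rintro rfl; exact hgx hg
          simpa using h3 ⟨m, hm, by omega, hg⟩
      · intro hne
        have hgx : ¬ IsGood G K Y i x := fun hg => hne ⟨x, hx, le_rfl, hg⟩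
        rw [h7 hgx]
        simpa using h4 fun ⟨m, hm, hxm, hg⟩ => hne ⟨m, hm, by omega, hg⟩)
  have hprog : coreProg.den σ = (for_ 17 (v 5) testBody).den (σ.setReg 9 0) := by
    simp [coreProg]
  rw [← hprog] at this
  simpa using this

/-! ### Correctness of the search -/

/-- The vertex set of the covering branching walk is connected and contains a set that hits all
obstructions. A branching walk may repeat vertices, so only an upper bound on the size results. -/
theorem exists_core_of_isGood (hG : G.Connected) {Y : Finset (Fin n)} {i m : ℕ}
    (h : IsGood G K (toNat Y) i m) : ∃ Z : Finset (Fin n),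
      G.IsConnectedCore (Z : Set (Fin n)) ∧ Y ⊆ Z ∧ Z.card ≤ i + 1 := by
  obtain ⟨h1, -, h2⟩ := h
  obtain ⟨a, A, hA, hpos⟩ := coverCount_pos.1 h2
  obtain ⟨haA, hconn, hcard⟩ := SimpleGraph.of_branchingWalks_pos hpos
  refine ⟨A, ⟨SimpleGraph.isCore_of_hits hG ⟨a, haA⟩ fun x y z hv => ?_, hconn⟩, ?_, hcard⟩
  · rcases hits_of_firstViolation_eq_zero G h1 hv with h | h | h
    · exact .inl (mem_toNat.1 (hA h))
    · exact .inr (.inl (mem_toNat.1 (hA h)))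
    · exact .inr (.inr (mem_toNat.1 (hA h)))
  · intro y hy
    exact mem_toNat.1 (hA (subset_branch G K _ m (mem_toNat.2 hy)))

/-- Branching is guided by `Z`, and a spanning tree of `G[Z]` provides a branching walk with exactly
`i` edges that covers the result. -/
theorem exists_isGood {Y Z : Finset (Fin n)} (hZ : G.IsConnectedCore (Z : Set (Fin n)))
    (hYZ : Y ⊆ Z) {i : ℕ} (hi : Z.card = i + 1) (hiK : i < K) :
    ∃ m < 3 ^ K, IsGood G K (toNat Y) i m := by
  have hsub : toNat Y ⊆ toNat Z := map_subset_map.2 hYZ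
  obtain ⟨m, hm, h1, h2⟩ := exists_branch G (Z := Z) (fun a b c hv => hZ.1.hits hv) K (toNat Y) hsub
    (by omega)
  obtain ⟨z, hz⟩ : Z.Nonempty := card_pos.1 (by omega)
  refine ⟨m, hm, h2, ?_, coverCount_pos.2 ⟨z, Z, h1, SimpleGraph.branchingWalks_pos hZ.2 hz hi⟩⟩
  have := card_le_card h1
  rw [card_toNat] at this
  omega

end MinConnectedCore

namespace MinConnectedCore

open RAM RAM.Ex RAM.St Finset

variable {n : ℕ} {G : SimpleGraph (Fin n)} {K B : ℕ} {σ τ : State}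

/-! ### The main program -/

/-- The modulus `2 ^ (n ^ 2 + 4 n + 1)`. -/
def modulusProg : St :=
  set 20 (v 0 * v 0 + c 4 * v 0 + c 1) ;; set 4 (c 1) ;; for_ 19 (v 20) (set 4 (v 4 + v 4))

/-- The numbers `3 ^ K`, `2 ^ K` and `n ^ 3`. -/
def powerProg : St :=
  set 5 (c 1) ;; set 6 (c 1) ;;
  for_ 21 (v 3) (set 5 ((v 5 * c 3) % v 4) ;; set 6 ((v 6 * c 2) % v 4)) ;;
  set 7 ((v 0 * v 0 * v 0) % v 4)

/-- The minimum size of a connected core. -/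
def sizeProg : St :=
  set 8 (c 0) ;;
  for_ 30 (v 3) (set 2 (v 30) ;; coreProg ;; ite (v 9) (set 8 ((v 30 + c 1) % v 4)) skip)

/-- The extension of the set in row `0` to a connected core with `2` edges in a spanning tree. -/
def extendProg : St :=
  for_ 31 (v 0) (store (v 31) (c 1) ;; coreProg ;; store (v 31) (v 9))

/-- The search for a minimum connected core, with the answer in variable `32`. -/
def answerProg : St :=
  sizeProg ;; ite (v 8) (set 2 (v 8 - c 1) ;; extendProg ;; set 32 (c 1)) (set 32 (c 0))

/-- The whole program. A graph with a single vertex is treated separately. -/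
def mainProg : St :=
  set 3 (v 0 - (v 0 - v 1)) ;; set 1 (c 0) ;;
  ite (v 0 - c 1) (modulusProg ;; powerProg ;; answerProg ;; set 0 (v 32))
    (set 0 (c 1 - (ld (c 0) - v 3)))

variable (G K) in
/-- Some result of branching from `X` is covered by a branching walk with `i` edges. -/
def IsFound (X : Finset (Fin n)) (i : ℕ) : Prop := ∃ m < 3 ^ K, IsGood G K (toNat X) i m

theorem coreProg_spec_found (h : Env G K B σ) {X : Finset (Fin n)}
    (hX : Row n 0 (indN (toNat X)) σ) {i : ℕ} (h2 : σ.reg 2 = i) (hi : i < K) :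
    (IsFound G K X i → (coreProg.den σ).reg 9 = 1) ∧
      (¬ IsFound G K X i → (coreProg.den σ).reg 9 = 0) ∧ Low (n * (n + 1)) σ (coreProg.den σ) :=
  coreProg_spec h hX (fun _ h => lt_of_mem_toNat h) h2 hi

/-- The lengths are tried in decreasing order, so the last success recorded is the least one.
Variable `8` holds the size `i + 1`, which leaves `0` to signal failure. -/
theorem sizeProg_spec (h : Env G K B σ) (hKn : K ≤ n) {X : Finset (Fin n)}
    (hX : Row n 0 (indN (toNat X)) σ) :
    ((sizeProg.den σ).reg 8 = 0 ∧ (∀ j < K, ¬ IsFound G K X j) ∨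
      ∃ i < K, (sizeProg.den σ).reg 8 = i + 1 ∧ IsFound G K X i ∧ ∀ j < i, ¬ IsFound G K X j) ∧
      Low (n * (n + 1)) σ (sizeProg.den σ) := by
  have := den_for (x := 30) (e := v 3) (σ := σ.setReg 8 0) (N := K)
    (s := set 2 (v 30) ;; coreProg ;; ite (v 9) (set 8 ((v 30 + c 1) % v 4)) skip)
    (fun x τ => (τ.reg 8 = 0 ∧ (∀ j < K, x ≤ j → ¬ IsFound G K X j) ∨
      ∃ i < K, x ≤ i ∧ τ.reg 8 = i + 1 ∧ IsFound G K X i ∧ ∀ j < i, x ≤ j → ¬ IsFound G K X j) ∧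
      Low (n * (n + 1)) σ τ)
    (by simp [h.reg3]) ⟨.inl ⟨by simp, fun j hj hj' => by omega⟩, Low.of_mem_eq rfl⟩ (by
      rintro x hx τ hr - ⟨h1, h2⟩
      set ρ := (τ.setReg 30 x).setReg 2 x with hρ
      have hE : Env G K B ρ := (((h.setReg 8 0 (by decide)).frame (by decide) hr h2).setReg 30 _
        (by decide)).setReg 2 _ (by decide)
      have hl : 0 + 1 ≤ n + 1 := by omega
      have hX' : Row n 0 (indN (toNat X)) ρ :=
        (hX.low h2 (Nat.mul_le_mul_left _ hl)).of_mem_eq rfl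
      obtain ⟨h3, h4, h5⟩ := coreProg_spec_found hE hX' (i := x) (by simp [hρ]) hx
      have hlow : Low (n * (n + 1)) σ (coreProg.den ρ) := (h2.trans (Low.of_mem_eq rfl)).trans h5
      have r8 : (coreProg.den ρ).reg 8 = τ.reg 8 := by rw [den_reg coreProg rfl]; simp [hρ]
      have r30 : (coreProg.den ρ).reg 30 = x := by rw [den_reg coreProg rfl]; simp [hρ]
      have r4 : (coreProg.den ρ).reg 4 = 2 ^ B := by rw [den_reg coreProg rfl, hE.reg4]
      have hden : (set 2 (v 30) ;; coreProg ;; ite (v 9) (set 8 ((v 30 + c 1) % v 4)) skip).den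
          (τ.setReg 30 x) = (ite (v 9) (set 8 ((v 30 + c 1) % v 4)) skip).den (coreProg.den ρ) := by
        simp [hρ]
      rw [hden]
      by_cases hf : IsFound G K X x
      · rw [den_ite_pos (by simp [h3 hf])]
        have hlt : x + 1 < 2 ^ B := lt_of_le_of_lt (by omega) h.lt_modulus
        exact ⟨.inr ⟨x, hx, le_rfl, by simp [r30, r4, Nat.mod_eq_of_lt hlt], hf,
          fun j hj hj' => by omega⟩, hlow.trans (Low.of_mem_eq rfl)⟩
      · rw [den_ite_neg (by simp [h4 hf]), den_skip, r8]
        have hne : ∀ j, x ≤ j → (x + 1 ≤ j → ¬ IsFound G K X j) → ¬ IsFound G K X j := by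
          intro j hj hj'
          rcases hj.lt_or_eq with hj | rfl
          exacts [hj' hj, hf]
        refine ⟨?_, hlow⟩
        rcases h1 with ⟨h6, h7⟩ | ⟨i, hi, hxi, h6, h7, h8⟩
        · exact .inl ⟨h6, fun j hj hxj => hne j hxj (h7 j hj)⟩
        · exact .inr ⟨i, hi, by omega, h6, h7, fun j hj hxj => hne j hxj (h8 j hj)⟩)
  have hprog : sizeProg.den σ = (for_ 30 (v 3) (set 2 (v 30) ;; coreProg ;;
      ite (v 9) (set 8 ((v 30 + c 1) % v 4)) skip)).den (σ.setReg 8 0) := by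
    simp [sizeProg]
  rw [← hprog] at this
  simpa using this

/-- Throughout, the current set `Y` extends to a core of the minimum size `i + 1`. A vertex is
rejected only if no such core contains it together with `Y`, and it stays rejected as `Y` grows. In
the end `Y` equals any core of this size that contains it. By `hmin`, the cores of size at most `i +
1` detected by the search have exactly this size. -/
theorem extendProg_spec (hG : G.Connected) (h : Env G K B σ) {X : Finset (Fin n)}
    (hX : Row n 0 (indN (toNat X)) σ) {i : ℕ} (h2 : σ.reg 2 = i) (hi : i < K)
    (hmin : ∀ Z : Finset (Fin n), G.IsConnectedCore (Z : Set (Fin n)) → X ⊆ Z → i + 1 ≤ Z.card)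
    (hex : ∃ Z : Finset (Fin n), G.IsConnectedCore (Z : Set (Fin n)) ∧ X ⊆ Z ∧ Z.card = i + 1) :
    ∃ Z : Finset (Fin n), G.IsConnectedCore (Z : Set (Fin n)) ∧ X ⊆ Z ∧ Z.card = i + 1 ∧
      Row n 0 (indN (toNat Z)) (extendProg.den σ) := by
  have := den_for (x := 31) (e := v 0) (σ := σ) (N := n)
    (s := store (v 31) (c 1) ;; coreProg ;; store (v 31) (v 9))
    (fun x τ => ∃ Y : Finset (Fin n), Row n 0 (indN (toNat Y)) τ ∧ X ⊆ Y ∧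
      (∃ Z : Finset (Fin n), G.IsConnectedCore (Z : Set (Fin n)) ∧ Y ⊆ Z ∧ Z.card = i + 1) ∧
      (∀ u : Fin n, x ≤ u → u ∉ Y → ¬ ∃ Z : Finset (Fin n), G.IsConnectedCore (Z : Set (Fin n)) ∧
        insert u Y ⊆ Z ∧ Z.card = i + 1) ∧ ∀ a, n ≤ a → a < n * (n + 1) → τ.mem a = σ.mem a)
    (by simp [h.reg0]) ⟨X, hX.of_mem_eq rfl, Subset.rfl, hex, fun u hu => by have := u.2; omega,
      fun a _ _ => rfl⟩ (by
      rintro x hx τ hr - ⟨Y, h1, h3, h4, h5, h6⟩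
      set ρ := (τ.setReg 31 x).setMem x 1 with hρ
      set u : Fin n := ⟨x, hx⟩ with hu
      have hE : Env G K B ρ := by
        -- The auxiliary loop only serves as a statement that writes no variable but `31`.
        refine (h.frame_of_adj (by decide) hr h6).frame_of_adj
          (s := for_ 31 (v 0) (store (v 31) (c 1))) (by decide) (fun r hr => ?_) fun a ha _ => ?_
        · simp only [wr, Bool.or_false, beq_eq_false_iff_ne] at hr
          simp [hρ, hr]
        · rw [hρ, State.setMem_mem, if_neg (by omega), State.setReg_mem]
      have hrow : ∀ (ρ : State) (b : ℕ), (∀ a < n, ρ.mem a = if a = x then b else τ.mem a) →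
          Row n 0 (fun a => if a = x then b else indN (toNat Y) a) ρ := by
        intro ρ b hρ a ha
        have := h1 a ha
        simp only [mul_zero, zero_add] at this ⊢
        rw [hρ a ha, this]
      have hins : (fun a => if a = x then 1 else indN (toNat Y) a) = indN (toNat (insert u Y)) := by
        have : toNat (insert u Y) = insert x (toNat Y) := map_insert ..
        funext a
        rw [this, indN_insert]
      have hY' : Row n 0 (indN (toNat (insert u Y))) ρ := by
        rw [← hins]
        exact hrow ρ 1 fun a _ => by rw [hρ, State.setMem_mem, State.setReg_mem]
      obtain ⟨h7, h8, h9⟩ := coreProg_spec_found hE hY' (i := i)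
        (show ρ.reg 2 = i by simp [hρ, hr 2 rfl, h2]) hi
      have r31 : (coreProg.den ρ).reg 31 = x := by rw [den_reg coreProg rfl]; simp [hρ]
      have hden : (store (v 31) (c 1) ;; coreProg ;; store (v 31) (v 9)).den (τ.setReg 31 x) =
          (coreProg.den ρ).setMem x ((coreProg.den ρ).reg 9) := by
        have : (store (v 31) (c 1)).den (τ.setReg 31 x) = ρ := by simp [hρ]
        rw [den_seq, den_seq, this, den_store, eval_v, eval_v, r31]
      rw [hden]
      have hmem : ∀ a < n, ((coreProg.den ρ).setMem x ((coreProg.den ρ).reg 9)).mem a =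
          if a = x then (coreProg.den ρ).reg 9 else τ.mem a := by
        intro a ha
        rw [State.setMem_mem]
        split_ifs with hax
        · rfl
        · rw [h9 a (by nlinarith), hρ, State.setMem_mem, if_neg hax, State.setReg_mem]
      have hadj : ∀ a, n ≤ a → a < n * (n + 1) →
          ((coreProg.den ρ).setMem x ((coreProg.den ρ).reg 9)).mem a = σ.mem a := by
        intro a ha ha'
        rw [State.setMem_mem, if_neg (by omega), h9 a ha', hρ, State.setMem_mem, if_neg (by omega),
          State.setReg_mem, h6 a ha ha']
      by_cases hf : IsFound G K (insert u Y) i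
      · refine ⟨insert u Y, ?_, h3.trans (subset_insert _ _), ?_, ?_, hadj⟩
        · rw [← hins, ← h7 hf]
          exact hrow _ _ hmem
        · obtain ⟨m, _, hg⟩ := hf
          obtain ⟨Z, hZ, hYZ, hc⟩ := exists_core_of_isGood hG hg
          have := hmin Z hZ (h3.trans ((subset_insert _ _).trans hYZ))
          exact ⟨Z, hZ, hYZ, by omega⟩
        · rintro w hw hwY ⟨Z, hZ, hYZ, hc⟩
          rw [mem_insert, not_or] at hwY
          have hne : (w : ℕ) ≠ x := fun h => hwY.1 (Fin.ext h)
          exact h5 w (by omega) hwY.2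
            ⟨Z, hZ, (insert_subset_insert _ (subset_insert _ _)).trans hYZ, hc⟩
      · have hnot : ¬ ∃ Z : Finset (Fin n), G.IsConnectedCore (Z : Set (Fin n)) ∧
            insert u Y ⊆ Z ∧ Z.card = i + 1 := fun ⟨Z, hZ, hYZ, hc⟩ => hf (exists_isGood hZ hYZ hc hi)
        -- A vertex that is already in `Y` passes the test, because `Y` extends to a core; so
        -- writing `0` never deletes an element.
        have huY : u ∉ Y := by
          intro huY
          rw [insert_eq_of_mem huY] at hnot
          exact hnot h4
        refine ⟨Y, ?_, h3, h4, ?_, hadj⟩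
        · have := hrow _ _ hmem
          intro a ha
          rw [this a ha]
          dsimp only
          rw [h8 hf]
          split_ifs with hax
          · subst hax
            exact (if_neg fun h => huY ((mem_toNat (a := u)).1 h)).symm
          · rfl
        · intro w hw hwY
          by_cases hwx : w = u
          · rw [hwx]; exact hnot
          · have hne : (w : ℕ) ≠ x := fun h => hwx (Fin.ext h)
            exact h5 w (by omega) hwY)
  obtain ⟨Y, h1, h3, ⟨Z, hZ, hYZ, hc⟩, h5, -⟩ := this
  have : Y = Z := by
    refine Subset.antisymm hYZ fun u hu => ?_
    by_contra huY
    exact h5 u (Nat.zero_le _) huY ⟨Z, hZ, insert_subset hu hYZ, hc⟩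
  subst this
  exact ⟨Y, hZ, h3, hc, h1⟩

theorem answerProg_spec (hG : G.Connected) (hn : 2 ≤ n) {k : ℕ} (hK : K = n - (n - k))
    (h : Env G K B σ) {X : Finset (Fin n)} (hX : Row n 0 (indN (toNat X)) σ) :
    ∃ out, IsAnswer G X k out ∧ (answerProg.den σ).reg 32 = (if out.isSome then 1 else 0) ∧
      ∀ Z ∈ out, Row n 0 (indN (toNat Z)) (answerProg.den σ) := by
  have hnt : Nontrivial (Fin n) := Fin.nontrivial_iff_two_le.2 hn
  have hpos : ∀ Z : Finset (Fin n), G.IsConnectedCore (Z : Set (Fin n)) → 1 ≤ Z.card := by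
    intro Z hZ
    obtain ⟨z, hz⟩ := hZ.1.nonempty hG
    exact card_pos.2 ⟨z, hz⟩
  have hcn : ∀ Z : Finset (Fin n), Z.card ≤ n := fun Z => by simpa using card_le_univ Z
  obtain ⟨h1, hlow⟩ := sizeProg_spec h (by omega) hX
  have hden : answerProg.den σ = (ite (v 8) (set 2 (v 8 - c 1) ;; extendProg ;; set 32 (c 1))
      (set 32 (c 0))).den (sizeProg.den σ) := rfl
  set ρ := sizeProg.den σ with hρ
  have hE : Env G K B ρ := h.den (by decide) hlow
  rw [hden]
  rcases h1 with ⟨h8, h9⟩ | ⟨i, hi, h8, hf, h9⟩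
  · rw [den_ite_neg (by simpa using h8)]
    refine ⟨none, ?_, by simp, by simp⟩
    rintro ⟨Z, hZ, hXZ, hc⟩
    have h3 := hpos Z hZ
    have h4 := hcn Z
    -- A spanning tree of `Z` has `Z.card - 1` edges. This number is below `K = min n k`, as `1 ≤
    -- Z.card`, `Z.card ≤ k` and `Z.card ≤ n`.
    exact h9 (Z.card - 1) (by omega) (exists_isGood hZ hXZ (by omega) (by omega))
  · rw [den_ite_pos (by simp [h8]), den_seq, den_seq, den_set, den_set]
    have hmin : ∀ Z : Finset (Fin n), G.IsConnectedCore (Z : Set (Fin n)) → X ⊆ Z →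
        i + 1 ≤ Z.card := by
      intro Z hZ hXZ
      by_contra! hlt
      have h3 := hpos Z hZ
      exact h9 (Z.card - 1) (by omega) (exists_isGood hZ hXZ (by omega) (by omega))
    obtain ⟨m, _, hg⟩ := hf
    obtain ⟨Z₀, hZ₀, hXZ₀, hc₀⟩ := exists_core_of_isGood hG hg
    have hl : 0 + 1 ≤ n + 1 := by omega
    obtain ⟨Z, hZ, hXZ, hc, hrow⟩ := extendProg_spec hG (hE.setReg 2 i (by decide))
      ((hX.low hlow (Nat.mul_le_mul_left _ hl)).of_mem_eq rfl) (i := i) (by simp) hi hmin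
      ⟨Z₀, hZ₀, hXZ₀, le_antisymm hc₀ (hmin Z₀ hZ₀ hXZ₀)⟩
    have hval : (v 8 - c 1).eval ρ = i := by simp [h8]
    rw [hval]
    refine ⟨some Z, ⟨⟨hZ, hXZ, fun Z' hZ' hXZ' => hc ▸ hmin Z' hZ' hXZ'⟩, by omega⟩, by simp, ?_⟩
    rintro Z' hZ'
    cases hZ'
    exact hrow.of_mem_eq rfl

end MinConnectedCore

namespace MinConnectedCore

open RAM RAM.Ex RAM.St Finset

variable {n : ℕ} {G : SimpleGraph (Fin n)} {K B : ℕ} {σ τ : State}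

/-! ### The constants -/

theorem set_cost_le (h : Sized B σ) (x : ℕ) {e : Ex} (he : e.wf = true) :
    (set x e).cost σ ≤ (set x e).cst * (B + 1) ^ 2 := by
  have h1 := e.cost_le h he
  have h2 := (e.size_eval_le h he).1
  simp only [St.cost, St.cst]
  nlinarith [Nat.zero_le (e.len * B), Nat.zero_le (e.len * B ^ 2)]

/-- The modulus cannot be computed under the syntactic check, which relies on the modulus and
forbids writing it. So this loop is analysed by hand; the hypothesis on `τ.reg 4 * 2 ^ N` keeps all
intermediate values at most `2 ^ B`. -/
theorem doubling_loop (B : ℕ) : ∀ (N : ℕ) (τ : State), N ≤ B → Sized (B + 1) τ →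
    τ.reg 4 * 2 ^ N ≤ 2 ^ B →
    loopCost (set 4 (v 4 + v 4)).den (set 4 (v 4 + v 4)).cost 19 N τ ≤
        1 + N * ((7 + (set 4 (v 4 + v 4)).cst) * (B + 2) ^ 2) ∧
      Sized (B + 1) (loopDen (set 4 (v 4 + v 4)).den 19 N τ) ∧
      (loopDen (set 4 (v 4 + v 4)).den 19 N τ).reg 4 = τ.reg 4 * 2 ^ N := by
  have hlt : ∀ x, x ≤ 2 ^ B → x < 2 ^ (B + 1) := fun x hx =>
    lt_of_le_of_lt hx (Nat.pow_lt_pow_right (by norm_num) (by omega))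
  intro N
  induction N with
  | zero => intro τ _ h _; exact ⟨by simp [loopCost], h, by simp [loopDen]⟩
  | succ N ih =>
    intro τ hN h h4
    have hNB : N + 1 ≤ 2 ^ B := hN.trans B.lt_two_pow_self.le
    have h1 : Sized (B + 1) (τ.setReg 19 N) := h.setReg _ (hlt _ (by omega))
    have h2 : (set 4 (v 4 + v 4)).den (τ.setReg 19 N) =
        (τ.setReg 19 N).setReg 4 (τ.reg 4 + τ.reg 4) := by simp
    have h3 : (τ.reg 4 + τ.reg 4) * 2 ^ N = τ.reg 4 * 2 ^ (N + 1) := by ring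
    have h5 : τ.reg 4 + τ.reg 4 ≤ 2 ^ B :=
      (Nat.le_mul_of_pos_right _ (by positivity)).trans (h3.trans_le h4)
    obtain ⟨h6, h7, h8⟩ := ih ((τ.setReg 19 N).setReg 4 (τ.reg 4 + τ.reg 4)) (by omega)
      (h1.setReg _ (hlt _ h5)) (by simpa [h3] using h4)
    refine ⟨?_, by rw [loopDen, h2]; exact h7, by rw [loopDen, h2, h8]; simp [h3]⟩
    have h9 := set_cost_le h1 4 (e := v 4 + v 4) rfl
    have h10 : 5 + 2 * Nat.size (N + 1) ≤ 7 * 1 * (B + 1 + 1) ^ 2 :=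
      test_time_le (Nat.size_le.2 (hlt _ hNB)) le_rfl
    rw [loopCost, h2]
    calc _ ≤ 7 * 1 * (B + 1 + 1) ^ 2 + (set 4 (v 4 + v 4)).cst * (B + 1 + 1) ^ 2 +
          (1 + N * ((7 + (set 4 (v 4 + v 4)).cst) * (B + 2) ^ 2)) := by gcongr
      _ = _ := by ring

/-- The constant in the running time of the computation of the modulus. -/
def modulusCst : ℕ :=
  (set 20 (v 0 * v 0 + c 4 * v 0 + c 1)).cst + (set 4 (c 1)).cst + (set 19 (v 20)).cst + 1 +
    (7 + (set 4 (v 4 + v 4)).cst)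

theorem modulusProg_spec (hB : B = n * n + 4 * n + 1) (h0 : σ.reg 0 = n) (h : Sized (B + 1) σ) :
    (modulusProg.den σ).reg 4 = 2 ^ B ∧ Sized (B + 1) (modulusProg.den σ) ∧
      modulusProg.cost σ ≤ modulusCst * (B + 2) ^ 3 := by
  have hlt : ∀ x, x ≤ 2 ^ B → x < 2 ^ (B + 1) := fun x hx =>
    lt_of_le_of_lt hx (Nat.pow_lt_pow_right (by norm_num) (by omega))
  have hBB : B ≤ 2 ^ B := B.lt_two_pow_self.le
  have hev : (v 0 * v 0 + c 4 * v 0 + c 1).eval σ = B := by simp [h0, hB]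
  set τ := (σ.setReg 20 B).setReg 4 1 with hτ
  have s1 : Sized (B + 1) (σ.setReg 20 B) := h.setReg _ (hlt _ hBB)
  have s2 : Sized (B + 1) τ := s1.setReg _ (hlt _ Nat.one_le_two_pow)
  have h20 : (v 20).eval τ = B := by simp [hτ]
  obtain ⟨h1, h2, h3⟩ := doubling_loop B B (τ.setReg 19 B) le_rfl (s2.setReg _ (hlt _ hBB))
    (by simp [hτ])
  have hden : modulusProg.den σ = loopDen (set 4 (v 4 + v 4)).den 19 B (τ.setReg 19 B) := by
    simp only [modulusProg, den_seq, den_set, hev, eval_c, ← hτ]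
    simp only [St.den, h20]
  rw [hden]
  refine ⟨by rw [h3]; simp [hτ], h2, ?_⟩
  have hcost : modulusProg.cost σ = (set 20 (v 0 * v 0 + c 4 * v 0 + c 1)).cost σ +
      ((set 4 (c 1)).cost (σ.setReg 20 B) + ((set 19 (v 20)).cost τ +
        loopCost (set 4 (v 4 + v 4)).den (set 4 (v 4 + v 4)).cost 19 B (τ.setReg 19 B))) := by
    simp only [modulusProg, St.cost, den_set, hev, eval_c, ← hτ, h20]
    ring
  have c1 := set_cost_le h 20 (e := v 0 * v 0 + c 4 * v 0 + c 1) rfl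
  have c2 := set_cost_le s1 4 (e := c 1) rfl
  have c3 := set_cost_le s2 19 (e := v 20) rfl
  have p1 : (B + 1 + 1) ^ 2 ≤ (B + 2) ^ 3 := Nat.pow_le_pow_right (by omega) (by norm_num)
  have p2 : B * (B + 2) ^ 2 ≤ (B + 2) ^ 3 := by
    rw [pow_succ' _ 2]; gcongr; omega
  rw [hcost]
  calc _ ≤ (set 20 (v 0 * v 0 + c 4 * v 0 + c 1)).cst * (B + 2) ^ 3 +
        ((set 4 (c 1)).cst * (B + 2) ^ 3 + ((set 19 (v 20)).cst * (B + 2) ^ 3 +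
          (1 * (B + 2) ^ 3 + (7 + (set 4 (v 4 + v 4)).cst) * (B + 2) ^ 3))) := by
        refine add_le_add (c1.trans (Nat.mul_le_mul_left _ p1)) (add_le_add
          (c2.trans (Nat.mul_le_mul_left _ p1)) (add_le_add (c3.trans (Nat.mul_le_mul_left _ p1))
          (h1.trans (add_le_add ?_ ?_))))
        · rw [one_mul]; exact Nat.one_le_pow _ _ (by omega)
        · rw [mul_left_comm]; exact Nat.mul_le_mul_left _ p2
    _ = _ := by simp only [modulusCst]; ring

theorem powerProg_spec (h0 : σ.reg 0 = n) (h3 : σ.reg 3 = K) (h4 : σ.reg 4 = 2 ^ B)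
    (hK : 3 ^ K < 2 ^ B) (hn : n * n * n < 2 ^ B) :
    (powerProg.den σ).reg 5 = 3 ^ K ∧ (powerProg.den σ).reg 6 = 2 ^ K ∧
      (powerProg.den σ).reg 7 = n * n * n := by
  have hK' : ∀ j ≤ K, 3 ^ j < 2 ^ B := fun j hj =>
    lt_of_le_of_lt (Nat.pow_le_pow_right (by norm_num) hj) hK
  have := den_for (x := 21) (e := v 3) (σ := (σ.setReg 5 1).setReg 6 1) (N := K)
    (s := set 5 ((v 5 * c 3) % v 4) ;; set 6 ((v 6 * c 2) % v 4))
    (fun i τ => τ.reg 5 = 3 ^ (K - i) ∧ τ.reg 6 = 2 ^ (K - i))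
    (by simp [h3]) (by simp) (by
      rintro i hi τ hr - ⟨h5, h6⟩
      have h4' : τ.reg 4 = 2 ^ B := (hr 4 rfl).trans (by simp [h4])
      have e1 : K - i = K - (i + 1) + 1 := by omega
      have l1 := hK' (K - i) (by omega)
      have l2 : 2 ^ (K - i) ≤ 3 ^ (K - i) := Nat.pow_le_pow_left (by norm_num) _
      rw [e1, pow_succ] at l1
      rw [e1, pow_succ, pow_succ] at l2
      have l3 := l2.trans_lt l1
      simp [h4', h5, h6, e1, pow_succ, Nat.mod_eq_of_lt l1, Nat.mod_eq_of_lt l3])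
  set τ := (for_ 21 (v 3) (set 5 ((v 5 * c 3) % v 4) ;; set 6 ((v 6 * c 2) % v 4))).den
    ((σ.setReg 5 1).setReg 6 1) with hτ
  have h0' : τ.reg 0 = n := by rw [hτ, den_reg _ rfl]; simpa using h0
  have h4' : τ.reg 4 = 2 ^ B := by rw [hτ, den_reg _ rfl]; simpa using h4
  have hden : powerProg.den σ = τ.setReg 7 (n * n * n) := by
    have : powerProg.den σ = (set 7 ((v 0 * v 0 * v 0) % v 4)).den τ := rfl
    rw [this]
    simp [h0', h4', Nat.mod_eq_of_lt hn]
  rw [hden]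
  simpa using this

theorem three_pow_lt (hKn : K ≤ n) (hB : B = n * n + 4 * n + 1) : 3 ^ K < 2 ^ B :=
  calc 3 ^ K ≤ 4 ^ K := Nat.pow_le_pow_left (by norm_num) _
    _ = 2 ^ (2 * K) := by rw [pow_mul]; norm_num
    _ < 2 ^ B := Nat.pow_lt_pow_right (by norm_num) (by rw [hB]; nlinarith)

theorem cube_lt (hB : B = n * n + 4 * n + 1) : n * n * n < 2 ^ B := by
  have h : n ≤ 2 ^ n := n.lt_two_pow_self.le
  calc n * n * n ≤ 2 ^ n * 2 ^ n * 2 ^ n := by gcongr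
    _ = 2 ^ (n + n + n) := by rw [pow_add, pow_add]
    _ < 2 ^ B := Nat.pow_lt_pow_right (by norm_num) (by rw [hB]; nlinarith)

/-- With `n ≤ 2 ^ n` and `K ≤ n`, the four factors contribute `n`, `n`, `2 n` and `n ^ 2` to the
exponent. This dictates the choice of `B`. -/
theorem count_lt (hKn : K ≤ n) (hB : B = n * n + 4 * n + 1) :
    2 ^ K * (n * (4 ^ K * n ^ K)) < 2 ^ B := by
  have h : n ≤ 2 ^ n := n.lt_two_pow_self.le
  calc 2 ^ K * (n * (4 ^ K * n ^ K)) ≤ 2 ^ n * (2 ^ n * ((2 ^ 2) ^ n * (2 ^ n) ^ n)) := by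
        have h1 : n ^ K ≤ (2 ^ n) ^ n :=
          (Nat.pow_le_pow_left h K).trans (Nat.pow_le_pow_right (by positivity) hKn)
        have h2 : 4 ^ K ≤ (2 ^ 2) ^ n := Nat.pow_le_pow_right (by norm_num) hKn
        have h3 : 2 ^ K ≤ 2 ^ n := Nat.pow_le_pow_right (by norm_num) hKn
        gcongr
    _ = 2 ^ (n + (n + (2 * n + n * n))) := by
        rw [← pow_mul, ← pow_mul, ← pow_add, ← pow_add, ← pow_add]
    _ < 2 ^ B := Nat.pow_lt_pow_right (by norm_num) (by rw [hB]; omega)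

/-- The state in which the main computation starts. -/
theorem env_of_constants {k : ℕ} (hK : K = n - (n - k)) (hB : B = n * n + 4 * n + 1)
    (h0 : σ.reg 0 = n) (h3 : σ.reg 3 = K) (hadj : ∀ a < n, Row n (a + 1) (adjN G a) σ)
    (h : Sized (B + 1) σ) : Env G K B (powerProg.den (modulusProg.den σ)) := by
  have hKn : K ≤ n := by omega
  have r4 := (modulusProg_spec hB h0 h).1
  have r0 : (modulusProg.den σ).reg 0 = n := by rw [den_reg _ rfl, h0]
  have r3 : (modulusProg.den σ).reg 3 = K := by rw [den_reg _ rfl, h3]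
  obtain ⟨r5, r6, r7⟩ := powerProg_spec r0 r3 r4 (three_pow_lt hKn hB) (cube_lt hB)
  exact {
    reg0 := by rw [den_reg powerProg rfl, r0]
    reg3 := by rw [den_reg powerProg rfl, r3]
    reg4 := by rw [den_reg powerProg rfl, r4]
    reg5 := r5
    reg6 := r6
    reg7 := r7
    adj := fun a ha => (hadj a ha).of_mem_eq (by rw [den_mem powerProg rfl, den_mem modulusProg rfl])
    one_le := by omega
    cube_lt := cube_lt hB
    count_lt := count_lt hKn hB }

/-! ### Correctness -/

theorem input_row (G : SimpleGraph (Fin n)) (X : Finset (Fin n)) (k : ℕ) :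
    Row n 0 (indN (toNat X)) (input G X k) := by
  intro a ha
  have h1 : ¬ ∃ u v : Fin n, G.Adj u v ∧ n * 0 + a = n + n * (u : ℕ) + (v : ℕ) := by
    rintro ⟨u, w, -, h⟩
    omega
  have h2 : (∃ w ∈ X, n * 0 + a = (w : ℕ)) ↔ a ∈ toNat X := by
    simp [toNat, eq_comm]
  simp only [input, h1, or_false, h2, indN]

theorem input_adj (G : SimpleGraph (Fin n)) (X : Finset (Fin n)) (k : ℕ) :
    ∀ a < n, Row n (a + 1) (adjN G a) (input G X k) := by
  intro a ha b hb
  have h1 : ¬ ∃ w ∈ X, n * (a + 1) + b = (w : ℕ) := by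
    rintro ⟨w, -, h⟩
    have := w.2
    nlinarith
  have h2 : (∃ u w : Fin n, G.Adj u w ∧ n * (a + 1) + b = n + n * (u : ℕ) + (w : ℕ)) ↔
      G.Adj ⟨a, ha⟩ ⟨b, hb⟩ := by
    constructor
    · rintro ⟨u, w, h, he⟩
      have : n * (a + 1) + b = n * (u + 1) + w := by rw [he]; ring
      obtain ⟨h3, h4⟩ := (cell_eq_iff hb w.2).1 this
      have hu : (⟨a, ha⟩ : Fin n) = u := Fin.ext (by simpa using h3)
      have hw : (⟨b, hb⟩ : Fin n) = w := Fin.ext h4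
      rwa [hu, hw]
    · exact fun h => ⟨_, _, h, by simp only; ring⟩
  classical
  have h3 := adjN_val G ⟨a, ha⟩ ⟨b, hb⟩
  simp only [input, h1, false_or, h2]
  rw [h3]

/-- The state after the initial assignments. -/
noncomputable def start (G : SimpleGraph (Fin n)) (X : Finset (Fin n)) (k : ℕ) : State :=
  ((input G X k).setReg 3 (n - (n - k))).setReg 1 0

theorem start_reg (X : Finset (Fin n)) (k r : ℕ) :
    (start G X k).reg r = if r = 0 then n else if r = 3 then n - (n - k) else 0 := by
  simp only [start, State.setReg_reg, input]
  split_ifs <;> first | rfl | omega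

theorem input_mem_le_one (X : Finset (Fin n)) (k a : ℕ) : (input G X k).mem a ≤ 1 := by
  simp only [input]
  split_ifs <;> simp

theorem mainProg_den (X : Finset (Fin n)) (k : ℕ) :
    mainProg.den (input G X k) = (ite (v 0 - c 1)
      (modulusProg ;; powerProg ;; answerProg ;; set 0 (v 32))
      (set 0 (c 1 - (ld (c 0) - v 3)))).den (start G X k) := rfl

theorem mainProg_spec (hG : G.Connected) (X : Finset (Fin n)) (k : ℕ) :
    ∃ out, IsAnswer G X k out ∧
      (mainProg.den (input G X k)).reg 0 = (if out.isSome then 1 else 0) ∧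
      ∀ Z ∈ out, Row n 0 (indN (toNat Z)) (mainProg.den (input G X k)) := by
  have hpos : 1 ≤ n := by
    obtain ⟨w⟩ := hG.nonempty
    exact w.pos
  have hrow : Row n 0 (indN (toNat X)) (start G X k) := (input_row G X k).of_mem_eq rfl
  have r0 : (start G X k).reg 0 = n := by simp [start_reg]
  have r3 : (start G X k).reg 3 = n - (n - k) := by simp [start_reg]
  rw [mainProg_den]
  rcases hpos.lt_or_eq with hn | rfl
  · rw [den_ite_pos (by simp only [eval_sub, eval_v, eval_c, r0]; omega)]
    set B := n * n + 4 * n + 1 with hB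
    have hBn : n ≤ B := by rw [hB]; nlinarith
    have hs : Sized (B + 1) (start G X k) := by
      have h2 : n < 2 ^ (B + 1) :=
        hBn.trans_lt (Nat.lt_succ_self B |>.trans (B + 1).lt_two_pow_self)
      refine ⟨fun r _ => ?_, fun a => ?_⟩
      · rw [start_reg]; split_ifs <;> omega
      · exact lt_of_le_of_lt (input_mem_le_one X k a) (by omega)
    have hE : Env G (n - (n - k)) B _ := env_of_constants (K := n - (n - k)) rfl hB r0 r3
      (fun a ha => (input_adj G X k a ha).of_mem_eq rfl) hs
    obtain ⟨out, h1, h2, h3⟩ := answerProg_spec hG hn rfl hE (X := X)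
      (hrow.of_mem_eq (by rw [den_mem powerProg rfl, den_mem modulusProg rfl]))
    refine ⟨out, h1, ?_, fun Z hZ => (h3 Z hZ).of_mem_eq rfl⟩
    simpa using h2
  -- For a single vertex every set is a connected core, so `X` itself is the answer exactly if it
  -- has at most `k` elements. Cell `0` holds the size of `X`, and already serves as the output.
  · rw [den_ite_neg (by simp [r0])]
    have hX : (start G X k).mem 0 = X.card := by
      have := hrow 0 (by norm_num)
      rw [mul_zero, add_zero] at this
      rw [this]
      rcases X.eq_empty_or_nonempty with rfl | ⟨w, hw⟩
      · simp [indN, toNat]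
      · have : X = {0} := by
          ext u
          simp only [Subsingleton.elim u w, hw, mem_singleton, true_iff]
          exact Subsingleton.elim _ _
        subst this
        simp [indN, toNat]
    have hval : ((set 0 (c 1 - (ld (c 0) - v 3))).den (start G X k)).reg 0 =
        1 - (X.card - (1 - (1 - k))) := by
      simp [r3, hX]
    have hc : X.card ≤ 1 := by simpa using card_le_univ X
    by_cases hk : X.card ≤ k
    · refine ⟨some X, ⟨⟨SimpleGraph.isConnectedCore_of_subsingleton G _, Subset.rfl,
        fun Z _ h => card_le_card h⟩, hk⟩, ?_, ?_⟩
      · rw [hval]; simp only [Option.isSome_some, if_true]; omega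
      · intro Z hZ
        cases hZ
        exact hrow.of_mem_eq rfl
    · refine ⟨none, ?_, ?_, by simp⟩
      · rintro ⟨Z, -, h, h'⟩
        exact hk ((card_le_card h).trans h')
      · rw [hval]
        have : ¬ ((none : Option (Finset (Fin 1))).isSome = true) := by simp
        rw [if_neg this]
        omega

/-! ### Running time -/

theorem add_le_bound {n k t t' A A' a a' : ℕ} (hn : 1 ≤ n) (h : t ≤ A * 6 ^ k * n ^ a)
    (h' : t' ≤ A' * 6 ^ k * n ^ a') : t + t' ≤ (A + A') * 6 ^ k * n ^ (a + a') := by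
  have h1 : n ^ a ≤ n ^ (a + a') := Nat.pow_le_pow_right hn (by omega)
  have h2 : n ^ a' ≤ n ^ (a + a') := Nat.pow_le_pow_right hn (by omega)
  calc t + t' ≤ A * 6 ^ k * n ^ (a + a') + A' * 6 ^ k * n ^ (a + a') :=
        add_le_add (h.trans (Nat.mul_le_mul_left _ h1)) (h'.trans (Nat.mul_le_mul_left _ h2))
    _ = _ := by ring

/-- The bounds on the loop variables. -/
def loopBound (n K r : ℕ) : ℕ := if r = 5 then 3 ^ K else if r = 6 then 2 ^ K else n ^ 3

/-- Loops bounded by variable `5` or variable `6` are not nested within their own kind, so they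
contribute at most `3 ^ K * 2 ^ K = 6 ^ K`; every other loop contributes at most `n ^ 3`. -/
theorem shape_loopBound_le (hn : 1 ≤ n) (s : St) (h5 : s.dep 5 ≤ 1) (h6 : s.dep 6 ≤ 1) :
    s.shape (loopBound n K) ≤ 6 ^ K * n ^ (3 * ∑ r ∈ range 10, s.dep r) := by
  have h : ∀ r ∈ range 10, loopBound n K r ^ s.dep r ≤
      (if r = 5 then 3 ^ K else 1) * (if r = 6 then 2 ^ K else 1) * (n ^ 3) ^ s.dep r := by
    intro r _
    have h1 : 1 ≤ (n ^ 3) ^ s.dep r := Nat.one_le_pow _ _ (Nat.one_le_pow _ _ hn)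
    unfold loopBound
    split_ifs with h h' h'
    · omega
    · subst h
      rw [mul_one]
      exact (Nat.pow_le_pow_right (by positivity) h5).trans
        (by rw [pow_one]; exact Nat.le_mul_of_pos_right _ h1)
    · subst h'
      rw [one_mul]
      exact (Nat.pow_le_pow_right (by positivity) h6).trans
        (by rw [pow_one]; exact Nat.le_mul_of_pos_right _ h1)
    · rw [one_mul, one_mul]
  refine (prod_le_prod' h).trans (le_of_eq ?_)
  rw [prod_mul_distrib, prod_mul_distrib, prod_ite_eq', prod_ite_eq', prod_pow_eq_pow_sum,
    ← pow_mul, if_pos (by simp), if_pos (by simp), ← mul_pow]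
  norm_num

theorem cost_le_of_chk {fz : ℕ → Bool} {k : ℕ} (hn : 1 ≤ n) (hK : K ≤ k)
    (hB : B = n * n + 4 * n + 1) (hfz : fz modVar = true) {s : St} (hs : s.chk fz = true)
    (h5 : s.dep 5 ≤ 1) (h6 : s.dep 6 ≤ 1) (h4 : σ.reg 4 = 2 ^ B) (h : Sized (B + 1) σ)
    (hσ : ∀ r, fz r = true → r ≠ modVar → σ.reg r ≤ loopBound n K r) :
    s.cost σ ≤ (64 * s.cst) * 6 ^ k * n ^ (4 + 3 * ∑ r ∈ range 10, s.dep r) ∧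
      Sized (B + 1) (s.den σ) := by
  obtain ⟨h1, h2⟩ := St.cost_le (ρ := loopBound n K) (by omega) hfz
    (fun r => by
      unfold loopBound
      split_ifs
      exacts [Nat.one_le_pow _ _ (by norm_num), Nat.one_le_pow _ _ (by norm_num),
        Nat.one_le_pow _ _ hn]) s σ hs (by rw [h4]; positivity) h hσ
  refine ⟨h1.trans ?_, h2⟩
  -- Here `B + 2 = n ^ 2 + 4 n + 3` and `n ≥ 1`; squaring yields the `64` and the `4` in the bound.
  have h3 : B + 1 + 1 ≤ 8 * n ^ 2 := by rw [hB]; nlinarith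
  calc _ ≤ s.cst * (6 ^ k * n ^ (3 * ∑ r ∈ range 10, s.dep r)) * (8 * n ^ 2) ^ 2 := by
        gcongr
        refine (shape_loopBound_le hn s h5 h6).trans ?_
        gcongr
        norm_num
    _ = _ := by ring

/-- For the few steps in which the input `k`, possibly far above `2 ^ B`, may still be in a
register. A polynomial in `k` is absorbed by `6 ^ k`; afterwards only `min n k` is kept and variable
`1` is cleared. -/
theorem small_cost_le {k t C : ℕ} (hn : 1 ≤ n) (h : t ≤ C * (n + k + 1) ^ 2) :
    t ≤ (4 * C) * 6 ^ k * n ^ 2 := by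
  have h1 : n + k + 1 ≤ 2 * (n * (k + 1)) := by nlinarith
  have h2 : k + 1 ≤ 2 ^ k := k.lt_two_pow_self
  have h3 : (2 ^ k) ^ 2 ≤ 6 ^ k := by
    rw [← pow_mul, mul_comm, pow_mul]
    exact Nat.pow_le_pow_left (by norm_num) _
  calc t ≤ C * (2 * (n * 2 ^ k)) ^ 2 := h.trans (by gcongr; exact h1.trans (by gcongr))
    _ = (4 * C) * (2 ^ k) ^ 2 * n ^ 2 := by ring
    _ ≤ _ := by gcongr

/-- The variables that the computation of the powers does not write. -/
def isBasic (r : ℕ) : Bool := r == 0 || r == 3 || r == 4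

/-- The variables that the main computation does not write. -/
def isConst (r : ℕ) : Bool := r == 0 || r == 3 || r == 4 || r == 5 || r == 6 || r == 7

/-- The constant in the running time of the main computation. -/
def mainCst : ℕ := 512 * modulusCst + (64 * powerProg.cst + (64 * answerProg.cst +
  64 * (set 0 (v 32)).cst))

/-- The exponent in the running time of the main computation. -/
def mainExp : ℕ := 6 + ((4 + 3 * ∑ r ∈ range 10, powerProg.dep r) +
  ((4 + 3 * ∑ r ∈ range 10, answerProg.dep r) + 4))

theorem main_cost_le (hn : 1 ≤ n) {k : ℕ} (h0 : σ.reg 0 = n) (h3 : σ.reg 3 = n - (n - k))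
    (hadj : ∀ a < n, Row n (a + 1) (adjN G a) σ) (hB : B = n * n + 4 * n + 1)
    (h : Sized (B + 1) σ) :
    (modulusProg ;; powerProg ;; answerProg ;; set 0 (v 32)).cost σ ≤
      mainCst * 6 ^ k * n ^ mainExp := by
  have hBn : B + 1 + 1 ≤ 8 * n ^ 2 := by rw [hB]; nlinarith
  have hn3 : n ≤ n ^ 3 := Nat.le_self_pow (by norm_num) n
  have h6 : 1 ≤ 6 ^ k := Nat.one_le_pow _ _ (by norm_num)
  have hE := env_of_constants rfl hB h0 h3 hadj h
  obtain ⟨h4, s1, c1⟩ := modulusProg_spec hB h0 h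
  have r0 : (modulusProg.den σ).reg 0 = n := by rw [den_reg _ rfl, h0]
  have r3 : (modulusProg.den σ).reg 3 = n - (n - k) := by rw [den_reg _ rfl, h3]
  have hb : ∀ r, loopBound n (n - (n - k)) r = if r = 5 then 3 ^ (n - (n - k)) else
    if r = 6 then 2 ^ (n - (n - k)) else n ^ 3 := fun _ => rfl
  obtain ⟨c2, s2⟩ := cost_le_of_chk (fz := isBasic) (K := n - (n - k)) (k := k) hn (by omega) hB rfl
    (s := powerProg) rfl (by decide) (by decide) h4 s1 (by
      intro r hr hr'
      simp only [isBasic, Bool.or_eq_true, beq_iff_eq] at hr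
      rcases hr with (rfl | rfl) | rfl
      · simpa [hb, r0] using hn3
      · simp only [hb, r3]; norm_num; omega
      · exact absurd rfl hr')
  obtain ⟨c3, s3⟩ := cost_le_of_chk (fz := isConst) (K := n - (n - k)) (k := k) hn (by omega) hB rfl
    (s := answerProg) rfl (by decide) (by decide) hE.reg4 s2 (by
      intro r hr hr'
      simp only [isConst, Bool.or_eq_true, beq_iff_eq] at hr
      rcases hr with ((((rfl | rfl) | rfl) | rfl) | rfl) | rfl
      · simpa [hb, hE.reg0] using hn3
      · simp only [hb, hE.reg3]; norm_num; omega
      · exact absurd rfl hr'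
      · simp [hb, hE.reg5]
      · simp [hb, hE.reg6]
      · simp only [hb, hE.reg7]; norm_num; exact le_of_eq (by ring))
  have c4 := set_cost_le s3 0 (e := v 32) rfl
  refine add_le_bound hn (c1.trans ?_) (add_le_bound hn c2 (add_le_bound hn c3 (c4.trans ?_)))
  · calc _ ≤ modulusCst * (8 * n ^ 2) ^ 3 := by gcongr
      _ = 512 * modulusCst * 1 * n ^ 6 := by ring
      _ ≤ _ := by gcongr
  · calc _ ≤ (set 0 (v 32)).cst * (8 * n ^ 2) ^ 2 := by gcongr
      _ = 64 * (set 0 (v 32)).cst * 1 * n ^ 4 := by ring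
      _ ≤ _ := by gcongr

theorem mainProg_cost_le : ∃ A c : ℕ, ∀ (n : ℕ) (G : SimpleGraph (Fin n)) (X : Finset (Fin n))
    (k : ℕ), 1 ≤ n → mainProg.cost (input G X k) ≤ A * 6 ^ k * n ^ c := by
  refine ⟨4 * (set 3 (v 0 - (v 0 - v 1))).cst + (4 * (set 1 (c 0)).cst +
    (4 * (set 0 (v 0 - c 1)).cst + (mainCst + 4 * (set 0 (c 1 - (ld (c 0) - v 3))).cst))),
    2 + (2 + (2 + (mainExp + 2))), fun n G X k hn => ?_⟩
  have hlt : ∀ x, x ≤ n + k → x < 2 ^ (n + k) := fun x hx => hx.trans_lt (n + k).lt_two_pow_self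
  have s0 : Sized (n + k) (input G X k) := by
    refine ⟨fun r _ => ?_, fun a => hlt _ ((input_mem_le_one X k a).trans (by omega))⟩
    simp only [input]
    split_ifs <;> exact hlt _ (by omega)
  have s1 : Sized (n + k) ((input G X k).setReg 3 (n - (n - k))) := s0.setReg _ (hlt _ (by omega))
  have s2 : Sized (n + k) (start G X k) := s1.setReg _ (hlt _ (by omega))
  have r0 : (start G X k).reg 0 = n := by simp [start_reg]
  have r3 : (start G X k).reg 3 = n - (n - k) := by simp [start_reg]
  have c1 := small_cost_le hn (set_cost_le s0 3 (e := v 0 - (v 0 - v 1)) rfl)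
  have c2 := small_cost_le hn (set_cost_le s1 1 (e := c 0) rfl)
  have c3 := small_cost_le hn (set_cost_le s2 0 (e := v 0 - c 1) rfl)
  have c4 := small_cost_le hn (set_cost_le s2 0 (e := c 1 - (ld (c 0) - v 3)) rfl)
  have c5 : (modulusProg ;; powerProg ;; answerProg ;; set 0 (v 32)).cost (start G X k) ≤
      mainCst * 6 ^ k * n ^ mainExp := by
    refine main_cost_le (G := G) hn r0 r3 (fun a ha => (input_adj G X k a ha).of_mem_eq rfl) rfl ?_
    have h2 : n < 2 ^ (n * n + 4 * n + 1 + 1) :=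
      lt_of_le_of_lt (by nlinarith) (n * n + 4 * n + 1 + 1).lt_two_pow_self
    refine ⟨fun r _ => ?_, fun a => ?_⟩
    · rw [start_reg]; split_ifs <;> omega
    · exact lt_of_le_of_lt (input_mem_le_one X k a) (by omega)
  have hcost : mainProg.cost (input G X k) = (set 3 (v 0 - (v 0 - v 1))).cost (input G X k) +
      ((set 1 (c 0)).cost ((input G X k).setReg 3 (n - (n - k))) +
        (ite (v 0 - c 1) (modulusProg ;; powerProg ;; answerProg ;; set 0 (v 32))
          (set 0 (c 1 - (ld (c 0) - v 3)))).cost (start G X k)) := by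
    rw [mainProg, St.cost, St.cost]
    rfl
  have hite : ∀ (e : Ex) (s t : St) (τ : State), (ite e s t).cost τ ≤
      (set 0 e).cost τ + (s.cost τ + t.cost τ) := by
    intro e s t τ
    rw [St.cost, St.cost, ← add_assoc]
    refine add_le_add le_rfl ?_
    split_ifs
    exacts [Nat.le_add_right _ _, Nat.le_add_left _ _]
  rw [hcost]
  exact (Nat.add_le_add_left (Nat.add_le_add_left (hite _ _ _ _) _) _).trans (add_le_bound hn c1
    (add_le_bound hn c2 (add_le_bound hn c3 (add_le_bound hn c5 c4))))

end MinConnectedCore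

/-! ### Correctness and running time of the compiled program -/

theorem mainTheorem5 :
    ∃ (P : RAM.Program) (A c : ℕ), ∀ (n : ℕ) (G : SimpleGraph (Fin n)), G.Connected →
      ∀ (X : Finset (Fin n)) (k : ℕ),
        ∃ (σ : RAM.State) (t : ℕ) (out : Option (Finset (Fin n))),
          RAM.Exec P (MinConnectedCore.input G X k) σ t ∧
          t ≤ A * 6 ^ k * n ^ c ∧
          MinConnectedCore.Outputs σ out ∧
          MinConnectedCore.IsAnswer G X k out := by
  obtain ⟨A, c, hA⟩ := MinConnectedCore.mainProg_cost_le
  refine ⟨MinConnectedCore.mainProg.code, A, c, fun n G hG X k => ?_⟩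
  obtain ⟨w⟩ := hG.nonempty
  obtain ⟨σ, t, h1, h2, hm, hr⟩ := RAM.St.exec_code MinConnectedCore.mainProg
    (MinConnectedCore.input G X k) _ rfl ⟨rfl, fun _ _ => rfl⟩
  obtain ⟨out, h3, h4, h5⟩ := MinConnectedCore.mainProg_spec hG X k
  refine ⟨σ, t, out, h1, h2.trans (hA n G X k w.pos), ?_, h3⟩
  have h6 := (hr 0 (by norm_num)).trans h4
  cases out with
  | none => exact h6
  | some Z =>
    refine ⟨h6, fun u => ?_⟩
    have h7 := h5 Z rfl u u.2
    rw [mul_zero, zero_add] at h7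
    rw [hm, h7]
    simp [MinConnectedCore.indN]
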